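/- Let $\mathbb P$ be a Borel probability measure on $\mathbb R$. For $n\ge 0$ let $\mathcal F_n$ be the $\sigma$-algebra generated by the dyadic intervals $[k2^{-n},(k+1)2^{-n})$, $k\in\mathbb Z$; let $A_j=[j,j+1)$, $j\in\mathbb Z$, and let $\mathbb E_n$ denote the conditional expectation given $\mathcal F_n$ (the average over the dyadic intervals of length $2^{-n}$). For $0<p,q<\infty$ put $$\|g\|_{L_{p,q}}=\Big(\sum_{j\in\mathbb Z}\Big(\int_{A_j}|g|^p\,d\mathbb P\Big)^{q/p}\Big)^{1/q}.$$ Let $\mathcal M$ be the space of real sequences $f=(f_n)_{n\ge0}$ with $f_0=0$ such that $(f_n\mathbf 1_{A_j})_{n\ge 0}$ is a martingale with respect to $(\mathcal F_n)_{n\ge 0}$ for every $j\in\mathbb Z$ (so $f$ is a dyadic martingale; each $f_n$ is integrable on each $A_j$, but integrability over all of $\mathbb R$ is not required), where sequences that agree almost everywhere are identified. Put $d_nf=f_n-f_{n-1}$ for $n\ge1$, $d_0f=0$, $f^*=\sup_n|f_n|$ and $s(f)=\big(\sum_{n\ge1}\mathbb E_{n-1}|d_nf|^2\big)^{1/2}$.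 Let $H^*_{p,q}$, $H^s_{p,q}$ and $\mathcal{BD}_{p,q}$ be the spaces of all $f\in\mathcal M$ for which, respectively, $$\|f\|_{H^*_{p,q}}=\|f^*\|_{L_{p,q}},\qquad \|f\|_{H^s_{p,q}}=\|s(f)\|_{L_{p,q}},\qquad \|f\|_{\mathcal{BD}_{p,q}}=\big\|\sup_n|d_nf|\big\|_{L_{p,q}}$$ is finite. **Theorem.** Let $1<q\le p\le2$ and $\frac1p+\frac1{p'}=\frac1q+\frac1{q'}=1$. The dual space of $H^*_{p,q}$ is $H^s_{p',q'}\cap\mathcal{BD}_{p',q'}$ with the norm $$\|\phi\|=\|\phi\|_{H^s_{p',q'}}+\|\phi\|_{\mathcal{BD}_{p',q'}},$$ up to equivalence of norms. More precisely, write $f_\infty=\lim_n f_n$ and $\phi_\infty=\lim_n\phi_n$ (almost everywhere limits). For all $f\in H^*_{p,q}$ and $\phi\in H^s_{p',q'}\cap\mathcal{BD}_{p',q'}$ the product $f_\infty\phi_\infty$ is integrable, and $$\phi\longmapsto\kappa_\phi,\qquad \kappa_\phi(f)=\mathbb E(f_\infty\phi_\infty),$$ is a linear isomorphism of $H^s_{p',q'}\cap\mathcal{BD}_{p',q'}$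 onto the dual space of $H^*_{p,q}$ with $$c\,\|\phi\|\le\|\kappa_\phi\|\le C\,\|\phi\|,$$ where $c,C>0$ depend only on $p$ and $q$. -/

import Mathlib

open MeasureTheory ProbabilityTheory Filter Topology
open scoped ENNReal

noncomputable section

namespace DyadicAmalgam

/-! ### The dyadic filtration of the real line -/

/-- The dyadic interval `[k / 2^n, (k + 1) / 2^n)`. -/
def dyadic (n : ℕ) (k : ℤ) : Set ℝ := Set.Ico ((k : ℝ) / 2 ^ n) (((k : ℝ) + 1) / 2 ^ n)

/-- The unit interval `A_j = [j, j + 1)`. -/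
def unitInterval (j : ℤ) : Set ℝ := Set.Ico (j : ℝ) ((j : ℝ) + 1)

theorem mem_dyadic {n : ℕ} {k : ℤ} {x : ℝ} : x ∈ dyadic n k ↔ ⌊x * 2 ^ n⌋ = k := by
  have h : (0 : ℝ) < 2 ^ n := by positivity
  rw [dyadic, Set.mem_Ico, Int.floor_eq_iff, div_le_iff₀ h, lt_div_iff₀ h]

theorem dyadic_split (n : ℕ) (k : ℤ) :
    dyadic n k = dyadic (n + 1) (2 * k) ∪ dyadic (n + 1) (2 * k + 1) := by
  ext x
  simp only [Set.mem_union, mem_dyadic, Int.floor_eq_iff, pow_succ]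
  push_cast
  constructor
  · rintro ⟨h1, h2⟩
    by_cases h : x * (2 ^ n * 2) < 2 * (k : ℝ) + 1
    · left; constructor <;> linarith
    · right; constructor <;> linarith
  · rintro (⟨h1, h2⟩ | ⟨h1, h2⟩) <;> constructor <;> linarith

/-- The dyadic filtration: the `n`-th σ-algebra is generated by the dyadic intervals of length
`2^(-n)`. -/
def dyadicFiltration : Filtration ℕ (inferInstance : MeasurableSpace ℝ) where
  seq n := MeasurableSpace.generateFrom (Set.range (dyadic n))
  mono' := monotone_nat_of_le_succ fun n ↦ by
    refine MeasurableSpace.generateFrom_le ?_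
    rintro _ ⟨k, rfl⟩
    rw [dyadic_split]
    exact MeasurableSet.union (MeasurableSpace.measurableSet_generateFrom (Set.mem_range_self _))
      (MeasurableSpace.measurableSet_generateFrom (Set.mem_range_self _))
  le' n := by
    refine MeasurableSpace.generateFrom_le ?_
    rintro _ ⟨k, rfl⟩
    exact measurableSet_Ico

theorem measurableSet_dyadic (n : ℕ) (k : ℤ) : MeasurableSet[dyadicFiltration n] (dyadic n k) :=
  MeasurableSpace.measurableSet_generateFrom ⟨k, rfl⟩

/-- A set of the `n`-th σ-algebra is a union of dyadic intervals of length `2^(-n)`. -/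
theorem mem_iff_of_dyadic {n : ℕ} {k : ℤ} {x y : ℝ} (hx : x ∈ dyadic n k) (hy : y ∈ dyadic n k)
    (s : Set ℝ) (hs : MeasurableSet[dyadicFiltration n] s) : x ∈ s ↔ y ∈ s := by
  refine MeasurableSpace.generateFrom_induction (Set.range (dyadic n))
    (fun s _ ↦ (x ∈ s ↔ y ∈ s)) ?_ ?_ ?_ ?_ s hs
  · rintro _ ⟨l, rfl⟩ _
    rw [mem_dyadic] at hx hy
    rw [mem_dyadic, mem_dyadic, hx, hy]
  · simp
  · intro t _ h
    simp [h]
  · intro t _ h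
    simp [h]

/-- Conditional expectations given the `n`-th dyadic σ-algebra are averages over the dyadic
intervals of length `2^(-n)`. -/
theorem condLExp_dyadic_ae (P : Measure ℝ) [IsProbabilityMeasure P] (n : ℕ) (g : ℝ → ℝ≥0∞) :
    ∀ᵐ x ∂P, (P⁻[g|dyadicFiltration n]) x =
      (∫⁻ y in dyadic n ⌊x * 2 ^ n⌋, g y ∂P) * (P (dyadic n ⌊x * 2 ^ n⌋))⁻¹ := by
  have hnull : ∀ᵐ x ∂P, ∀ k : ℤ, P (dyadic n k) = 0 → x ∉ dyadic n k := by
    rw [ae_all_iff]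
    intro k
    by_cases hk : P (dyadic n k) = 0
    · filter_upwards [measure_eq_zero_iff_ae_notMem.1 hk] with x hx _ using hx
    · exact ae_of_all _ fun x h ↦ absurd h hk
  filter_upwards [hnull] with x hx
  have hxm : x ∈ dyadic n ⌊x * 2 ^ n⌋ := mem_dyadic.2 rfl
  set I := dyadic n ⌊x * 2 ^ n⌋ with hI
  have h0 : P I ≠ 0 := fun h ↦ hx _ h hxm
  have hIm : MeasurableSet[dyadicFiltration n] I := measurableSet_dyadic n _
  have hconst : ∀ y ∈ I, (P⁻[g|dyadicFiltration n]) y = (P⁻[g|dyadicFiltration n]) x := by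
    intro y hy
    have hm := measurable_condLExp (dyadicFiltration n) P g
      (measurableSet_singleton ((P⁻[g|dyadicFiltration n]) x))
    have := (mem_iff_of_dyadic hxm hy _ hm).1 rfl
    exact this
  have h1 := setLIntegral_condLExp (dyadicFiltration.le n) P g hIm
  rw [setLIntegral_congr_fun (dyadicFiltration.le n _ hIm) hconst, setLIntegral_const] at h1
  rw [← h1, mul_assoc, ENNReal.mul_inv_cancel h0 (measure_ne_top P I), mul_one]

/-! ### Martingales, square function and amalgam norms -/

/-- The space `𝓜` of real dyadic martingales with `f 0 = 0`.  On each unit interval `A_j` (which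
belongs to every σ-algebra of the filtration) `f` is a martingale in the usual sense.  Global
integrability of `f n` is not required: conditional expectations given the dyadic σ-algebras are
averages over dyadic intervals, on each of which every `f n` is bounded. -/
def martingales (P : Measure ℝ) : Submodule ℝ (ℕ → ℝ → ℝ) where
  carrier := {f | f 0 = 0 ∧
    ∀ j : ℤ, Martingale (fun n ↦ (unitInterval j).indicator (f n)) dyadicFiltration P}
  zero_mem' := ⟨rfl, fun j ↦ by
    have h : (fun n ↦ (unitInterval j).indicator ((0 : ℕ → ℝ → ℝ) n)) = 0 := by
      funext n
      simp
    rw [h]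
    exact martingale_zero ℝ dyadicFiltration P⟩
  add_mem' := by
    rintro f g ⟨hf0, hf⟩ ⟨hg0, hg⟩
    refine ⟨by simp [hf0, hg0], fun j ↦ ?_⟩
    have h := (hf j).add (hg j)
    convert h using 1
    funext n
    simp [Set.indicator_add']
  smul_mem' := by
    rintro c f ⟨hf0, hf⟩
    refine ⟨by simp [hf0], fun j ↦ ?_⟩
    have h := (hf j).smul c
    convert h using 1
    funext n
    exact Set.indicator_const_smul _ c (f n)

/-- The maximal function `f^* = sup_n |f_n|`. -/
def maximal (f : ℕ → ℝ → ℝ) (x : ℝ) : ℝ≥0∞ := ⨆ n, ‖f n x‖ₑ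

/-- The largest jump `sup_n |d_n f|`, where `d_n f = f_n - f_{n-1}` and `d_0 f = 0`. -/
def maxJump (f : ℕ → ℝ → ℝ) (x : ℝ) : ℝ≥0∞ := ⨆ n, ‖f (n + 1) x - f n x‖ₑ

/-- The conditional quadratic variation `s(f) = (∑_{n ≥ 1} E_{n-1} |d_n f|^2)^{1/2}`. -/
def condSquare (P : Measure ℝ) (f : ℕ → ℝ → ℝ) (x : ℝ) : ℝ≥0∞ :=
  (∑' n : ℕ, (P⁻[fun y ↦ ‖f (n + 1) y - f n y‖ₑ ^ (2 : ℝ)|dyadicFiltration n]) x) ^ (1 / 2 : ℝ)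

/-- The norm of the amalgam space `L_{p,q}` of `L_p` and `ℓ_q`, `0 < p, q < ∞`. -/
def amalgamNorm (P : Measure ℝ) (p q : ℝ) (g : ℝ → ℝ≥0∞) : ℝ≥0∞ :=
  (∑' j : ℤ, (∫⁻ x in unitInterval j, g x ^ p ∂P) ^ (q / p)) ^ (1 / q)

theorem measurable_of_mem {P : Measure ℝ} {f : ℕ → ℝ → ℝ} (hf : f ∈ martingales P) (n : ℕ) :
    Measurable (f n) := by
  have h : ∀ j : ℤ, Measurable ((unitInterval j).indicator (f n)) := fun j ↦
    (((hf.2 j).1 n).mono (dyadicFiltration.le n)).measurable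
  intro s hs
  have : f n ⁻¹' s = ⋃ j : ℤ, unitInterval j ∩ ((unitInterval j).indicator (f n)) ⁻¹' s := by
    ext x
    simp only [Set.mem_preimage, Set.mem_iUnion, Set.mem_inter_iff]
    constructor
    · intro hx
      have hm : x ∈ unitInterval ⌊x⌋ := ⟨Int.floor_le x, Int.lt_floor_add_one x⟩
      exact ⟨⌊x⌋, hm, by rwa [Set.indicator_of_mem hm]⟩
    · rintro ⟨j, hm, hx⟩
      rwa [Set.indicator_of_mem hm] at hx
  rw [this]
  exact MeasurableSet.iUnion fun j ↦ measurableSet_Ico.inter (h j hs)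

theorem measurable_maximal {P : Measure ℝ} {f : ℕ → ℝ → ℝ} (hf : f ∈ martingales P) :
    Measurable (maximal f) :=
  Measurable.iSup fun n ↦ (measurable_of_mem hf n).enorm

theorem measurable_maxJump {P : Measure ℝ} {f : ℕ → ℝ → ℝ} (hf : f ∈ martingales P) :
    Measurable (maxJump f) :=
  Measurable.iSup fun n ↦ ((measurable_of_mem hf (n + 1)).sub (measurable_of_mem hf n)).enorm

theorem measurable_condSquare (P : Measure ℝ) (f : ℕ → ℝ → ℝ) : Measurable (condSquare P f) :=
  (Measurable.tsum fun _ ↦ measurable_condLExp' _ _ _).pow_const _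

/-- Minkowski's inequality in `ℓ_q`. -/
theorem tsum_Lp_add_le {ι : Type*} {q : ℝ} (hq : 1 ≤ q) (a b : ι → ℝ≥0∞) :
    (∑' j, (a j + b j) ^ q) ^ (1 / q) ≤ (∑' j, a j ^ q) ^ (1 / q) + (∑' j, b j ^ q) ^ (1 / q) := by
  let _ : MeasurableSpace ι := ⊤
  have hc : ∀ u : ι → ℝ≥0∞, ∫⁻ j, u j ∂Measure.count = ∑' j, u j := fun u ↦
    lintegral_count' measurable_from_top
  have h := ENNReal.lintegral_Lp_add_le (μ := Measure.count) (f := a) (g := b)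
    (measurable_from_top (f := a)).aemeasurable (measurable_from_top (f := b)).aemeasurable hq
  simpa only [hc, Pi.add_apply] using h

theorem amalgamNorm_mono {P : Measure ℝ} {p q : ℝ} (hp : 1 ≤ p) (hq : 1 ≤ q) {g h : ℝ → ℝ≥0∞}
    (hgh : ∀ᵐ x ∂P, g x ≤ h x) : amalgamNorm P p q g ≤ amalgamNorm P p q h := by
  unfold amalgamNorm
  refine ENNReal.rpow_le_rpow (ENNReal.tsum_le_tsum fun j ↦ ENNReal.rpow_le_rpow ?_
    (by positivity)) (by positivity)
  refine lintegral_mono_ae (ae_restrict_of_ae ?_)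
  filter_upwards [hgh] with x hx using ENNReal.rpow_le_rpow hx (by positivity)

theorem amalgamNorm_add_le {P : Measure ℝ} {p q : ℝ} (hp : 1 ≤ p) (hq : 1 ≤ q) {g h : ℝ → ℝ≥0∞}
    (hg : Measurable g) (hh : Measurable h) :
    amalgamNorm P p q (fun x ↦ g x + h x) ≤ amalgamNorm P p q g + amalgamNorm P p q h := by
  have key : ∀ u : ℝ → ℝ≥0∞, amalgamNorm P p q u =
      (∑' j : ℤ, ((∫⁻ x in unitInterval j, u x ^ p ∂P) ^ (1 / p)) ^ q) ^ (1 / q) := by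
    intro u
    unfold amalgamNorm
    congr 2
    ext j
    rw [← ENNReal.rpow_mul]
    congr 1
    ring
  rw [key, key, key]
  refine le_trans ?_ (tsum_Lp_add_le hq _ _)
  refine ENNReal.rpow_le_rpow (ENNReal.tsum_le_tsum fun j ↦ ENNReal.rpow_le_rpow ?_
    (by positivity)) (by positivity)
  exact ENNReal.lintegral_Lp_add_le hg.aemeasurable hh.aemeasurable hp

theorem amalgamNorm_const_mul {P : Measure ℝ} {p q : ℝ} (hp : 1 ≤ p) (hq : 1 ≤ q) {c : ℝ≥0∞}
    (hc : c ≠ ∞) (g : ℝ → ℝ≥0∞) :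
    amalgamNorm P p q (fun x ↦ c * g x) = c * amalgamNorm P p q g := by
  have hp0 : 0 < p := by linarith
  have hq0 : 0 < q := by linarith
  unfold amalgamNorm
  have h : ∀ j : ℤ, (∫⁻ x in unitInterval j, (c * g x) ^ p ∂P) ^ (q / p) =
      c ^ q * (∫⁻ x in unitInterval j, g x ^ p ∂P) ^ (q / p) := by
    intro j
    simp_rw [ENNReal.mul_rpow_of_nonneg _ _ hp0.le]
    rw [lintegral_const_mul' _ _ (ENNReal.rpow_ne_top_of_nonneg hp0.le hc),
      ENNReal.mul_rpow_of_nonneg _ _ (by positivity), ← ENNReal.rpow_mul]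
    congr 2
    field_simp
  simp_rw [h]
  rw [ENNReal.tsum_mul_left, ENNReal.mul_rpow_of_nonneg _ _ (by positivity), ← ENNReal.rpow_mul]
  congr 1
  rw [mul_one_div_cancel hq0.ne', ENNReal.rpow_one]

theorem maximal_add_le (f g : ℕ → ℝ → ℝ) (x : ℝ) :
    maximal (f + g) x ≤ maximal f x + maximal g x :=
  iSup_le fun n ↦ (enorm_add_le _ _).trans
    (add_le_add (le_iSup (fun n ↦ ‖f n x‖ₑ) n) (le_iSup (fun n ↦ ‖g n x‖ₑ) n))

theorem maximal_smul (c : ℝ) (f : ℕ → ℝ → ℝ) (x : ℝ) :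
    maximal (c • f) x = ‖c‖ₑ * maximal f x := by
  simp [maximal, enorm_mul, ENNReal.mul_iSup]

theorem maxJump_add_le (f g : ℕ → ℝ → ℝ) (x : ℝ) :
    maxJump (f + g) x ≤ maxJump f x + maxJump g x := by
  refine iSup_le fun n ↦ ?_
  have h : (f + g) (n + 1) x - (f + g) n x = (f (n + 1) x - f n x) + (g (n + 1) x - g n x) := by
    simp only [Pi.add_apply]; ring
  rw [h]
  exact (enorm_add_le _ _).trans
    (add_le_add (le_iSup (fun n ↦ ‖f (n + 1) x - f n x‖ₑ) n)
      (le_iSup (fun n ↦ ‖g (n + 1) x - g n x‖ₑ) n))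

theorem maxJump_smul (c : ℝ) (f : ℕ → ℝ → ℝ) (x : ℝ) :
    maxJump (c • f) x = ‖c‖ₑ * maxJump f x := by
  simp [maxJump, ← mul_sub, enorm_mul, ENNReal.mul_iSup]

theorem condSquare_add_le {P : Measure ℝ} [IsProbabilityMeasure P] {f g : ℕ → ℝ → ℝ}
    (hf : f ∈ martingales P) (hg : g ∈ martingales P) :
    ∀ᵐ x ∂P, condSquare P (f + g) x ≤ condSquare P f x + condSquare P g x := by
  have h1 := ae_all_iff.2 fun n ↦
    condLExp_dyadic_ae P n (fun y ↦ ‖(f + g) (n + 1) y - (f + g) n y‖ₑ ^ (2 : ℝ))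
  have h2 := ae_all_iff.2 fun n ↦
    condLExp_dyadic_ae P n (fun y ↦ ‖f (n + 1) y - f n y‖ₑ ^ (2 : ℝ))
  have h3 := ae_all_iff.2 fun n ↦
    condLExp_dyadic_ae P n (fun y ↦ ‖g (n + 1) y - g n y‖ₑ ^ (2 : ℝ))
  filter_upwards [h1, h2, h3] with x hx1 hx2 hx3
  have key : ∀ n, ((P⁻[fun y ↦ ‖(f + g) (n + 1) y - (f + g) n y‖ₑ ^ (2 : ℝ)|
      dyadicFiltration n]) x) ^ (1 / 2 : ℝ) ≤
      ((P⁻[fun y ↦ ‖f (n + 1) y - f n y‖ₑ ^ (2 : ℝ)|dyadicFiltration n]) x) ^ (1 / 2 : ℝ) +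
      ((P⁻[fun y ↦ ‖g (n + 1) y - g n y‖ₑ ^ (2 : ℝ)|dyadicFiltration n]) x) ^ (1 / 2 : ℝ) := by
    intro n
    rw [hx1 n, hx2 n, hx3 n]
    simp_rw [ENNReal.mul_rpow_of_nonneg _ _ (show (0 : ℝ) ≤ 1 / 2 by norm_num)]
    rw [← add_mul]
    gcongr
    have hm : ∀ u ∈ martingales P, Measurable fun y ↦ ‖u (n + 1) y - u n y‖ₑ := fun u hu ↦
      ((measurable_of_mem hu (n + 1)).sub (measurable_of_mem hu n)).enorm
    refine le_trans ?_ (ENNReal.lintegral_Lp_add_le (hm f hf).aemeasurable (hm g hg).aemeasurable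
      (p := 2) (by norm_num))
    gcongr with y
    have h : (f + g) (n + 1) y - (f + g) n y =
        (f (n + 1) y - f n y) + (g (n + 1) y - g n y) := by
      simp only [Pi.add_apply]; ring
    rw [h]
    exact enorm_add_le _ _
  have sq : ∀ a : ℝ≥0∞, (a ^ (1 / 2 : ℝ)) ^ (2 : ℝ) = a := fun a ↦ by
    rw [← ENNReal.rpow_mul]; norm_num
  have h4 := tsum_Lp_add_le (q := 2) (by norm_num)
    (fun n ↦ ((P⁻[fun y ↦ ‖f (n + 1) y - f n y‖ₑ ^ (2 : ℝ)|dyadicFiltration n]) x) ^ (1 / 2 : ℝ))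
    (fun n ↦ ((P⁻[fun y ↦ ‖g (n + 1) y - g n y‖ₑ ^ (2 : ℝ)|dyadicFiltration n]) x) ^ (1 / 2 : ℝ))
  simp only [sq] at h4
  refine le_trans ?_ h4
  refine ENNReal.rpow_le_rpow (ENNReal.tsum_le_tsum fun n ↦ ?_) (by norm_num)
  rw [← sq ((P⁻[_|dyadicFiltration n]) x)]
  exact ENNReal.rpow_le_rpow (key n) (by norm_num)

theorem condSquare_smul {P : Measure ℝ} [IsProbabilityMeasure P] (c : ℝ) (f : ℕ → ℝ → ℝ) :
    ∀ᵐ x ∂P, condSquare P (c • f) x = ‖c‖ₑ * condSquare P f x := by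
  have h1 := ae_all_iff.2 fun n ↦
    condLExp_dyadic_ae P n (fun y ↦ ‖(c • f) (n + 1) y - (c • f) n y‖ₑ ^ (2 : ℝ))
  have h2 := ae_all_iff.2 fun n ↦
    condLExp_dyadic_ae P n (fun y ↦ ‖f (n + 1) y - f n y‖ₑ ^ (2 : ℝ))
  filter_upwards [h1, h2] with x hx1 hx2
  have h3 : ∀ n, (P⁻[fun y ↦ ‖(c • f) (n + 1) y - (c • f) n y‖ₑ ^ (2 : ℝ)|
      dyadicFiltration n]) x = ‖c‖ₑ ^ (2 : ℝ) *
      (P⁻[fun y ↦ ‖f (n + 1) y - f n y‖ₑ ^ (2 : ℝ)|dyadicFiltration n]) x := by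
    intro n
    rw [hx1 n, hx2 n, ← mul_assoc, ← lintegral_const_mul' _ _
      (ENNReal.rpow_ne_top_of_nonneg (by norm_num) enorm_ne_top)]
    congr 2
    ext y
    rw [← ENNReal.mul_rpow_of_nonneg _ _ (by norm_num), ← enorm_mul]
    simp only [Pi.smul_apply, smul_eq_mul, mul_sub]
  unfold condSquare
  simp_rw [h3]
  rw [ENNReal.tsum_mul_left, ENNReal.mul_rpow_of_nonneg _ _ (by norm_num), ← ENNReal.rpow_mul]
  norm_num

/-! ### The spaces -/

/-- A (possibly infinite) seminorm on the space of dyadic martingales. -/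
structure MartingaleNorm (P : Measure ℝ) where
  toFun : (ℕ → ℝ → ℝ) → ℝ≥0∞
  add_le' : ∀ f ∈ martingales P, ∀ g ∈ martingales P, toFun (f + g) ≤ toFun f + toFun g
  smul' : ∀ (c : ℝ), ∀ f ∈ martingales P, toFun (c • f) = ‖c‖ₑ * toFun f

/-- The space of all dyadic martingales of finite norm. -/
def MartingaleNorm.space {P : Measure ℝ} (N : MartingaleNorm P) : Submodule ℝ (ℕ → ℝ → ℝ) where
  carrier := {f | f ∈ martingales P ∧ N.toFun f < ∞}
  zero_mem' := ⟨zero_mem _, by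
    have h := N.smul' 0 0 (zero_mem _)
    rw [zero_smul, enorm_zero, zero_mul] at h
    exact h.le.trans_lt ENNReal.zero_lt_top⟩
  add_mem' := fun {f g} hf hg ↦ ⟨add_mem hf.1 hg.1,
    (N.add_le' f hf.1 g hg.1).trans_lt (ENNReal.add_lt_top.2 ⟨hf.2, hg.2⟩)⟩
  smul_mem' := fun c f hf ↦ ⟨Submodule.smul_mem _ c hf.1, by
    rw [N.smul' c f hf.1]
    exact ENNReal.mul_lt_top enorm_lt_top hf.2⟩

theorem MartingaleNorm.toReal_add_le {P : Measure ℝ} (N : MartingaleNorm P) {f g : ℕ → ℝ → ℝ}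
    (hf : f ∈ N.space) (hg : g ∈ N.space) :
    (N.toFun (f + g)).toReal ≤ (N.toFun f).toReal + (N.toFun g).toReal := by
  rw [← ENNReal.toReal_add hf.2.ne hg.2.ne]
  exact ENNReal.toReal_mono (ENNReal.add_ne_top.2 ⟨hf.2.ne, hg.2.ne⟩) (N.add_le' f hf.1 g hg.1)

theorem MartingaleNorm.toReal_smul {P : Measure ℝ} (N : MartingaleNorm P) (c : ℝ) {f : ℕ → ℝ → ℝ}
    (hf : f ∈ N.space) : (N.toFun (c • f)).toReal = ‖c‖ * (N.toFun f).toReal := by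
  rw [N.smul' c f hf.1, ENNReal.toReal_mul, toReal_enorm]

section Norms

variable (P : Measure ℝ) [IsProbabilityMeasure P] (p q : ℝ) (hp : 1 ≤ p) (hq : 1 ≤ q)

/-- The norm `‖f‖_{H^*_{p,q}} = ‖f^*‖_{L_{p,q}}`. -/
def starNorm : MartingaleNorm P where
  toFun f := amalgamNorm P p q (maximal f)
  add_le' f hf g hg := (amalgamNorm_mono hp hq (ae_of_all _ (maximal_add_le f g))).trans
    (amalgamNorm_add_le hp hq (measurable_maximal hf) (measurable_maximal hg))
  smul' c f _ := by
    rw [← amalgamNorm_const_mul hp hq enorm_ne_top]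
    congr 1
    ext x
    exact maximal_smul c f x

/-- The norm `‖f‖_{H^s_{p,q}} = ‖s(f)‖_{L_{p,q}}`. -/
def condNorm : MartingaleNorm P where
  toFun f := amalgamNorm P p q (condSquare P f)
  add_le' f hf g hg := (amalgamNorm_mono hp hq (condSquare_add_le hf hg)).trans
    (amalgamNorm_add_le hp hq (measurable_condSquare P f) (measurable_condSquare P g))
  smul' c f _ := by
    rw [← amalgamNorm_const_mul hp hq enorm_ne_top]
    exact le_antisymm
      (amalgamNorm_mono hp hq ((condSquare_smul c f).mono fun x hx ↦ hx.le))
      (amalgamNorm_mono hp hq ((condSquare_smul c f).mono fun x hx ↦ hx.ge))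

/-- The norm `‖f‖_{BD_{p,q}} = ‖sup_n |d_n f|‖_{L_{p,q}}`. -/
def jumpNorm : MartingaleNorm P where
  toFun f := amalgamNorm P p q (maxJump f)
  add_le' f hf g hg := (amalgamNorm_mono hp hq (ae_of_all _ (maxJump_add_le f g))).trans
    (amalgamNorm_add_le hp hq (measurable_maxJump hf) (measurable_maxJump hg))
  smul' c f _ := by
    rw [← amalgamNorm_const_mul hp hq enorm_ne_top]
    congr 1
    ext x
    exact maxJump_smul c f x

/-- The space `H^*_{p,q}` of dyadic martingales (before identifying martingales that agree almost
everywhere). -/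
def HStar : Type := (starNorm P p q hp hq).space

/-- The space `H^s_{p,q} ∩ BD_{p,q}` of dyadic martingales (before identifying martingales that
agree almost everywhere). -/
def HsBD : Type :=
  ((condNorm P p q hp hq).space ⊓ (jumpNorm P p q hp hq).space : Submodule ℝ (ℕ → ℝ → ℝ))

end Norms

section Instances

variable {P : Measure ℝ} [IsProbabilityMeasure P] {p q : ℝ} {hp : 1 ≤ p} {hq : 1 ≤ q}

instance : AddCommGroup (HStar P p q hp hq) :=
  inferInstanceAs (AddCommGroup (starNorm P p q hp hq).space)

instance : Module ℝ (HStar P p q hp hq) :=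
  inferInstanceAs (Module ℝ (starNorm P p q hp hq).space)

instance : AddCommGroup (HsBD P p q hp hq) :=
  inferInstanceAs (AddCommGroup ((condNorm P p q hp hq).space ⊓ (jumpNorm P p q hp hq).space :
    Submodule ℝ (ℕ → ℝ → ℝ)))

instance : Module ℝ (HsBD P p q hp hq) :=
  inferInstanceAs (Module ℝ ((condNorm P p q hp hq).space ⊓ (jumpNorm P p q hp hq).space :
    Submodule ℝ (ℕ → ℝ → ℝ)))

/-- The underlying martingale `(f_n)_n` of an element of `H^*_{p,q}`. -/
def HStar.mart (f : HStar P p q hp hq) : ℕ → ℝ → ℝ := f.1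

/-- The underlying martingale `(φ_n)_n` of an element of `H^s_{p,q} ∩ BD_{p,q}`. -/
def HsBD.mart (φ : HsBD P p q hp hq) : ℕ → ℝ → ℝ := φ.1

instance : Norm (HStar P p q hp hq) where
  norm f := (amalgamNorm P p q (maximal f.mart)).toReal

instance : Norm (HsBD P p q hp hq) where
  norm φ := (amalgamNorm P p q (condSquare P φ.mart)).toReal +
    (amalgamNorm P p q (maxJump φ.mart)).toReal

theorem HStar.core : SeminormedSpace.Core ℝ (HStar P p q hp hq) where
  norm_nonneg _ := ENNReal.toReal_nonneg
  norm_smul c f := (starNorm P p q hp hq).toReal_smul c f.2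
  norm_triangle f g := (starNorm P p q hp hq).toReal_add_le f.2 g.2

theorem HsBD.core : SeminormedSpace.Core ℝ (HsBD P p q hp hq) where
  norm_nonneg _ := add_nonneg ENNReal.toReal_nonneg ENNReal.toReal_nonneg
  norm_smul c f :=
    (congrArg₂ (· + ·) ((condNorm P p q hp hq).toReal_smul c f.2.1)
      ((jumpNorm P p q hp hq).toReal_smul c f.2.2)).trans (mul_add _ _ _).symm
  norm_triangle f g :=
    (add_le_add ((condNorm P p q hp hq).toReal_add_le f.2.1 g.2.1)
      ((jumpNorm P p q hp hq).toReal_add_le f.2.2 g.2.2)).trans (add_add_add_comm _ _ _ _).le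

instance : SeminormedAddCommGroup (HStar P p q hp hq) :=
  SeminormedAddCommGroup.ofCore HStar.core

instance : NormedSpace ℝ (HStar P p q hp hq) where
  norm_smul_le c f := (HStar.core.norm_smul c f).le

instance : SeminormedAddCommGroup (HsBD P p q hp hq) :=
  SeminormedAddCommGroup.ofCore HsBD.core

instance : NormedSpace ℝ (HsBD P p q hp hq) where
  norm_smul_le c φ := (HsBD.core.norm_smul c φ).le

end Instances

/-- The almost everywhere limit `f_∞ = lim_n f_n` of a martingale. -/
def limit (P : Measure ℝ) (f : ℕ → ℝ → ℝ) : ℝ → ℝ := dyadicFiltration.limitProcess f P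

end DyadicAmalgam

end

open MeasureTheory ProbabilityTheory Filter Topology
open scoped ENNReal

noncomputable section

namespace DyadicAmalgam

set_option linter.unusedSectionVars false

section

/-! ### Elementary inequalities -/

/-! Because p ≤ 2, the conjugate exponent p' is at least 2. For inner exponents at least 2 the norm
of H^s ∩ BD is equivalent to the norm of the maximal function: the maximal function is bounded by
s(φ) and the largest jump through Rosenthal's inequality (`exists_rosenthal`), s(φ) is bounded by
φ^* (`exists_condVar_le`), and |d_n φ| ≤ 2 φ^*. So the theorem says that H^*_{p,q} and H^*_{p',q'}
are dual to each other. Doob's inequality (`exists_doob`) compares maximal norms with norms of the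
f_n, and what is left is the duality of L_{p,q} and L_{p',q'} on dyadic step functions.

The intervals A_j belong to every F_n. Hence each martingale inequality is proved on a single A_j
with the inner exponent only and is then summed over j; the outer exponent enters only through
Hölder and Minkowski for series. On A_j the function f_n takes finitely many values, so the
inequalities concern bounded martingales and integrability is automatic. All constants are chosen
before the measure P and therefore depend on the exponents alone.

The upper bound for κ_φ is Hölder's inequality for f^* and φ^*. The lower bound and surjectivity
share one argument (`exists_dual_norm_le`). If L is bounded on H^*_{p,q} and L(g - E_0 g) = E(g φ_N)
for F_N-measurable step functions g, then |E(g φ_N)| ≤ C ‖L‖ ‖g‖ by Doob, the converse of Hölder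
bounds φ_N uniformly in N, and Doob again bounds φ^*. For a given L such a φ is obtained by dividing
L(1_I - E_0 1_I) by P(I) on every dyadic interval I. Finally f is approximated by f stopped at N and
restricted to [-N, N), by dominated convergence with majorant 2 f^*, so L and κ_φ agree everywhere.
-/

/-- Young's inequality with a small parameter. -/
theorem exists_young {α β : ℝ} (hα : 0 ≤ α) (hβ : 0 < β) {ε : ℝ} (hε : 0 < ε) :
    ∃ C : ℝ, 0 ≤ C ∧ ∀ a b : ℝ, 0 ≤ a → 0 ≤ b →
      a ^ α * b ^ β ≤ ε * a ^ (α + β) + C * b ^ (α + β) := by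
  -- The threshold satisfies δ^β = ε: for b ≤ δa the first term suffices, and otherwise a ≤ b/δ
  -- makes the second one suffice.
  set δ := ε ^ (1 / β) with hδ
  have hδ0 : 0 < δ := Real.rpow_pos_of_pos hε _
  have hδβ : δ ^ β = ε := by
    rw [hδ, ← Real.rpow_mul hε.le, one_div_mul_cancel hβ.ne', Real.rpow_one]
  refine ⟨(1 / δ) ^ α, by positivity, fun a b ha hb ↦ ?_⟩
  rcases le_total b (δ * a) with h | h
  · have h1 : b ^ β ≤ ε * a ^ β := by
      rw [← hδβ, ← Real.mul_rpow hδ0.le ha]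
      exact Real.rpow_le_rpow hb h hβ.le
    calc a ^ α * b ^ β ≤ a ^ α * (ε * a ^ β) := by gcongr
      _ = ε * a ^ (α + β) := by rw [Real.rpow_add_of_nonneg ha hα hβ.le]; ring
      _ ≤ _ := le_add_of_nonneg_right (by positivity)
  · have h1 : a ^ α ≤ (1 / δ) ^ α * b ^ α := by
      rw [← Real.mul_rpow (by positivity) hb]
      refine Real.rpow_le_rpow ha ?_ hα
      rw [one_div, inv_mul_eq_div, le_div_iff₀ hδ0]
      linarith
    calc a ^ α * b ^ β ≤ ((1 / δ) ^ α * b ^ α) * b ^ β := by gcongr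
      _ = (1 / δ) ^ α * b ^ (α + β) := by rw [Real.rpow_add_of_nonneg hb hα hβ.le]; ring
      _ ≤ _ := le_add_of_nonneg_left (by positivity)

/-- For |rt| ≤ 1 compare with exp(rt) and use |e^s - 1 - s| ≤ s². Otherwise 1 < r|t|, so |1 + t| ≤
(1 + r)|t|, and the quadratic polynomial is nonnegative. The first-order term is kept exact because
it will integrate to zero against a martingale difference. -/
theorem abs_one_add_rpow_le {r : ℝ} (hr : 2 ≤ r) (t : ℝ) :
    |1 + t| ^ r ≤ 1 + r * t + r ^ 2 * t ^ 2 + (1 + r) ^ r * |t| ^ r := by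
  have hr0 : 0 < r := by linarith
  by_cases h : |r * t| ≤ 1
  · have ht : -1 ≤ t := by
      have := (abs_le.1 h).1
      nlinarith
    have h1 : |1 + t| ^ r ≤ Real.exp (r * t) := by
      rw [abs_of_nonneg (by linarith), mul_comm, Real.exp_mul]
      exact Real.rpow_le_rpow (by linarith) (by linarith [Real.add_one_le_exp t]) hr0.le
    have h2 := (abs_le.1 (Real.abs_exp_sub_one_sub_id_le h)).2
    have h3 : 0 ≤ (1 + r) ^ r * |t| ^ r := by positivity
    nlinarith
  · rw [abs_mul, abs_of_pos hr0, not_le] at h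
    have h1 : |1 + t| ≤ (1 + r) * |t| := by
      have := abs_add_le 1 t
      rw [abs_one] at this
      linarith
    have h2 : |1 + t| ^ r ≤ (1 + r) ^ r * |t| ^ r := by
      rw [← Real.mul_rpow (by positivity) (by positivity)]
      exact Real.rpow_le_rpow (abs_nonneg _) h1 hr0.le
    have h3 := neg_abs_le t
    have h4 : r ^ 2 * t ^ 2 = (r * |t|) ^ 2 := by rw [mul_pow, sq_abs]
    rw [h4]
    nlinarith

theorem abs_add_rpow_le {r : ℝ} (hr : 2 ≤ r) (a d : ℝ) :
    |a + d| ^ r ≤ |a| ^ r + r * (|a| ^ (r - 2) * a) * d + r ^ 2 * (|a| ^ (r - 2) * d ^ 2) +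
      (1 + r) ^ r * |d| ^ r := by
  have hr0 : 0 < r := by linarith
  rcases eq_or_ne a 0 with rfl | ha
  · have h1 : |d| ^ r ≤ (1 + r) ^ r * |d| ^ r :=
      le_mul_of_one_le_left (by positivity) (Real.one_le_rpow (by linarith) hr0.le)
    have h2 : 0 ≤ r ^ 2 * (|(0 : ℝ)| ^ (r - 2) * d ^ 2) := by positivity
    rw [zero_add, abs_zero, Real.zero_rpow hr0.ne']
    rw [abs_zero] at h2
    linarith
  · have ha' : 0 < |a| := abs_pos.2 ha
    have h := mul_le_mul_of_nonneg_left (abs_one_add_rpow_le hr (d / a))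
      (Real.rpow_nonneg ha'.le r)
    have e1 : |a| ^ r * |1 + d / a| ^ r = |a + d| ^ r := by
      rw [← Real.mul_rpow ha'.le (abs_nonneg _), ← abs_mul]
      congr 2
      field_simp
    have e2 : |a| ^ r * |d / a| ^ r = |d| ^ r := by
      rw [← Real.mul_rpow ha'.le (abs_nonneg _), ← abs_mul]
      congr 2
      field_simp
    have e3 : |a| ^ r = |a| ^ (r - 2) * a ^ 2 := by
      rw [← sq_abs a, ← Real.rpow_natCast, ← Real.rpow_add ha']
      congr 1
      push_cast
      ring
    rw [e1] at h
    refine h.trans (le_of_eq ?_)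
    have e4 : |a| ^ r * (1 + r * (d / a) + r ^ 2 * (d / a) ^ 2 + (1 + r) ^ r * |d / a| ^ r) =
      |a| ^ r + r * (|a| ^ r * (d / a)) + r ^ 2 * (|a| ^ r * (d / a) ^ 2) +
        (1 + r) ^ r * (|a| ^ r * |d / a| ^ r) := by ring
    rw [e4, e2]
    have e5 : |a| ^ r * (d / a) = |a| ^ (r - 2) * a * d := by
      rw [e3]; field_simp
    have e6 : |a| ^ r * (d / a) ^ 2 = |a| ^ (r - 2) * d ^ 2 := by
      rw [e3]; field_simp
    rw [e5, e6]
    ring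

/-- Here a is the largest earlier jump. A new record is paid for by the increase of the record's
power, and any other jump by the quadratic term. The increments telescope, so the sum of all |d_k|^r
costs only the largest jump and conditional variances. -/
theorem rpow_jump_le {r a d : ℝ} (hr : 2 ≤ r) (ha : 0 ≤ a) :
    |d| ^ r ≤ max a |d| ^ r - a ^ r + a ^ (r - 2) * d ^ 2 := by
  have hr0 : 0 < r := by linarith
  have e : ∀ x : ℝ, 0 ≤ x → x ^ r = x ^ (r - 2) * x ^ 2 := by
    intro x hx
    rw [← Real.rpow_natCast, ← Real.rpow_add_of_nonneg hx (by linarith) (by norm_num)]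
    congr 1
    push_cast
    ring
  rcases le_total |d| a with h | h
  · rw [max_eq_left h, e |d| (abs_nonneg _), sq_abs, sub_self, zero_add]
    gcongr
  · rw [max_eq_right h]
    have : a ^ r ≤ a ^ (r - 2) * d ^ 2 := by
      rw [e a ha, ← sq_abs d]
      gcongr
    linarith

/-- Young's inequality for the product a^(p-1) · b with exponents p/(p-1) and p. -/
theorem rpow_sub_mul_ge {p a b : ℝ} (hp : 1 < p) (ha : 0 ≤ a) (hb : 0 ≤ b) :
    (1 - 1 / p) * (b ^ p - a ^ p) ≤ (b ^ (p - 1) - a ^ (p - 1)) * b := by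
  have hp0 : 0 < p := by linarith
  have hc : (p / (p - 1)).HolderConjugate p := (Real.HolderConjugate.conjExponent hp).symm
  have h := Real.young_inequality_of_nonneg (Real.rpow_nonneg ha (p - 1)) hb hc
  have hp1 : p - 1 ≠ 0 := by linarith
  have e1 : (a ^ (p - 1)) ^ (p / (p - 1)) = a ^ p := by
    rw [← Real.rpow_mul ha]
    congr 1
    field_simp
  have e2 : b ^ (p - 1) * b = b ^ p := by
    nth_rewrite 2 [← Real.rpow_one b]
    rw [← Real.rpow_add_of_nonneg hb (by linarith) zero_le_one]
    congr 1
    ring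
  have e3 : a ^ p / (p / (p - 1)) = (1 - 1 / p) * a ^ p := by
    field_simp
  rw [e1, e3] at h
  rw [sub_mul (b ^ (p - 1)), e2]
  have : b ^ p / p = 1 / p * b ^ p := by ring
  nlinarith

/-- Bernoulli's inequality at -s/(a + s). The derivative is taken at the right end a + s, which for
sums of conditional variances is still predictable. -/
theorem rpow_add_le_mul {α a s : ℝ} (hα : 1 ≤ α) (ha : 0 ≤ a) (hs : 0 ≤ s) :
    (a + s) ^ α ≤ a ^ α + α * (s * (a + s) ^ (α - 1)) := by
  rcases eq_or_lt_of_le (add_nonneg ha hs) with h | h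
  · have : s = 0 := by linarith
    simp [this]
  · have h1 := one_add_mul_self_le_rpow_one_add (s := -(s / (a + s))) (p := α)
      (by rw [neg_le_neg_iff, div_le_one h]; linarith) hα
    have h2 := mul_le_mul_of_nonneg_left h1 (Real.rpow_nonneg h.le α)
    have e1 : (a + s) ^ α * (1 + -(s / (a + s))) ^ α = a ^ α := by
      rw [← Real.mul_rpow h.le]
      · congr 1
        field_simp
        ring
      · have : s / (a + s) ≤ 1 := by rw [div_le_one h]; linarith
        linarith
    have e2 : (a + s) ^ α = (a + s) ^ (α - 1) * (a + s) := by
      nth_rewrite 3 [← Real.rpow_one (a + s)]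
      rw [← Real.rpow_add h]
      congr 1
      ring
    rw [e1] at h2
    have e3 : (a + s) ^ α * (1 + α * -(s / (a + s))) =
        (a + s) ^ α - α * (s * (a + s) ^ (α - 1)) := by
      rw [e2]; field_simp; ring
    rw [e3] at h2
    linarith

/-! ### Bounded measurable functions and the running maximum -/

variable {Ω : Type*} {m0 : MeasurableSpace Ω}

/-- Bounded functions that are measurable with respect to a given σ-algebra. -/
def BddMeasurable (m : MeasurableSpace Ω) (f : Ω → ℝ) : Prop :=
  Measurable[m] f ∧ ∃ C : ℝ, ∀ x, |f x| ≤ C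

namespace BddMeasurable

variable {m m' : MeasurableSpace Ω} {f g : Ω → ℝ}

theorem mono (hf : BddMeasurable m f) (h : m ≤ m') : BddMeasurable m' f :=
  ⟨hf.1.mono h le_rfl, hf.2⟩

theorem const (c : ℝ) : BddMeasurable m fun _ : Ω ↦ c :=
  ⟨measurable_const, |c|, fun _ ↦ le_rfl⟩

theorem add (hf : BddMeasurable m f) (hg : BddMeasurable m g) :
    BddMeasurable m fun x ↦ f x + g x := by
  obtain ⟨hf, C, hC⟩ := hf
  obtain ⟨hg, D, hD⟩ := hg
  exact ⟨hf.add hg, C + D, fun x ↦ (abs_add_le _ _).trans (add_le_add (hC x) (hD x))⟩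

theorem mul (hf : BddMeasurable m f) (hg : BddMeasurable m g) :
    BddMeasurable m fun x ↦ f x * g x := by
  obtain ⟨hf, C, hC⟩ := hf
  obtain ⟨hg, D, hD⟩ := hg
  refine ⟨hf.mul hg, C * D, fun x ↦ ?_⟩
  rw [abs_mul]
  exact mul_le_mul (hC x) (hD x) (abs_nonneg _) ((abs_nonneg _).trans (hC x))

theorem const_mul (c : ℝ) (hf : BddMeasurable m f) : BddMeasurable m fun x ↦ c * f x :=
  (BddMeasurable.const c).mul hf

theorem sub (hf : BddMeasurable m f) (hg : BddMeasurable m g) :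
    BddMeasurable m fun x ↦ f x - g x := by
  simpa [sub_eq_add_neg] using hf.add (hg.const_mul (-1))

theorem abs (hf : BddMeasurable m f) : BddMeasurable m fun x ↦ |f x| := by
  obtain ⟨hf, C, hC⟩ := hf
  exact ⟨continuous_abs.measurable.comp hf, C, fun x ↦ by rw [abs_abs]; exact hC x⟩

theorem sq (hf : BddMeasurable m f) : BddMeasurable m fun x ↦ f x ^ 2 := by
  simpa [_root_.sq] using hf.mul hf

theorem max (hf : BddMeasurable m f) (hg : BddMeasurable m g) :
    BddMeasurable m fun x ↦ max (f x) (g x) := by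
  obtain ⟨hf, C, hC⟩ := hf
  obtain ⟨hg, D, hD⟩ := hg
  exact ⟨hf.max hg, Max.max C D, fun x ↦ abs_max_le_max_abs_abs.trans (max_le_max (hC x) (hD x))⟩

theorem rpow (hf : BddMeasurable m f) {a : ℝ} (ha : 0 ≤ a) :
    BddMeasurable m fun x ↦ f x ^ a := by
  obtain ⟨hf, C, hC⟩ := hf
  exact ⟨hf.pow_const a, C ^ a, fun x ↦ (Real.abs_rpow_le_abs_rpow _ _).trans
    (Real.rpow_le_rpow (abs_nonneg _) (hC x) ha)⟩

theorem sum {f : ℕ → Ω → ℝ} {s : Finset ℕ} (hf : ∀ i ∈ s, BddMeasurable m (f i)) :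
    BddMeasurable m fun x ↦ ∑ i ∈ s, f i x := by
  classical
  induction s using Finset.induction_on with
  | empty => simpa using BddMeasurable.const (m := m) (0 : ℝ)
  | insert i s hi ih =>
    simp only [Finset.sum_insert hi]
    exact (hf i (Finset.mem_insert_self i s)).add
      (ih fun j hj ↦ hf j (Finset.mem_insert_of_mem hj))

theorem sign (hf : BddMeasurable m f) :
    BddMeasurable m fun x ↦ if 0 ≤ f x then (1 : ℝ) else -1 := by
  refine ⟨Measurable.ite (measurableSet_le measurable_const hf.1) measurable_const
    measurable_const, 1, fun x ↦ ?_⟩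
  dsimp only
  split_ifs <;> simp

end BddMeasurable

theorem BddMeasurable.integrable (μ : Measure Ω) [IsFiniteMeasure μ] {m : MeasurableSpace Ω}
    {f : Ω → ℝ} (hf : BddMeasurable m f)
    (h : m ≤ m0) :
    Integrable f μ := by
  obtain ⟨hf, C, hC⟩ := hf
  exact Integrable.of_bound (hf.mono h le_rfl).aestronglyMeasurable C (ae_of_all _ hC)

/-- The running maximum `max_{k ≤ n} |f_k|`. -/
def runMax (f : ℕ → Ω → ℝ) : ℕ → Ω → ℝ
  | 0 => fun x ↦ |f 0 x|
  | n + 1 => fun x ↦ max (runMax f n x) |f (n + 1) x|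

theorem runMax_succ (f : ℕ → Ω → ℝ) (n : ℕ) (x : Ω) :
    runMax f (n + 1) x = max (runMax f n x) |f (n + 1) x| := rfl

theorem runMax_nonneg (f : ℕ → Ω → ℝ) (n : ℕ) (x : Ω) : 0 ≤ runMax f n x := by
  cases n with
  | zero => exact abs_nonneg _
  | succ n => exact (abs_nonneg _).trans (le_max_right _ _)

theorem runMax_mono (f : ℕ → Ω → ℝ) (x : Ω) : Monotone fun n ↦ runMax f n x :=
  monotone_nat_of_le_succ fun _ ↦ le_max_left _ _

theorem abs_le_runMax (f : ℕ → Ω → ℝ) {k n : ℕ} (h : k ≤ n) (x : Ω) : |f k x| ≤ runMax f n x := by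
  refine le_trans ?_ (runMax_mono f x h)
  cases k with
  | zero => exact le_rfl
  | succ k => exact le_max_right _ _

variable {ℱ : Filtration ℕ m0}

theorem BddMeasurable.runMax {f : ℕ → Ω → ℝ} (hf : ∀ n, BddMeasurable (ℱ n) (f n)) (n : ℕ) :
    BddMeasurable (ℱ n) (runMax f n) := by
  induction n with
  | zero => exact (hf 0).abs
  | succ n ih => exact (ih.mono (ℱ.mono n.le_succ)).max (hf (n + 1)).abs

end

section

/-! ### Inequalities for bounded martingales -/

variable {Ω : Type*} {m0 : MeasurableSpace Ω}

/-- Adapted processes of bounded functions with the martingale property, tested on bounded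
functions. -/
structure IsBddMartingale (μ : Measure Ω) (ℱ : Filtration ℕ m0) (f : ℕ → Ω → ℝ) : Prop where
  bdd : ∀ n, BddMeasurable (ℱ n) (f n)
  step : ∀ n w, BddMeasurable (ℱ n) w → ∫ x, w x * f (n + 1) x ∂μ = ∫ x, w x * f n x ∂μ

/-- `σ n` is a bounded version of the conditional expectation of `|d_{n+1} f|^2` given `ℱ n`. -/
structure IsCondVar (μ : Measure Ω) (ℱ : Filtration ℕ m0) (f σ : ℕ → Ω → ℝ) : Prop where
  bdd : ∀ n, BddMeasurable (ℱ n) (σ n)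
  nonneg : ∀ n x, 0 ≤ σ n x
  step : ∀ n w, BddMeasurable (ℱ n) w →
    ∫ x, w x * σ n x ∂μ = ∫ x, w x * (f (n + 1) x - f n x) ^ 2 ∂μ

variable {μ : Measure Ω} [IsFiniteMeasure μ] {ℱ : Filtration ℕ m0} {f σ : ℕ → Ω → ℝ}

theorem BddMeasurable.int {n : ℕ} {g : Ω → ℝ} (hg : BddMeasurable (ℱ n) g) : Integrable g μ :=
  hg.integrable μ (ℱ.le n)

namespace IsBddMartingale

theorem bdd_of_le (hf : IsBddMartingale μ ℱ f) {k n : ℕ} (h : k ≤ n) : BddMeasurable (ℱ n) (f k) :=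
  (hf.bdd k).mono (ℱ.mono h)

theorem diff (hf : IsBddMartingale μ ℱ f) (n : ℕ) :
    BddMeasurable (ℱ (n + 1)) fun x ↦ f (n + 1) x - f n x :=
  (hf.bdd (n + 1)).sub (hf.bdd_of_le n.le_succ)

theorem step_diff (hf : IsBddMartingale μ ℱ f) (n : ℕ) {w : Ω → ℝ} (hw : BddMeasurable (ℱ n) w) :
    ∫ x, w x * (f (n + 1) x - f n x) ∂μ = 0 := by
  simp only [mul_sub]
  rw [integral_sub, hf.step n w hw, sub_self]
  · exact ((hw.mono (ℱ.mono n.le_succ)).mul (hf.bdd (n + 1))).int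
  · exact (hw.mul (hf.bdd n)).int

theorem integral_mul_abs_le (hf : IsBddMartingale μ ℱ f) (n : ℕ) {w : Ω → ℝ}
    (hw : BddMeasurable (ℱ n) w) (hw0 : ∀ x, 0 ≤ w x) :
    ∫ x, w x * |f n x| ∂μ ≤ ∫ x, w x * |f (n + 1) x| ∂μ := by
  have hs := (hf.bdd n).sign
  -- The sign of f_n may be absorbed into the weight, since it is measurable at time n; this gives
  -- the submartingale property of |f_n|.
  have hw' := hw.mul hs
  have h := hf.step n _ hw'
  have e : ∀ x, w x * |f n x| = w x * (if 0 ≤ f n x then 1 else -1) * f n x := by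
    intro x
    split_ifs with h0
    · rw [abs_of_nonneg h0]; ring
    · rw [abs_of_neg (not_le.1 h0)]; ring
  simp only [e]
  rw [← h]
  refine integral_mono ((hw'.mono (ℱ.mono n.le_succ)).mul (hf.bdd (n + 1))).int
    ((hw.mono (ℱ.mono n.le_succ)).mul (hf.bdd (n + 1)).abs).int fun x ↦ ?_
  dsimp only
  split_ifs with h0
  · have := mul_le_mul_of_nonneg_left (le_abs_self (f (n + 1) x)) (hw0 x)
    linarith
  · have := mul_le_mul_of_nonneg_left (neg_abs_le (f (n + 1) x)) (hw0 x)
    linarith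

/-- Induction on n. The running maximum M_n changes only where |f_(n+1)| becomes the new maximum,
and there `rpow_sub_mul_ge` applies. In the remaining term the weight M_n^(p-1) is known at time n,
so |f_n| may be replaced by |f_(n+1)|. -/
theorem doob_aux (hf : IsBddMartingale μ ℱ f) {p : ℝ} (hp : 1 < p) (n : ℕ) :
    (1 - 1 / p) * ∫ x, runMax f n x ^ p ∂μ ≤ ∫ x, runMax f n x ^ (p - 1) * |f n x| ∂μ := by
  have hp0 : 0 ≤ p := by linarith
  have hp1 : 0 ≤ p - 1 := by linarith
  have hM := BddMeasurable.runMax hf.bdd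
  induction n with
  | zero =>
    have e : ∀ x, runMax f 0 x ^ (p - 1) * |f 0 x| = runMax f 0 x ^ p := by
      intro x
      change |f 0 x| ^ (p - 1) * |f 0 x| = |f 0 x| ^ p
      nth_rewrite 2 [← Real.rpow_one |f 0 x|]
      rw [← Real.rpow_add_of_nonneg (abs_nonneg _) hp1 zero_le_one]
      congr 1
      ring
    simp only [e]
    have h0 : 0 ≤ ∫ x, runMax f 0 x ^ p ∂μ :=
      integral_nonneg fun x ↦ Real.rpow_nonneg (runMax_nonneg f 0 x) p
    have : 0 < 1 / p := by positivity
    nlinarith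
  | succ n ih =>
    have hM1 := ((hM n).mono (ℱ.mono n.le_succ)).rpow hp1
    have i1 := ((hM (n + 1)).rpow hp0).int (μ := μ)
    have i2 := ((hM n).rpow hp0).int (μ := μ)
    have i3 := (((hM (n + 1)).rpow hp1).mul (hf.bdd (n + 1)).abs).int (μ := μ)
    have i4 := (hM1.mul (hf.bdd (n + 1)).abs).int (μ := μ)
    have h1 : (1 - 1 / p) * (∫ x, runMax f (n + 1) x ^ p ∂μ - ∫ x, runMax f n x ^ p ∂μ) ≤
        ∫ x, runMax f (n + 1) x ^ (p - 1) * |f (n + 1) x| ∂μ -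
          ∫ x, runMax f n x ^ (p - 1) * |f (n + 1) x| ∂μ := by
      rw [← integral_sub i1 i2, ← integral_sub i3 i4, ← integral_const_mul]
      refine integral_mono ((i1.sub i2).const_mul _) (i3.sub i4) fun x ↦ ?_
      dsimp only
      rw [← sub_mul]
      rcases le_total |f (n + 1) x| (runMax f n x) with h | h
      · rw [runMax_succ, max_eq_left h]
        simp
      · rw [runMax_succ, max_eq_right h]
        exact rpow_sub_mul_ge hp (runMax_nonneg f n x) (abs_nonneg _)
    have h2 := hf.integral_mul_abs_le n ((hM n).rpow hp1)
      fun x ↦ Real.rpow_nonneg (runMax_nonneg f n x) _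
    linarith

end IsBddMartingale

/-- Doob's maximal inequality. -/
theorem exists_doob (Ω : Type*) [m0 : MeasurableSpace Ω] {p : ℝ} (hp : 1 < p) :
    ∃ C : ℝ, 0 ≤ C ∧ ∀ (μ : Measure Ω) [IsFiniteMeasure μ] (ℱ : Filtration ℕ m0)
      (f : ℕ → Ω → ℝ), IsBddMartingale μ ℱ f → ∀ n,
        ∫ x, runMax f n x ^ p ∂μ ≤ C * ∫ x, |f n x| ^ p ∂μ := by
  have hp0 : 0 < p := by linarith
  have hε : 0 < (1 - 1 / p) / 2 := by
    have : 1 / p < 1 := by rw [div_lt_one hp0]; exact hp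
    linarith
  -- Half of the constant 1 - 1/p of `doob_aux` is spent, so the power of the maximum can be
  -- absorbed on the left; it is finite by boundedness.
  obtain ⟨C, hC, h⟩ := exists_young (α := p - 1) (β := 1) (by linarith) one_pos hε
  refine ⟨C / ((1 - 1 / p) / 2), by positivity, fun μ _ ℱ f hf n ↦ ?_⟩
  have h1 := hf.doob_aux hp n
  have hM := BddMeasurable.runMax hf.bdd n
  have i1 := (hM.rpow hp0.le).int (μ := μ)
  have i2 := ((hf.bdd n).abs.rpow hp0.le).int (μ := μ)
  have h2 : ∫ x, runMax f n x ^ (p - 1) * |f n x| ∂μ ≤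
      (1 - 1 / p) / 2 * ∫ x, runMax f n x ^ p ∂μ + C * ∫ x, |f n x| ^ p ∂μ := by
    rw [← integral_const_mul, ← integral_const_mul,
      ← integral_add (i1.const_mul _) (i2.const_mul _)]
    refine integral_mono ((hM.rpow (by linarith)).mul (hf.bdd n).abs).int
      ((i1.const_mul _).add (i2.const_mul _)) fun x ↦ ?_
    have := h (runMax f n x) |f n x| (runMax_nonneg f n x) (abs_nonneg _)
    simpa using this
  rw [div_mul_eq_mul_div, le_div_iff₀ hε]
  linarith

/-! ### The conditional square function is bounded by the maximal function. -/

namespace IsCondVar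

theorem sum_bdd (hσ : IsCondVar μ ℱ f σ) (n : ℕ) :
    BddMeasurable (ℱ n) fun x ↦ ∑ i ∈ Finset.range (n + 1), σ i x :=
  BddMeasurable.sum fun i hi ↦ (hσ.bdd i).mono (ℱ.mono (Nat.lt_succ_iff.1 (Finset.mem_range.1 hi)))

theorem sum_bdd' (hσ : IsCondVar μ ℱ f σ) (n : ℕ) :
    BddMeasurable (ℱ n) fun x ↦ ∑ i ∈ Finset.range n, σ i x :=
  BddMeasurable.sum fun i hi ↦ (hσ.bdd i).mono (ℱ.mono (Finset.mem_range.1 hi).le)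

theorem sum_nonneg (hσ : IsCondVar μ ℱ f σ) (n : ℕ) (x : Ω) :
    0 ≤ ∑ i ∈ Finset.range n, σ i x :=
  Finset.sum_nonneg fun i _ ↦ hσ.nonneg i x

theorem sum_mono (hσ : IsCondVar μ ℱ f σ) (x : Ω) :
    Monotone fun n ↦ ∑ i ∈ Finset.range n, σ i x :=
  monotone_nat_of_le_succ fun n ↦ by
    rw [Finset.sum_range_succ]
    exact le_add_of_nonneg_right (hσ.nonneg n x)

end IsCondVar

/-- The martingale transform `∑_{k < n} V_k d_{k+1}`. -/
def transform (V f : ℕ → Ω → ℝ) (n : ℕ) (x : Ω) : ℝ :=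
  ∑ k ∈ Finset.range n, V k x * (f (k + 1) x - f k x)

/-- Summation by parts: up to the boundary term V_n f_(n+1), the transform is a combination of
values of f whose coefficients are V_0 and the increments of V, of total mass V_n. -/
theorem abs_transform_le {V f : ℕ → Ω → ℝ} {x : Ω} (hV0 : ∀ k, 0 ≤ V k x)
    (hV : Monotone fun k ↦ V k x) (n : ℕ) :
    |transform V f (n + 1) x| ≤ 2 * (V n x * runMax f (n + 1) x) := by
  have key : ∀ n, |transform V f (n + 1) x - V n x * f (n + 1) x| ≤ V n x * runMax f (n + 1) x := by
    intro n
    induction n with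
    | zero =>
      have : transform V f (0 + 1) x - V 0 x * f (0 + 1) x = - (V 0 x * f 0 x) := by
        simp [transform]; ring
      rw [this, abs_neg, abs_mul, abs_of_nonneg (hV0 0)]
      exact mul_le_mul_of_nonneg_left (abs_le_runMax f (by omega) x) (hV0 0)
    | succ n ih =>
      have e : transform V f (n + 1 + 1) x - V (n + 1) x * f (n + 1 + 1) x =
          (transform V f (n + 1) x - V n x * f (n + 1) x) -
            (V (n + 1) x - V n x) * f (n + 1) x := by
        simp only [transform]
        rw [Finset.sum_range_succ _ (n + 1)]
        ring
      have h0 : 0 ≤ V (n + 1) x - V n x := sub_nonneg.2 (hV n.le_succ)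
      rw [e]
      refine (abs_sub _ _).trans ?_
      rw [abs_mul, abs_of_nonneg h0]
      have h1 : |f (n + 1) x| ≤ runMax f (n + 1 + 1) x := abs_le_runMax f (by omega) x
      have h2 : runMax f (n + 1) x ≤ runMax f (n + 1 + 1) x := runMax_mono f x (by omega)
      have h3 := mul_le_mul_of_nonneg_left h1 h0
      have h4 := mul_le_mul_of_nonneg_left h2 (hV0 n)
      linarith
  have h1 := key n
  have h2 : |V n x * f (n + 1) x| ≤ V n x * runMax f (n + 1) x := by
    rw [abs_mul, abs_of_nonneg (hV0 n)]
    exact mul_le_mul_of_nonneg_left (abs_le_runMax f le_rfl x) (hV0 n)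
  have h3 := abs_add_le (transform V f (n + 1) x - V n x * f (n + 1) x) (V n x * f (n + 1) x)
  rw [sub_add_cancel] at h3
  linarith

theorem IsBddMartingale.transform_bdd (hf : IsBddMartingale μ ℱ f) {V : ℕ → Ω → ℝ}
    (hV : ∀ k, BddMeasurable (ℱ k) (V k)) (n : ℕ) : BddMeasurable (ℱ n) (transform V f n) :=
  BddMeasurable.sum fun k hk ↦ by
    have hk := Finset.mem_range.1 hk
    exact ((hV k).mono (ℱ.mono hk.le)).mul ((hf.diff k).mono (ℱ.mono hk))

/-- Orthogonality of martingale differences: the cross term has an ℱ n-measurable factor and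
integrates to zero. -/
theorem IsBddMartingale.integral_transform_sq (hf : IsBddMartingale μ ℱ f)
    (hσ : IsCondVar μ ℱ f σ) {V : ℕ → Ω → ℝ} (hV : ∀ k, BddMeasurable (ℱ k) (V k)) (n : ℕ) :
    ∫ x, transform V f n x ^ 2 ∂μ = ∑ k ∈ Finset.range n, ∫ x, V k x ^ 2 * σ k x ∂μ := by
  induction n with
  | zero => simp [transform]
  | succ n ih =>
    rw [Finset.sum_range_succ, ← ih, hσ.step n _ (hV n).sq]
    have hg := hf.transform_bdd hV n
    have hg' := hg.mono (ℱ.mono n.le_succ)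
    have hV' := (hV n).mono (ℱ.mono n.le_succ)
    have hw := (hg.mul (hV n)).const_mul 2
    have h0 := hf.step_diff n hw
    have e : ∀ x, transform V f (n + 1) x ^ 2 = (transform V f n x ^ 2 +
        V n x ^ 2 * (f (n + 1) x - f n x) ^ 2) +
          2 * (transform V f n x * V n x) * (f (n + 1) x - f n x) := by
      intro x
      have : transform V f (n + 1) x = transform V f n x + V n x * (f (n + 1) x - f n x) := by
        simp only [transform]
        rw [Finset.sum_range_succ]
      rw [this]
      ring
    simp only [e]
    have i1 := hg'.sq.int (μ := μ)
    have i2 := (hV'.sq.mul (hf.diff n).sq).int (μ := μ)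
    have i3 := ((hw.mono (ℱ.mono n.le_succ)).mul (hf.diff n)).int (μ := μ)
    have i12 := (hg'.sq.add (hV'.sq.mul (hf.diff n).sq)).int (μ := μ)
    rw [integral_add i12 i3, integral_add i1 i2, h0, add_zero]

/-- The conditional square function is controlled by the maximal function. -/
theorem exists_condVar_le (Ω : Type*) [m0 : MeasurableSpace Ω] {r : ℝ} (hr : 2 ≤ r) :
    ∃ C : ℝ, 0 ≤ C ∧ ∀ (μ : Measure Ω) [IsFiniteMeasure μ] (ℱ : Filtration ℕ m0)
      (f σ : ℕ → Ω → ℝ), IsBddMartingale μ ℱ f → IsCondVar μ ℱ f σ → ∀ n,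
        ∫ x, (∑ i ∈ Finset.range n, σ i x) ^ (r / 2) ∂μ ≤ C * ∫ x, runMax f n x ^ r ∂μ := by
  set α := r / 2 with hα
  have hα1 : 1 ≤ α := by rw [hα]; linarith
  have hα0 : 0 < α := by linarith
  have hαm : 0 ≤ α - 1 := by linarith
  have hr0 : 0 < r := by linarith
  -- The factors α and 4 arising below turn 1/(8α) into 1/2, so this term is absorbed on the left.
  obtain ⟨C, hC, hY⟩ := exists_young (α := α - 1) (β := 1) hαm one_pos
    (show 0 < 1 / (8 * α) by positivity)
  refine ⟨8 * α * C, by positivity, fun μ _ ℱ f σ hf hσ n ↦ ?_⟩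
  set A : ℕ → Ω → ℝ := fun n x ↦ ∑ i ∈ Finset.range n, σ i x with hA
  have hA0 : ∀ n x, 0 ≤ A n x := hσ.sum_nonneg
  have hAb : ∀ n, BddMeasurable (ℱ n) (A (n + 1)) := hσ.sum_bdd
  have hAb' : ∀ n, BddMeasurable (ℱ n) (A n) := hσ.sum_bdd'
  have hAm : ∀ x, Monotone fun n ↦ A n x := hσ.sum_mono
  have hM := BddMeasurable.runMax hf.bdd
  change ∫ x, A n x ^ α ∂μ ≤ _
  cases n with
  | zero =>
    have : ∀ x, A 0 x ^ α = 0 := fun x ↦ by simp [hA, Real.zero_rpow hα0.ne']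
    simp only [this, integral_zero]
    exact mul_nonneg (by positivity)
      (integral_nonneg fun x ↦ Real.rpow_nonneg (runMax_nonneg f 0 x) _)
  | succ n =>
  -- The sum A_(k+1) ends with σ_k and is known at time k, so V is predictable. Then A^α is at most
  -- α times the sum of V_k² σ_k, whose integral is the second moment of the transform of f by V. As
  -- V increases, the transform is at most twice V times the running maximum.
  set V : ℕ → Ω → ℝ := fun k x ↦ A (k + 1) x ^ ((α - 1) / 2) with hV
  have hVb : ∀ k, BddMeasurable (ℱ k) (V k) := fun k ↦ (hAb k).rpow (by positivity)
  have hV2 : ∀ k x, V k x ^ 2 = A (k + 1) x ^ (α - 1) := by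
    intro k x
    rw [hV, ← Real.rpow_natCast, ← Real.rpow_mul (hA0 _ _)]
    congr 1
    push_cast
    ring
  have h1 : ∀ m, ∫ x, A m x ^ α ∂μ ≤
      α * ∑ k ∈ Finset.range m, ∫ x, V k x ^ 2 * σ k x ∂μ := by
    intro m
    induction m with
    | zero => simp [hA, Real.zero_rpow hα0.ne']
    | succ m ih =>
      have i1 := ((hAb' m).rpow hα0.le).int (μ := μ)
      have i2 := ((hVb m).sq.mul (hσ.bdd m)).int (μ := μ)
      rw [Finset.sum_range_succ, mul_add]
      refine le_trans ?_ (add_le_add_left ih _)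
      rw [← integral_const_mul, ← integral_add i1 (i2.const_mul _)]
      refine integral_mono ((hAb' (m + 1)).rpow hα0.le).int (i1.add (i2.const_mul _)) fun x ↦ ?_
      have h := rpow_add_le_mul hα1 (hA0 m x) (hσ.nonneg m x)
      have e : A (m + 1) x = A m x + σ m x := Finset.sum_range_succ _ _
      dsimp only
      rw [hV2, e]
      linarith
  have h2 := h1 (n + 1)
  rw [← hf.integral_transform_sq hσ hVb (n + 1)] at h2
  have i1 := ((hAb' (n + 1)).rpow hα0.le).int (μ := μ)
  have i2 := ((hM (n + 1)).rpow hr0.le).int (μ := μ)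
  have h3 : ∫ x, transform V f (n + 1) x ^ 2 ∂μ ≤
      4 * (1 / (8 * α) * ∫ x, A (n + 1) x ^ α ∂μ + C * ∫ x, runMax f (n + 1) x ^ r ∂μ) := by
    rw [← integral_const_mul, ← integral_const_mul,
      ← integral_add (i1.const_mul _) (i2.const_mul _),
      ← integral_const_mul]
    refine integral_mono (hf.transform_bdd hVb (n + 1)).sq.int
      (((i1.const_mul _).add (i2.const_mul _)).const_mul _) fun x ↦ ?_
    have h := abs_transform_le (V := V) (f := f) (x := x)
      (fun k ↦ Real.rpow_nonneg (hA0 _ _) _)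
      (fun k l hkl ↦ Real.rpow_le_rpow (hA0 _ _) (hAm x (by omega)) (by positivity)) n
    have h' : transform V f (n + 1) x ^ 2 ≤ 4 * (V n x ^ 2 * runMax f (n + 1) x ^ 2) := by
      rw [← sq_abs]
      calc |transform V f (n + 1) x| ^ 2 ≤ (2 * (V n x * runMax f (n + 1) x)) ^ 2 := by gcongr
        _ = _ := by ring
    rw [hV2] at h'
    have hy := hY (A (n + 1) x) (runMax f (n + 1) x ^ 2) (hA0 _ _) (by positivity)
    rw [Real.rpow_one, sub_add_cancel] at hy
    have e : (runMax f (n + 1) x ^ 2) ^ α = runMax f (n + 1) x ^ r := by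
      rw [← Real.rpow_natCast, ← Real.rpow_mul (runMax_nonneg _ _ _)]
      congr 1
      rw [hα]
      push_cast
      ring
    rw [e] at hy
    dsimp only
    linarith
  have h4 : α * (4 * (1 / (8 * α) * ∫ x, A (n + 1) x ^ α ∂μ + C * ∫ x, runMax f (n + 1) x ^ r ∂μ)) =
      (∫ x, A (n + 1) x ^ α ∂μ) / 2 + 4 * α * C * ∫ x, runMax f (n + 1) x ^ r ∂μ := by
    field_simp
    ring
  have h5 := h2.trans (mul_le_mul_of_nonneg_left h3 hα0.le)
  rw [h4] at h5
  linarith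

end

/-! ### Jumps and Rosenthal's inequality. -/

section

/-- The process of jumps `f_n - f_{n-1}`, starting with `0`. -/
def jump {Ω : Type*} (f : ℕ → Ω → ℝ) (n : ℕ) (x : Ω) : ℝ := f n x - f (n - 1) x

theorem IsBddMartingale.jump_bdd {Ω : Type*} {m0 : MeasurableSpace Ω} {μ : Measure Ω}
    {ℱ : Filtration ℕ m0} {f : ℕ → Ω → ℝ} (hf : IsBddMartingale μ ℱ f) (n : ℕ) :
    BddMeasurable (ℱ n) (jump f n) :=
  (hf.bdd n).sub ((hf.bdd (n - 1)).mono (ℱ.mono (n.sub_le 1)))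

/-- The upper bound in Rosenthal's inequality for martingales. -/
theorem exists_rosenthal (Ω : Type*) [m0 : MeasurableSpace Ω] {r : ℝ} (hr : 2 ≤ r) :
    ∃ C : ℝ, 0 ≤ C ∧ ∀ (μ : Measure Ω) [IsFiniteMeasure μ] (ℱ : Filtration ℕ m0)
      (f σ : ℕ → Ω → ℝ), f 0 = 0 → IsBddMartingale μ ℱ f → IsCondVar μ ℱ f σ → ∀ n,
        ∫ x, runMax f n x ^ r ∂μ ≤ C * (∫ x, (∑ i ∈ Finset.range n, σ i x) ^ (r / 2) ∂μ +
          ∫ x, runMax (jump f) n x ^ r ∂μ) := by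
  have hr0 : 0 < r := by linarith
  have hr2 : 0 ≤ r - 2 := by linarith
  obtain ⟨K, hK, hD⟩ := exists_doob Ω (p := r) (by linarith)
  set B : ℝ := (1 + r) ^ r with hB
  have hB0 : 0 ≤ B := by positivity
  -- After multiplication by r² and by Doob's constant K this leaves at most half of the maximal
  -- term; the summand 1 covers K = 0.
  obtain ⟨C₁, hC₁, hY₁⟩ := exists_young (α := r - 2) (β := 2) hr2 two_pos
    (show 0 < 1 / (2 * (K * r ^ 2 + 1)) by positivity)
  obtain ⟨C₂, hC₂, hY₂⟩ := exists_young (α := r - 2) (β := 2) hr2 two_pos one_pos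
  refine ⟨2 * K * (r ^ 2 * C₁ + B * C₂ + 2 * B), by positivity, fun μ _ ℱ f σ hf0 hf hσ N ↦ ?_⟩
  set A : ℕ → Ω → ℝ := fun n x ↦ ∑ i ∈ Finset.range n, σ i x with hA
  have hA0 : ∀ n x, 0 ≤ A n x := hσ.sum_nonneg
  have hAb : ∀ n, BddMeasurable (ℱ n) (A n) := hσ.sum_bdd'
  have hM := BddMeasurable.runMax hf.bdd
  have hJ := BddMeasurable.runMax hf.jump_bdd
  have hle : ∀ {n}, n ≤ N → ∀ {g : Ω → ℝ}, BddMeasurable (ℱ n) g → BddMeasurable (ℱ N) g :=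
    fun h _ hg ↦ hg.mono (ℱ.mono h)
  -- The weights are taken at the final time N, so that they stay fixed during the induction and the
  -- conditional variances simply add up to A_n.
  have key : ∀ n, n ≤ N → ∫ x, |f n x| ^ r ∂μ ≤
      r ^ 2 * ∫ x, runMax f N x ^ (r - 2) * A n x ∂μ +
        B * (∫ x, runMax (jump f) n x ^ r ∂μ + ∫ x, runMax (jump f) N x ^ (r - 2) * A n x ∂μ) := by
    intro n
    induction n with
    | zero =>
      intro _
      have e : ∀ x : Ω, |f 0 x| ^ r = 0 := fun x ↦ by simp [hf0, Real.zero_rpow hr0.ne']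
      have e' : ∀ x : Ω, runMax (jump f) 0 x ^ r = 0 := fun x ↦ by
        simp [runMax, jump, Real.zero_rpow hr0.ne']
      simp [e, e', hA]
    | succ n ih =>
      intro hn
      have hn' : n ≤ N := (Nat.le_succ n).trans hn
      have h0 := ih hn'
      have hd := hf.diff n
      have hfn := (hf.bdd n).abs.rpow hr0.le
      have hw : BddMeasurable (ℱ n) fun x ↦ r * (|f n x| ^ (r - 2) * f n x) :=
        (((hf.bdd n).abs.rpow hr2).mul (hf.bdd n)).const_mul r
      have hu : BddMeasurable (ℱ n) fun x ↦ |f n x| ^ (r - 2) := (hf.bdd n).abs.rpow hr2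
      have hv : BddMeasurable (ℱ n) fun x ↦ runMax (jump f) n x ^ (r - 2) := (hJ n).rpow hr2
      have up : ∀ {g : Ω → ℝ}, BddMeasurable (ℱ n) g → BddMeasurable (ℱ (n + 1)) g :=
        fun hg ↦ hg.mono (ℱ.mono n.le_succ)
      have b1 := up hfn
      have b2 := (up hw).mul hd
      have b3 := (up hu).mul hd.sq
      have b4 := hd.abs.rpow hr0.le
      have h1 : ∫ x, |f (n + 1) x| ^ r ∂μ ≤ ∫ x, |f n x| ^ r ∂μ +
          r ^ 2 * ∫ x, |f n x| ^ (r - 2) * σ n x ∂μ +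
            B * ∫ x, |f (n + 1) x - f n x| ^ r ∂μ := by
        rw [hσ.step n _ hu]
        -- Second-order expansion around f_n; the first-order term has mean zero by the martingale
        -- property.
        have h2 : ∫ x, |f (n + 1) x| ^ r ∂μ ≤ ∫ x, (|f n x| ^ r +
            r * (|f n x| ^ (r - 2) * f n x) * (f (n + 1) x - f n x) +
            r ^ 2 * (|f n x| ^ (r - 2) * (f (n + 1) x - f n x) ^ 2) +
            B * |f (n + 1) x - f n x| ^ r) ∂μ := by
          refine integral_mono ((hf.bdd (n + 1)).abs.rpow hr0.le).int
            (((b1.add b2).add (b3.const_mul _)).add (b4.const_mul _)).int fun x ↦ ?_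
          have := abs_add_rpow_le hr (f n x) (f (n + 1) x - f n x)
          rwa [add_sub_cancel] at this
        rw [integral_add ((b1.add b2).add (b3.const_mul _)).int (b4.const_mul _).int,
          integral_add (b1.add b2).int (b3.const_mul _).int, integral_add b1.int b2.int,
          hf.step_diff n hw, integral_const_mul, integral_const_mul, add_zero] at h2
        exact h2
      -- `rpow_jump_le` with a the largest jump so far. The difference telescopes along the
      -- induction, and the weight of the square is known at time n, so the square may be exchanged
      -- for σ_n.
      have h2 : ∫ x, |f (n + 1) x - f n x| ^ r ∂μ ≤ ∫ x, runMax (jump f) (n + 1) x ^ r ∂μ -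
          ∫ x, runMax (jump f) n x ^ r ∂μ + ∫ x, runMax (jump f) n x ^ (r - 2) * σ n x ∂μ := by
        rw [hσ.step n _ hv]
        have c1 := (hJ (n + 1)).rpow hr0.le
        have c2 := up ((hJ n).rpow hr0.le)
        have c3 := (up hv).mul hd.sq
        rw [← integral_sub c1.int c2.int, ← integral_add (c1.sub c2).int c3.int]
        refine integral_mono b4.int ((c1.sub c2).add c3).int fun x ↦ ?_
        exact rpow_jump_le hr (runMax_nonneg (jump f) n x)
      have eA : ∀ x, A (n + 1) x = A n x + σ n x := fun x ↦ Finset.sum_range_succ _ _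
      have hMN := (hM N).rpow hr2
      have hJN := (hJ N).rpow hr2
      have split : ∀ {g : Ω → ℝ}, BddMeasurable (ℱ N) g →
          ∫ x, g x * A (n + 1) x ∂μ = ∫ x, g x * A n x ∂μ + ∫ x, g x * σ n x ∂μ := by
        intro g hg
        simp only [eA, mul_add]
        exact integral_add (hg.mul (hle hn' (hAb n))).int (hg.mul (hle hn' (hσ.bdd n))).int
      rw [split hMN, split hJN]
      have h3 : ∫ x, |f n x| ^ (r - 2) * σ n x ∂μ ≤ ∫ x, runMax f N x ^ (r - 2) * σ n x ∂μ := by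
        refine integral_mono (hu.mul (hσ.bdd n)).int (hMN.mul (hle hn' (hσ.bdd n))).int fun x ↦ ?_
        exact mul_le_mul_of_nonneg_right
          (Real.rpow_le_rpow (abs_nonneg _) (abs_le_runMax f hn' x) hr2) (hσ.nonneg n x)
      have h4 : ∫ x, runMax (jump f) n x ^ (r - 2) * σ n x ∂μ ≤
          ∫ x, runMax (jump f) N x ^ (r - 2) * σ n x ∂μ := by
        refine integral_mono (hv.mul (hσ.bdd n)).int (hJN.mul (hle hn' (hσ.bdd n))).int fun x ↦ ?_
        exact mul_le_mul_of_nonneg_right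
          (Real.rpow_le_rpow (runMax_nonneg _ _ _) (runMax_mono (jump f) x hn') hr2)
          (hσ.nonneg n x)
      have h5 := mul_le_mul_of_nonneg_left h3 (sq_nonneg r)
      have h6 := mul_le_mul_of_nonneg_left (h2.trans (add_le_add_right h4 _)) hB0
      linarith
  have young : ∀ {ε C : ℝ} {g : Ω → ℝ}, BddMeasurable (ℱ N) g → (∀ x, 0 ≤ g x) →
      (∀ a b : ℝ, 0 ≤ a → 0 ≤ b →
        a ^ (r - 2) * b ^ (2 : ℝ) ≤ ε * a ^ (r - 2 + 2) + C * b ^ (r - 2 + 2)) →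
      ∫ x, g x ^ (r - 2) * A N x ∂μ ≤ ε * ∫ x, g x ^ r ∂μ + C * ∫ x, A N x ^ (r / 2) ∂μ := by
    intro ε C g hg hg0 hY
    have b1 := hg.rpow hr0.le
    have b2 := (hAb N).rpow (a := r / 2) (by positivity)
    rw [← integral_const_mul, ← integral_const_mul,
      ← integral_add (b1.const_mul _).int (b2.const_mul _).int]
    refine integral_mono ((hg.rpow hr2).mul (hAb N)).int
      ((b1.const_mul _).add (b2.const_mul _)).int fun x ↦ ?_
    -- Young's inequality is applied to the square root of A_N, the conditional square function,
    -- which has the same homogeneity as g.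
    have h := hY (g x) (A N x ^ (1 / 2 : ℝ)) (hg0 x) (Real.rpow_nonneg (hA0 N x) _)
    rw [← Real.rpow_mul (hA0 N x), ← Real.rpow_mul (hA0 N x), sub_add_cancel,
      one_div_mul_cancel two_ne_zero, Real.rpow_one, one_div_mul_eq_div] at h
    exact h
  have e1 := young (hM N) (runMax_nonneg f N) hY₁
  have e2 := young (hJ N) (runMax_nonneg (jump f) N) hY₂
  have e3 := key N le_rfl
  have e4 := hD μ ℱ f hf N
  set X := ∫ x, runMax f N x ^ r ∂μ
  set Y := ∫ x, A N x ^ (r / 2) ∂μ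
  set Z := ∫ x, runMax (jump f) N x ^ r ∂μ
  have hX : 0 ≤ X := integral_nonneg fun x ↦ Real.rpow_nonneg (runMax_nonneg _ _ _) _
  have hYn : 0 ≤ Y := integral_nonneg fun x ↦ Real.rpow_nonneg (hA0 _ _) _
  have hZ : 0 ≤ Z := integral_nonneg fun x ↦ Real.rpow_nonneg (runMax_nonneg _ _ _) _
  have e5 := mul_le_mul_of_nonneg_left e1 (sq_nonneg r)
  have e6 := mul_le_mul_of_nonneg_left e2 hB0
  have e7 := mul_le_mul_of_nonneg_left
    (show ∫ x, |f N x| ^ r ∂μ ≤ r ^ 2 * (1 / (2 * (K * r ^ 2 + 1)) * X + C₁ * Y) +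
      B * (Z + (1 * Z + C₂ * Y)) by linarith) hK
  have e8 : K * (r ^ 2 * (1 / (2 * (K * r ^ 2 + 1)) * X)) ≤ X / 2 := by
    have : K * (r ^ 2 * (1 / (2 * (K * r ^ 2 + 1)) * X)) =
        (K * r ^ 2) / (K * r ^ 2 + 1) * (X / 2) := by field_simp
    rw [this]
    refine mul_le_of_le_one_left (by positivity) ?_
    rw [div_le_one (by positivity)]
    linarith
  have e9 : 0 ≤ K * (r ^ 2 * C₁ * Z) := by positivity
  have e10 : 0 ≤ K * (B * C₂ * Z) := by positivity
  have e11 : 0 ≤ K * (B * Y) := by positivity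
  nlinarith

end

section

/-! ### Averages over dyadic intervals -/

theorem mem_unitInterval {j : ℤ} {x : ℝ} : x ∈ unitInterval j ↔ ⌊x⌋ = j := by
  rw [unitInterval, Set.mem_Ico, Int.floor_eq_iff]

theorem unitInterval_eq_dyadic (j : ℤ) : unitInterval j = dyadic 0 j := by
  ext x
  rw [mem_unitInterval, mem_dyadic, pow_zero, mul_one]

theorem measurableSet_unitInterval (n : ℕ) (j : ℤ) :
    MeasurableSet[dyadicFiltration n] (unitInterval j) :=
  unitInterval_eq_dyadic j ▸ dyadicFiltration.mono (Nat.zero_le n) _ (measurableSet_dyadic 0 j)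

theorem measurableSet_unitInterval' (j : ℤ) : MeasurableSet (unitInterval j) := measurableSet_Ico

theorem measurable_comp_floor (n : ℕ) (h : ℤ → ℝ) :
    Measurable[dyadicFiltration n] fun x : ℝ ↦ h ⌊x * 2 ^ n⌋ := by
  intro s _
  have : (fun x : ℝ ↦ h ⌊x * 2 ^ n⌋) ⁻¹' s = ⋃ k ∈ {k : ℤ | h k ∈ s}, dyadic n k := by
    ext x
    simp [mem_dyadic]
  rw [this]
  exact MeasurableSet.biUnion (Set.to_countable _) fun k _ ↦ measurableSet_dyadic n k

theorem floor_congr {m n : ℕ} (h : m ≤ n) {x y : ℝ} (hxy : ⌊x * 2 ^ n⌋ = ⌊y * 2 ^ n⌋) :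
    ⌊x * 2 ^ m⌋ = ⌊y * 2 ^ m⌋ := by
  have := (mem_iff_of_dyadic (mem_dyadic.2 hxy) (mem_dyadic.2 rfl) _
    (dyadicFiltration.mono h _ (measurableSet_dyadic m ⌊y * 2 ^ m⌋))).2 (mem_dyadic.2 rfl)
  exact mem_dyadic.1 this

theorem floor_congr' {n : ℕ} {x y : ℝ} (hxy : ⌊x * 2 ^ n⌋ = ⌊y * 2 ^ n⌋) : ⌊x⌋ = ⌊y⌋ := by
  simpa using floor_congr (Nat.zero_le n) hxy

theorem eq_of_floor_eq {n : ℕ} {g : ℝ → ℝ} (hg : Measurable[dyadicFiltration n] g) {x y : ℝ}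
    (hxy : ⌊x * 2 ^ n⌋ = ⌊y * 2 ^ n⌋) : g x = g y :=
  (mem_iff_of_dyadic (mem_dyadic.2 hxy) (mem_dyadic.2 rfl) _
    (hg (measurableSet_singleton (g y)))).2 rfl

/-- The average of `g` over the dyadic interval of length `2^(-n)` containing `x`. -/
def avg (P : Measure ℝ) (n : ℕ) (g : ℝ → ℝ) (x : ℝ) : ℝ :=
  (∫ y in dyadic n ⌊x * 2 ^ n⌋, g y ∂P) / P.real (dyadic n ⌊x * 2 ^ n⌋)

theorem measurable_avg (P : Measure ℝ) (n : ℕ) (g : ℝ → ℝ) :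
    Measurable[dyadicFiltration n] (avg P n g) :=
  measurable_comp_floor n fun k ↦ (∫ y in dyadic n k, g y ∂P) / P.real (dyadic n k)

theorem avg_nonneg (P : Measure ℝ) (n : ℕ) {g : ℝ → ℝ} (hg : ∀ x, 0 ≤ g x) (x : ℝ) :
    0 ≤ avg P n g x :=
  div_nonneg (integral_nonneg hg) measureReal_nonneg

theorem avg_congr (P : Measure ℝ) {n : ℕ} {g h : ℝ → ℝ} {x : ℝ}
    (hgh : ∀ y, ⌊y * 2 ^ n⌋ = ⌊x * 2 ^ n⌋ → g y = h y) : avg P n g x = avg P n h x := by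
  unfold avg
  have h1 : ∫ y in dyadic n ⌊x * 2 ^ n⌋, g y ∂P = ∫ y in dyadic n ⌊x * 2 ^ n⌋, h y ∂P :=
    setIntegral_congr_fun measurableSet_Ico fun y hy ↦ hgh y (mem_dyadic.1 hy)
  rw [h1]

theorem avg_zero (P : Measure ℝ) (n : ℕ) (x : ℝ) : avg P n (fun _ ↦ 0) x = 0 := by
  simp [avg]

theorem ae_dyadic_ne_zero (P : Measure ℝ) (n : ℕ) : ∀ᵐ x ∂P, P (dyadic n ⌊x * 2 ^ n⌋) ≠ 0 := by
  have hnull : ∀ᵐ x ∂P, ∀ k : ℤ, P (dyadic n k) = 0 → x ∉ dyadic n k := by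
    rw [ae_all_iff]
    intro k
    by_cases hk : P (dyadic n k) = 0
    · filter_upwards [measure_eq_zero_iff_ae_notMem.1 hk] with x hx _ using hx
    · exact ae_of_all _ fun x h ↦ absurd h hk
  filter_upwards [hnull] with x hx h
  exact hx _ h (mem_dyadic.2 rfl)

variable {P : Measure ℝ} [IsProbabilityMeasure P]

theorem abs_avg_le (n : ℕ) {g : ℝ → ℝ} {C : ℝ} (hg : ∀ x, |g x| ≤ C) (x : ℝ) :
    |avg P n g x| ≤ C := by
  have hC : 0 ≤ C := (abs_nonneg _).trans (hg 0)
  rw [avg, abs_div, abs_of_nonneg measureReal_nonneg]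
  refine div_le_of_le_mul₀ measureReal_nonneg hC ?_
  rw [← Real.norm_eq_abs]
  exact norm_setIntegral_le_of_norm_le_const (f := g) (measure_lt_top P _) fun y _ ↦ hg y

theorem condExp_ae_eq_avg (n : ℕ) {g : ℝ → ℝ} (hg : Integrable g P) :
    P[g|dyadicFiltration n] =ᵐ[P] avg P n g := by
  filter_upwards [ae_dyadic_ne_zero P n] with x h0
  have hxm : x ∈ dyadic n ⌊x * 2 ^ n⌋ := mem_dyadic.2 rfl
  set I := dyadic n ⌊x * 2 ^ n⌋ with hI
  have hIm : MeasurableSet[dyadicFiltration n] I := measurableSet_dyadic n _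
  have hconst : ∀ y ∈ I, (P[g|dyadicFiltration n]) y = (P[g|dyadicFiltration n]) x := fun y hy ↦
    eq_of_floor_eq stronglyMeasurable_condExp.measurable (mem_dyadic.1 hy)
  have h1 := setIntegral_condExp (dyadicFiltration.le n) hg hIm
  rw [setIntegral_congr_fun (dyadicFiltration.le n _ hIm) hconst, setIntegral_const,
    smul_eq_mul] at h1
  have h2 : P.real I ≠ 0 := by
    rw [measureReal_def, ENNReal.toReal_ne_zero]
    exact ⟨h0, measure_ne_top P I⟩
  rw [avg, ← hI, eq_div_iff h2, ← h1, mul_comm]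

theorem integral_mul_avg {n : ℕ} {g w : ℝ → ℝ} (hg : Integrable g P)
    (hw : BddMeasurable (dyadicFiltration n) w) :
    ∫ x, w x * avg P n g x ∂P = ∫ x, w x * g x ∂P := by
  obtain ⟨hwm, C, hC⟩ := hw
  have h1 := condExp_stronglyMeasurable_mul_of_bound (dyadicFiltration.le n) (μ := P)
    hwm.stronglyMeasurable hg C (ae_of_all _ hC)
  have h2 := integral_condExp (μ := P) (dyadicFiltration.le n) (f := w * g)
  calc ∫ x, w x * avg P n g x ∂P = ∫ x, (P[w * g|dyadicFiltration n]) x ∂P := by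
        refine integral_congr_ae ?_
        filter_upwards [h1, condExp_ae_eq_avg n hg] with x hx hx'
        rw [hx, Pi.mul_apply, hx']
    _ = _ := h2

/-! ### Restriction of dyadic martingales to unit intervals -/

theorem measurable_of_indicator {n : ℕ} {g : ℝ → ℝ}
    (h : ∀ j : ℤ, Measurable[dyadicFiltration n] ((unitInterval j).indicator g)) :
    Measurable[dyadicFiltration n] g := by
  intro s hs
  have : g ⁻¹' s = ⋃ j : ℤ, unitInterval j ∩ ((unitInterval j).indicator g) ⁻¹' s := by
    ext x
    simp only [Set.mem_preimage, Set.mem_iUnion, Set.mem_inter_iff]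
    constructor
    · intro hx
      have hm : x ∈ unitInterval ⌊x⌋ := mem_unitInterval.2 rfl
      exact ⟨⌊x⌋, hm, by rwa [Set.indicator_of_mem hm]⟩
    · rintro ⟨j, hm, hx⟩
      rwa [Set.indicator_of_mem hm] at hx
  rw [this]
  exact MeasurableSet.iUnion fun j ↦ (measurableSet_unitInterval n j).inter (h j hs)

/-- An ℱ_n-measurable function is constant on each dyadic interval of level n, and only finitely
many of them meet a bounded set. This is what places local dyadic martingales within reach of the
inequalities for bounded ones. -/
theorem bddMeasurable_of_support {n : ℕ} {g : ℝ → ℝ} (hg : Measurable[dyadicFiltration n] g)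
    (a b : ℤ) (h : ∀ x, g x ≠ 0 → (a : ℝ) ≤ x ∧ x < b) : BddMeasurable (dyadicFiltration n) g := by
  -- The values at left endpoints are all the values of g on [a, b).
  refine ⟨hg, ∑ k ∈ Finset.Ico (a * 2 ^ n) (b * 2 ^ n), |g ((k : ℝ) / 2 ^ n)|, fun x ↦ ?_⟩
  by_cases hx : g x = 0
  · rw [hx, abs_zero]
    exact Finset.sum_nonneg fun _ _ ↦ abs_nonneg _
  · obtain ⟨h1, h2⟩ := h x hx
    have h2n : (0 : ℝ) < 2 ^ n := by positivity
    have e : g x = g (((⌊x * 2 ^ n⌋ : ℤ) : ℝ) / 2 ^ n) := by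
      refine eq_of_floor_eq hg ?_
      rw [div_mul_cancel₀ _ h2n.ne', Int.floor_intCast]
    have hm : ⌊x * 2 ^ n⌋ ∈ Finset.Ico (a * 2 ^ n) (b * 2 ^ n) := by
      rw [Finset.mem_Ico, Int.le_floor, Int.floor_lt]
      push_cast
      exact ⟨by gcongr, by gcongr⟩
    rw [e]
    exact Finset.single_le_sum (f := fun k : ℤ ↦ |g ((k : ℝ) / 2 ^ n)|)
      (fun _ _ ↦ abs_nonneg _) hm

theorem bddMeasurable_indicator {n : ℕ} {g : ℝ → ℝ} (hg : Measurable[dyadicFiltration n] g)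
    (j : ℤ) : BddMeasurable (dyadicFiltration n) ((unitInterval j).indicator g) := by
  refine bddMeasurable_of_support (hg.indicator (measurableSet_unitInterval n j)) j (j + 1)
    fun x hx ↦ ?_
  have := Set.mem_of_indicator_ne_zero hx
  rw [unitInterval, Set.mem_Ico] at this
  exact_mod_cast this

theorem isBddMartingale_of_martingale {f : ℕ → ℝ → ℝ} (hf : Martingale f dyadicFiltration P)
    (hb : ∀ n, BddMeasurable (dyadicFiltration n) (f n)) :
    IsBddMartingale P dyadicFiltration f where
  bdd := hb
  step n w hw := by
    obtain ⟨hwm, C, hC⟩ := hw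
    have h1 := condExp_stronglyMeasurable_mul_of_bound (dyadicFiltration.le n) (μ := P)
      hwm.stronglyMeasurable (hb (n + 1)).int C (ae_of_all _ hC)
    have h2 := integral_condExp (μ := P) (dyadicFiltration.le n) (f := w * f (n + 1))
    refine h2.symm.trans (integral_congr_ae ?_)
    filter_upwards [h1, hf.2 n (n + 1) n.le_succ] with x hx hx'
    rw [hx, Pi.mul_apply, hx']

/-- Processes whose restriction to every unit interval is a dyadic martingale. -/
def IsLocalMartingale (P : Measure ℝ) (f : ℕ → ℝ → ℝ) : Prop :=
  ∀ j : ℤ, Martingale (fun n ↦ (unitInterval j).indicator (f n)) dyadicFiltration P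

theorem IsLocalMartingale.adapted {f : ℕ → ℝ → ℝ} (hf : IsLocalMartingale P f) (n : ℕ) :
    Measurable[dyadicFiltration n] (f n) :=
  measurable_of_indicator fun j ↦ ((hf j).1 n).measurable

theorem IsLocalMartingale.measurable {f : ℕ → ℝ → ℝ} (hf : IsLocalMartingale P f) (n : ℕ) :
    Measurable (f n) := (hf.adapted n).mono (dyadicFiltration.le n) le_rfl

theorem IsLocalMartingale.isBddMartingale {f : ℕ → ℝ → ℝ} (hf : IsLocalMartingale P f) (j : ℤ) :
    IsBddMartingale P dyadicFiltration fun n ↦ (unitInterval j).indicator (f n) :=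
  isBddMartingale_of_martingale (hf j) fun n ↦ bddMeasurable_indicator (hf.adapted n) j

/-- The conditional variances of the restriction of `f` to a unit interval. -/
def condVar (P : Measure ℝ) (f : ℕ → ℝ → ℝ) (j : ℤ) (n : ℕ) : ℝ → ℝ :=
  avg P n fun y ↦
    ((unitInterval j).indicator (f (n + 1)) y - (unitInterval j).indicator (f n) y) ^ 2

theorem IsLocalMartingale.isCondVar {f : ℕ → ℝ → ℝ} (hf : IsLocalMartingale P f) (j : ℤ) :
    IsCondVar P dyadicFiltration (fun n ↦ (unitInterval j).indicator (f n)) (condVar P f j) where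
  bdd n := by
    obtain ⟨_, C, hC⟩ := ((hf.isBddMartingale j).diff n).sq
    exact ⟨measurable_avg P n _, C, abs_avg_le n hC⟩
  nonneg n x := avg_nonneg P n (fun _ ↦ sq_nonneg _) x
  step n w hw := integral_mul_avg ((hf.isBddMartingale j).diff n).sq.int hw

theorem condVar_eq_zero (f : ℕ → ℝ → ℝ) {j : ℤ} (n : ℕ) {x : ℝ} (hx : x ∉ unitInterval j) :
    condVar P f j n x = 0 := by
  rw [condVar, ← avg_zero P n x]
  refine avg_congr P fun y hy ↦ ?_
  have : y ∉ unitInterval j := by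
    rw [mem_unitInterval] at hx ⊢
    rwa [floor_congr' hy]
  simp [this]

/-- Both sides are averages over the same dyadic interval, which lies inside A_j. Intervals of mass
zero are discarded, since there the real average is a division by zero. -/
theorem IsLocalMartingale.condSquare_ae {f : ℕ → ℝ → ℝ} (hf : IsLocalMartingale P f) (j : ℤ) :
    ∀ᵐ x ∂P, x ∈ unitInterval j →
      condSquare P f x = (∑' n, ENNReal.ofReal (condVar P f j n x)) ^ (1 / 2 : ℝ) := by
  have h1 := ae_all_iff.2 fun n ↦
    condLExp_dyadic_ae P n (fun y ↦ ‖f (n + 1) y - f n y‖ₑ ^ (2 : ℝ))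
  have h2 := ae_all_iff.2 fun n ↦ ae_dyadic_ne_zero P n
  filter_upwards [h1, h2] with x hx1 hx2 hxj
  unfold condSquare
  congr 2
  ext n
  rw [hx1 n, condVar, avg, ENNReal.ofReal_div_of_pos, ENNReal.div_eq_inv_mul, mul_comm]
  · congr 1
    · rw [ofReal_measureReal]
    · rw [ofReal_integral_eq_lintegral_ofReal]
      · refine setLIntegral_congr_fun measurableSet_Ico fun y hy ↦ ?_
        have hyj : y ∈ unitInterval j := by
          rw [mem_unitInterval] at hxj ⊢
          rw [← hxj]
          exact floor_congr' (mem_dyadic.1 hy)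
        rw [Set.indicator_of_mem hyj, Set.indicator_of_mem hyj, ← sq_abs,
          ENNReal.ofReal_pow (abs_nonneg _), ← Real.enorm_eq_ofReal_abs]
        exact_mod_cast rfl
      · exact ((hf.isBddMartingale j).diff n).sq.int.integrableOn
      · exact ae_of_all _ fun _ ↦ sq_nonneg _
  · rw [measureReal_def]
    exact ENNReal.toReal_pos (hx2 n) (measure_ne_top P _)

theorem ofReal_integral_rpow {j : ℤ} {n : ℕ} {g : ℝ → ℝ} (hg : BddMeasurable (dyadicFiltration n) g)
    (hg0 : ∀ x, 0 ≤ g x) (hgj : ∀ x, x ∉ unitInterval j → g x = 0) {a : ℝ} (ha : 0 < a) :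
    ENNReal.ofReal (∫ x, g x ^ a ∂P) = ∫⁻ x in unitInterval j, ENNReal.ofReal (g x) ^ a ∂P := by
  rw [ofReal_integral_eq_lintegral_ofReal (hg.rpow ha.le).int
    (ae_of_all _ fun x ↦ Real.rpow_nonneg (hg0 x) a),
    ← lintegral_indicator (measurableSet_unitInterval' j)]
  congr 1
  ext x
  rw [← ENNReal.ofReal_rpow_of_nonneg (hg0 x) ha.le]
  by_cases hx : x ∈ unitInterval j
  · rw [Set.indicator_of_mem hx]
  · rw [Set.indicator_of_notMem hx, hgj x hx, ENNReal.ofReal_zero, ENNReal.zero_rpow_of_pos ha]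

theorem runMax_indicator (f : ℕ → ℝ → ℝ) (s : Set ℝ) (n : ℕ) (x : ℝ) :
    runMax (fun n ↦ s.indicator (f n)) n x = s.indicator (runMax f n) x := by
  by_cases hx : x ∈ s
  · induction n with
    | zero => simp [runMax, hx]
    | succ n ih => rw [runMax_succ, ih]; simp [hx, runMax_succ]
  · induction n with
    | zero => simp [runMax, hx]
    | succ n ih => rw [runMax_succ, ih]; simp [hx]

theorem jump_indicator (f : ℕ → ℝ → ℝ) (s : Set ℝ) :
    jump (fun n ↦ s.indicator (f n)) = fun n ↦ s.indicator (jump f n) := by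
  ext n x
  by_cases hx : x ∈ s <;> simp [jump, hx]

theorem IsLocalMartingale.ofReal_integral_runMax {f : ℕ → ℝ → ℝ} (hf : IsLocalMartingale P f)
    (j : ℤ) (n : ℕ) {a : ℝ} (ha : 0 < a) :
    ENNReal.ofReal (∫ x, runMax (fun n ↦ (unitInterval j).indicator (f n)) n x ^ a ∂P) =
      ∫⁻ x in unitInterval j, ENNReal.ofReal (runMax f n x) ^ a ∂P := by
  rw [ofReal_integral_rpow (j := j) (BddMeasurable.runMax (hf.isBddMartingale j).bdd n)
    (runMax_nonneg _ n) _ ha]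
  · refine setLIntegral_congr_fun (measurableSet_unitInterval' j) fun x hx ↦ ?_
    rw [runMax_indicator, Set.indicator_of_mem hx]
  · intro x hx
    rw [runMax_indicator, Set.indicator_of_notMem hx]

/-! ### The martingale inequalities on one unit interval. -/

theorem maximal_eq_iSup_runMax (f : ℕ → ℝ → ℝ) (x : ℝ) :
    maximal f x = ⨆ n, ENNReal.ofReal (runMax f n x) := by
  refine le_antisymm (iSup_mono fun n ↦ ?_) (iSup_le fun n ↦ ?_)
  · rw [Real.enorm_eq_ofReal_abs]
    exact ENNReal.ofReal_le_ofReal (abs_le_runMax f le_rfl x)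
  · induction n with
    | zero =>
      refine le_trans (le_of_eq ?_) (le_iSup _ 0)
      rw [Real.enorm_eq_ofReal_abs]
      rfl
    | succ n ih =>
      rw [runMax_succ, ENNReal.ofReal_max]
      refine max_le ih ?_
      rw [← Real.enorm_eq_ofReal_abs]
      exact le_iSup (fun n ↦ ‖f n x‖ₑ) (n + 1)

theorem maxJump_eq_maximal (f : ℕ → ℝ → ℝ) (x : ℝ) : maxJump f x = maximal (jump f) x := by
  refine le_antisymm (iSup_le fun n ↦ ?_) (iSup_le fun n ↦ ?_)
  · exact le_iSup (fun n ↦ ‖jump f n x‖ₑ) (n + 1)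
  · cases n with
    | zero => simp [jump]
    | succ n => exact le_iSup (fun n ↦ ‖f (n + 1) x - f n x‖ₑ) n

theorem measurable_maximal' {f : ℕ → ℝ → ℝ} (hf : ∀ n, Measurable (f n)) : Measurable (maximal f) :=
  Measurable.iSup fun n ↦ (hf n).enorm

theorem measurable_runMax {f : ℕ → ℝ → ℝ} (hf : ∀ n, Measurable (f n)) (n : ℕ) :
    Measurable (runMax f n) := by
  induction n with
  | zero => exact continuous_abs.measurable.comp (hf 0)
  | succ n ih => exact ih.max (continuous_abs.measurable.comp (hf (n + 1)))

theorem iSup_rpow {ι : Type*} [Nonempty ι] (u : ι → ℝ≥0∞) {a : ℝ} (ha : 0 < a) :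
    (⨆ i, u i) ^ a = ⨆ i, u i ^ a :=
  (ENNReal.orderIsoRpow a ha).map_iSup u

/-- Monotone convergence; it carries inequalities for finite n over to the full maximal function. -/
theorem lintegral_maximal_rpow {f : ℕ → ℝ → ℝ} (hf : ∀ n, Measurable (f n)) (s : Set ℝ) {a : ℝ}
    (ha : 0 < a) : ∫⁻ x in s, maximal f x ^ a ∂P =
      ⨆ n, ∫⁻ x in s, ENNReal.ofReal (runMax f n x) ^ a ∂P := by
  rw [← lintegral_iSup]
  · congr 1
    ext x
    rw [maximal_eq_iSup_runMax, iSup_rpow _ ha]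
  · exact fun n ↦ ((measurable_runMax hf n).ennreal_ofReal).pow_const a
  · exact fun m n hmn x ↦ ENNReal.rpow_le_rpow
      (ENNReal.ofReal_le_ofReal (runMax_mono f x hmn)) ha.le

theorem exists_local_doob {p : ℝ} (hp : 1 < p) : ∃ C : ℝ≥0∞, C ≠ ∞ ∧
    ∀ (P : Measure ℝ) [IsProbabilityMeasure P] (f : ℕ → ℝ → ℝ), IsLocalMartingale P f →
      ∀ (j : ℤ) (n : ℕ), ∫⁻ x in unitInterval j, ENNReal.ofReal (runMax f n x) ^ p ∂P ≤
        C * ∫⁻ x in unitInterval j, ‖f n x‖ₑ ^ p ∂P := by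
  obtain ⟨C, hC, h⟩ := exists_doob ℝ hp
  refine ⟨ENNReal.ofReal C, ENNReal.ofReal_ne_top, fun P _ f hf j n ↦ ?_⟩
  have h1 := ENNReal.ofReal_le_ofReal (h P _ _ (hf.isBddMartingale j) n)
  have hp0 : 0 < p := by linarith
  rw [hf.ofReal_integral_runMax j n hp0, ENNReal.ofReal_mul hC,
    ofReal_integral_rpow (j := j) ((hf.isBddMartingale j).bdd n).abs (fun _ ↦ abs_nonneg _) _
      hp0] at h1
  · refine h1.trans (le_of_eq ?_)
    congr 1
    refine setLIntegral_congr_fun (measurableSet_unitInterval' j) fun x hx ↦ ?_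
    rw [Set.indicator_of_mem hx, Real.enorm_eq_ofReal_abs]
  · intro x hx
    simp [hx]

theorem IsLocalMartingale.lintegral_condSquare {f : ℕ → ℝ → ℝ} (hf : IsLocalMartingale P f) (j : ℤ)
    {r : ℝ} (hr : 0 < r) : ∫⁻ x in unitInterval j, condSquare P f x ^ r ∂P =
      ⨆ n, ENNReal.ofReal (∫ x, (∑ i ∈ Finset.range n, condVar P f j i x) ^ (r / 2) ∂P) := by
  have hσ := hf.isCondVar j
  have e : ∀ n, ENNReal.ofReal (∫ x, (∑ i ∈ Finset.range n, condVar P f j i x) ^ (r / 2) ∂P) =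
      ∫⁻ x in unitInterval j,
        ENNReal.ofReal (∑ i ∈ Finset.range n, condVar P f j i x) ^ (r / 2) ∂P := fun n ↦
    ofReal_integral_rpow (hσ.sum_bdd' n) (hσ.sum_nonneg n)
      (fun x hx ↦ Finset.sum_eq_zero fun i _ ↦ condVar_eq_zero f i hx) (by positivity)
  simp only [e]
  rw [← lintegral_iSup]
  · refine setLIntegral_congr_fun_ae (measurableSet_unitInterval' j) ?_
    filter_upwards [hf.condSquare_ae j] with x hx hxj
    rw [hx hxj, ← ENNReal.rpow_mul, one_div_mul_eq_div, ← iSup_rpow _ (by positivity),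
      ENNReal.tsum_eq_iSup_nat]
    congr 2
    ext n
    rw [ENNReal.ofReal_sum_of_nonneg fun i _ ↦ hσ.nonneg i x]
  · exact fun n ↦ ((hσ.sum_bdd' n).1.mono (dyadicFiltration.le n) le_rfl).ennreal_ofReal.pow_const _
  · exact fun m n hmn x ↦ ENNReal.rpow_le_rpow
      (ENNReal.ofReal_le_ofReal (hσ.sum_mono x hmn)) (by positivity)

/-- For each n the right side of `exists_rosenthal` is dominated by its value for the whole
martingale; the supremum over n is then taken on the left. -/
theorem exists_local_rosenthal {r : ℝ} (hr : 2 ≤ r) : ∃ C : ℝ≥0∞, C ≠ ∞ ∧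
    ∀ (P : Measure ℝ) [IsProbabilityMeasure P], ∀ f ∈ martingales P, ∀ j : ℤ,
      ∫⁻ x in unitInterval j, maximal f x ^ r ∂P ≤
        C * (∫⁻ x in unitInterval j, condSquare P f x ^ r ∂P +
          ∫⁻ x in unitInterval j, maxJump f x ^ r ∂P) := by
  have hr0 : 0 < r := by linarith
  obtain ⟨C, hC, h⟩ := exists_rosenthal ℝ hr
  refine ⟨ENNReal.ofReal C, ENNReal.ofReal_ne_top, fun P _ f hfm j ↦ ?_⟩
  have hf : IsLocalMartingale P f := hfm.2
  rw [lintegral_maximal_rpow hf.measurable _ hr0]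
  refine iSup_le fun n ↦ ?_
  have h1 := ENNReal.ofReal_le_ofReal (h P _ _ _ (by simp [hfm.1])
    (hf.isBddMartingale j) (hf.isCondVar j) n)
  rw [hf.ofReal_integral_runMax j n hr0, ENNReal.ofReal_mul hC] at h1
  refine h1.trans ?_
  gcongr
  refine ENNReal.ofReal_add_le.trans (add_le_add ?_ ?_)
  · rw [hf.lintegral_condSquare j hr0]
    exact le_iSup (fun n ↦ ENNReal.ofReal
      (∫ x, (∑ i ∈ Finset.range n, condVar P f j i x) ^ (r / 2) ∂P)) n
  · rw [ofReal_integral_rpow (j := j) (BddMeasurable.runMax (hf.isBddMartingale j).jump_bdd n)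
      (runMax_nonneg _ n) _ hr0]
    · refine setLIntegral_mono_ae ?_ (ae_of_all _ fun x hx ↦ ?_)
      · exact ((measurable_maxJump hfm).pow_const _).aemeasurable
      · rw [jump_indicator, runMax_indicator, Set.indicator_of_mem hx, maxJump_eq_maximal,
          maximal_eq_iSup_runMax]
        exact ENNReal.rpow_le_rpow (le_iSup (fun n ↦ ENNReal.ofReal (runMax (jump f) n x)) n) hr0.le
    · intro x hx
      rw [jump_indicator, runMax_indicator, Set.indicator_of_notMem hx]

theorem exists_local_condSquare {r : ℝ} (hr : 2 ≤ r) : ∃ C : ℝ≥0∞, C ≠ ∞ ∧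
    ∀ (P : Measure ℝ) [IsProbabilityMeasure P], ∀ f ∈ martingales P, ∀ j : ℤ,
      ∫⁻ x in unitInterval j, condSquare P f x ^ r ∂P ≤
        C * ∫⁻ x in unitInterval j, maximal f x ^ r ∂P := by
  have hr0 : 0 < r := by linarith
  obtain ⟨C, hC, h⟩ := exists_condVar_le ℝ hr
  refine ⟨ENNReal.ofReal C, ENNReal.ofReal_ne_top, fun P _ f hfm j ↦ ?_⟩
  have hf : IsLocalMartingale P f := hfm.2
  rw [hf.lintegral_condSquare j hr0]
  refine iSup_le fun n ↦ ?_
  have h1 := ENNReal.ofReal_le_ofReal (h P _ _ _ (hf.isBddMartingale j) (hf.isCondVar j) n)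
  rw [ENNReal.ofReal_mul hC, hf.ofReal_integral_runMax j n hr0] at h1
  refine h1.trans ?_
  rw [lintegral_maximal_rpow hf.measurable _ hr0]
  gcongr
  exact le_iSup (fun n ↦ ∫⁻ x in unitInterval j, ENNReal.ofReal (runMax f n x) ^ r ∂P) n

theorem maxJump_le (f : ℕ → ℝ → ℝ) (x : ℝ) : maxJump f x ≤ 2 * maximal f x := by
  refine iSup_le fun n ↦ ?_
  rw [two_mul]
  exact (enorm_sub_le).trans (add_le_add (le_iSup (fun n ↦ ‖f n x‖ₑ) (n + 1))
    (le_iSup (fun n ↦ ‖f n x‖ₑ) n))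

end

section

variable {P : Measure ℝ} [IsProbabilityMeasure P]

/-! ### Amalgam norms -/

theorem tsum_eq_lintegral_count {ι : Type*} (u : ι → ℝ≥0∞) :
    ∑' j, u j = ∫⁻ j, u j ∂(@Measure.count ι ⊤) := by
  let _ : MeasurableSpace ι := ⊤
  exact (lintegral_count' measurable_from_top).symm

theorem tsum_iSup_of_monotone {ι : Type*} {u : ℕ → ι → ℝ≥0∞} (hu : Monotone u) :
    ∑' j, ⨆ n, u n j = ⨆ n, ∑' j, u n j := by
  let _ : MeasurableSpace ι := ⊤
  simp only [tsum_eq_lintegral_count]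
  exact lintegral_iSup (fun n ↦ measurable_from_top) hu

theorem tsum_mul_le {ι : Type*} {p q : ℝ} (hpq : p.HolderConjugate q) (a b : ι → ℝ≥0∞) :
    ∑' j, a j * b j ≤ (∑' j, a j ^ p) ^ (1 / p) * (∑' j, b j ^ q) ^ (1 / q) := by
  let _ : MeasurableSpace ι := ⊤
  simp only [tsum_eq_lintegral_count]
  exact ENNReal.lintegral_mul_le_Lp_mul_Lq _ hpq (measurable_from_top (f := a)).aemeasurable
    (measurable_from_top (f := b)).aemeasurable

theorem tendsto_tsum_zero {ι : Type*} {u : ℕ → ι → ℝ≥0∞} {b : ι → ℝ≥0∞} (hb : ∑' j, b j ≠ ∞)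
    (hub : ∀ n j, u n j ≤ b j) (hu : ∀ j, Tendsto (fun n ↦ u n j) atTop (𝓝 0)) :
    Tendsto (fun n ↦ ∑' j, u n j) atTop (𝓝 0) := by
  let _ : MeasurableSpace ι := ⊤
  simp only [tsum_eq_lintegral_count] at hb ⊢
  have := tendsto_lintegral_of_dominated_convergence (μ := @Measure.count ι ⊤) (f := fun _ ↦ 0) b
    (fun n ↦ measurable_from_top (f := u n)) (fun n ↦ ae_of_all _ (hub n)) hb (ae_of_all _ hu)
  simpa using this

theorem lintegral_eq_tsum (g : ℝ → ℝ≥0∞) :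
    ∫⁻ x, g x ∂P = ∑' j : ℤ, ∫⁻ x in unitInterval j, g x ∂P := by
  rw [← lintegral_iUnion measurableSet_unitInterval', ← setLIntegral_univ]
  · congr
    symm
    exact Set.eq_univ_of_forall fun x ↦ Set.mem_iUnion.2 ⟨⌊x⌋, mem_unitInterval.2 rfl⟩
  · intro i j hij
    refine Set.disjoint_left.2 fun x hi hj ↦ hij ?_
    rw [← mem_unitInterval.1 hi, mem_unitInterval.1 hj]

theorem amalgamNorm_congr {p q : ℝ} {g h : ℝ → ℝ≥0∞} (hgh : g =ᵐ[P] h) :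
    amalgamNorm P p q g = amalgamNorm P p q h := by
  unfold amalgamNorm
  congr 2
  ext j
  congr 1
  refine lintegral_congr_ae (ae_restrict_of_ae ?_)
  filter_upwards [hgh] with x hx
  rw [hx]

/-- The constant is the same for all j and leaves the sum. Every martingale inequality passes from
the A_j to the amalgam norm in this way. -/
theorem amalgamNorm_le_of_local {p q : ℝ} (hp : 0 < p) (hq : 0 < q) {C : ℝ≥0∞} {g h : ℝ → ℝ≥0∞}
    (hgh : ∀ j : ℤ, ∫⁻ x in unitInterval j, g x ^ p ∂P ≤
      C * ∫⁻ x in unitInterval j, h x ^ p ∂P) :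
    amalgamNorm P p q g ≤ C ^ (1 / p) * amalgamNorm P p q h := by
  unfold amalgamNorm
  have e : C ^ (1 / p) = ((C ^ (q / p)) ^ (1 / q)) := by
    rw [← ENNReal.rpow_mul]
    congr 1
    field_simp
  rw [e, ← ENNReal.mul_rpow_of_nonneg _ _ (by positivity), ← ENNReal.tsum_mul_left]
  refine ENNReal.rpow_le_rpow (ENNReal.tsum_le_tsum fun j ↦ ?_) (by positivity)
  rw [← ENNReal.mul_rpow_of_nonneg _ _ (by positivity)]
  exact ENNReal.rpow_le_rpow (hgh j) (by positivity)

theorem lintegral_ne_top_of_amalgamNorm {p q : ℝ} (hp : 0 < p) (hq : 0 < q) {g : ℝ → ℝ≥0∞}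
    (hg : amalgamNorm P p q g ≠ ∞) (j : ℤ) : ∫⁻ x in unitInterval j, g x ^ p ∂P ≠ ∞ := by
  intro h
  apply hg
  unfold amalgamNorm
  have h1 : ∞ ≤ ∑' j : ℤ, (∫⁻ x in unitInterval j, g x ^ p ∂P) ^ (q / p) := by
    refine le_trans (le_of_eq ?_) (ENNReal.le_tsum j)
    rw [h, ENNReal.top_rpow_of_pos (by positivity)]
  rw [top_le_iff.1 h1, ENNReal.top_rpow_of_pos (by positivity)]

/-- Hölder's inequality on each A_j, then Hölder's inequality for the series over j. -/
theorem lintegral_mul_le_amalgamNorm {p q p' q' : ℝ} (hp : p.HolderConjugate p')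
    (hq : q.HolderConjugate q') {g h : ℝ → ℝ≥0∞} (hg : Measurable g) (hh : Measurable h) :
    ∫⁻ x, g x * h x ∂P ≤ amalgamNorm P p q g * amalgamNorm P p' q' h := by
  rw [lintegral_eq_tsum]
  refine (ENNReal.tsum_le_tsum fun j ↦ ENNReal.lintegral_mul_le_Lp_mul_Lq
    (P.restrict (unitInterval j)) hp hg.aemeasurable hh.aemeasurable).trans ?_
  refine (tsum_mul_le hq _ _).trans (le_of_eq ?_)
  unfold amalgamNorm
  simp only [← ENNReal.rpow_mul, one_div_mul_eq_div]

theorem amalgamNorm_maximal {p q : ℝ} (hp : 0 < p) (hq : 0 < q) {f : ℕ → ℝ → ℝ}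
    (hf : ∀ n, Measurable (f n)) : amalgamNorm P p q (maximal f) =
      ⨆ n, amalgamNorm P p q fun x ↦ ENNReal.ofReal (runMax f n x) := by
  unfold amalgamNorm
  rw [← iSup_rpow _ (by positivity), ← tsum_iSup_of_monotone]
  · congr 2
    ext j
    rw [lintegral_maximal_rpow hf _ hp, iSup_rpow _ (by positivity)]
  · intro m n hmn j
    refine ENNReal.rpow_le_rpow (lintegral_mono fun x ↦ ENNReal.rpow_le_rpow
      (ENNReal.ofReal_le_ofReal (runMax_mono f x hmn)) hp.le) (by positivity)

/-- Dominated convergence twice: in the integral over each A_j and in the sum over j. -/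
theorem tendsto_amalgamNorm_zero {p q : ℝ} (hp : 0 < p) (hq : 0 < q) {h : ℕ → ℝ → ℝ≥0∞}
    {H : ℝ → ℝ≥0∞} (hm : ∀ n, Measurable (h n)) (hH : amalgamNorm P p q H ≠ ∞)
    (hle : ∀ n, ∀ᵐ x ∂P, h n x ≤ H x) (hlim : ∀ᵐ x ∂P, Tendsto (fun n ↦ h n x) atTop (𝓝 0)) :
    Tendsto (fun n ↦ amalgamNorm P p q (h n)) atTop (𝓝 0) := by
  have rp : ∀ {u : ℕ → ℝ≥0∞} {a : ℝ}, 0 < a → Tendsto u atTop (𝓝 0) →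
      Tendsto (fun n ↦ u n ^ a) atTop (𝓝 0) := by
    intro u a ha hu
    have := (ENNReal.continuous_rpow_const (y := a)).tendsto 0
    rw [ENNReal.zero_rpow_of_pos ha] at this
    exact this.comp hu
  unfold amalgamNorm at hH ⊢
  refine rp (by positivity) (tendsto_tsum_zero
    (b := fun j ↦ (∫⁻ x in unitInterval j, H x ^ p ∂P) ^ (q / p)) ?_ (fun n j ↦ ?_) fun j ↦ ?_)
  · intro h
    rw [h, ENNReal.top_rpow_of_pos (by positivity)] at hH
    exact hH rfl
  · refine ENNReal.rpow_le_rpow (lintegral_mono_ae (ae_restrict_of_ae ?_)) (by positivity)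
    filter_upwards [hle n] with x hx using ENNReal.rpow_le_rpow hx hp.le
  · refine rp (by positivity) ?_
    have := tendsto_lintegral_of_dominated_convergence (μ := P.restrict (unitInterval j))
      (F := fun n x ↦ h n x ^ p) (f := fun _ ↦ 0) (fun x ↦ H x ^ p)
      (fun n ↦ (hm n).pow_const p) (fun n ↦ ?_) (lintegral_ne_top_of_amalgamNorm hp hq hH j) ?_
    · simpa using this
    · refine ae_restrict_of_ae ?_
      filter_upwards [hle n] with x hx using ENNReal.rpow_le_rpow hx hp.le
    · refine ae_restrict_of_ae ?_
      filter_upwards [hlim] with x hx using rp hp hx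

theorem amalgamNorm_lt_top_of_bdd {p q : ℝ} (hp : 0 < p) (hq : 0 < q) {g : ℝ → ℝ≥0∞} {C : ℝ≥0∞}
    (hC : C ≠ ∞) (hg : ∀ x, g x ≤ C) (K : ℕ) (hK : ∀ x, g x ≠ 0 → -(K : ℝ) ≤ x ∧ x < K) :
    amalgamNorm P p q g < ∞ := by
  unfold amalgamNorm
  have h0 : ∀ j ∉ Finset.Ico (-(K : ℤ)) K,
      (∫⁻ x in unitInterval j, g x ^ p ∂P) ^ (q / p) = 0 := by
    intro j hj
    have : ∫⁻ x in unitInterval j, g x ^ p ∂P = ∫⁻ x in unitInterval j, 0 ∂P := by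
      refine setLIntegral_congr_fun (measurableSet_unitInterval' j) fun x hx ↦ ?_
      have hx0 : g x = 0 := by
        by_contra h
        obtain ⟨h1, h2⟩ := hK x h
        apply hj
        rw [← mem_unitInterval.1 hx, Finset.mem_Ico, Int.le_floor, Int.floor_lt]
        push_cast
        exact ⟨h1, h2⟩
      rw [hx0, ENNReal.zero_rpow_of_pos hp]
    rw [this, lintegral_zero, ENNReal.zero_rpow_of_pos (by positivity)]
  rw [tsum_eq_sum h0]
  refine ENNReal.rpow_lt_top_of_nonneg (by positivity) (ENNReal.sum_ne_top.2 fun j _ ↦ ?_)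
  refine ENNReal.rpow_ne_top_of_nonneg (by positivity) (ne_top_of_le_ne_top
    (b := ∫⁻ x in unitInterval j, C ^ p ∂P) ?_
    (lintegral_mono fun x ↦ ENNReal.rpow_le_rpow (hg x) hp.le))
  rw [setLIntegral_const]
  exact ENNReal.mul_ne_top (ENNReal.rpow_ne_top_of_nonneg hp.le hC) (measure_ne_top _ _)

/-! ### Comparison of the norms of dyadic martingales -/

/-- Doob's inequality on each A_j. A bound from level N on is enough because the running maximum
increases with n; this suits step functions, which equal their averages from some level on. -/
theorem exists_maximal_le_of_forall {p q : ℝ} (hp : 1 < p) (hq : 1 ≤ q) : ∃ C : ℝ≥0∞, C ≠ ∞ ∧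
    ∀ (P : Measure ℝ) [IsProbabilityMeasure P] (f : ℕ → ℝ → ℝ), IsLocalMartingale P f →
      ∀ (N : ℕ) (B : ℝ≥0∞), (∀ n ≥ N, amalgamNorm P p q (fun x ↦ ‖f n x‖ₑ) ≤ B) →
        amalgamNorm P p q (maximal f) ≤ C * B := by
  have hp0 : 0 < p := by linarith
  have hq0 : 0 < q := by linarith
  obtain ⟨C, hC, h⟩ := exists_local_doob hp
  refine ⟨C ^ (1 / p), ENNReal.rpow_ne_top_of_nonneg (by positivity) hC,
    fun P _ f hf N B hB ↦ ?_⟩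
  rw [amalgamNorm_maximal hp0 hq0 hf.measurable]
  refine iSup_le fun n ↦ ?_
  have h1 : amalgamNorm P p q (fun x ↦ ENNReal.ofReal (runMax f n x)) ≤
      amalgamNorm P p q (fun x ↦ ENNReal.ofReal (runMax f (max n N) x)) :=
    amalgamNorm_mono hp.le hq (ae_of_all _ fun x ↦
      ENNReal.ofReal_le_ofReal (runMax_mono f x (le_max_left n N)))
  refine h1.trans ((amalgamNorm_le_of_local hp0 hq0 fun j ↦ h P f hf j _).trans ?_)
  gcongr
  exact hB _ (le_max_right n N)

/-- Rosenthal's inequality, with the two p-th powers merged by a^p + b^p ≤ (a + b)^p. With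
`exists_condSquare_le` it makes the dual norm equivalent to a maximal norm. -/
theorem exists_maximal_le {p q : ℝ} (hp : 2 ≤ p) (hq : 1 ≤ q) : ∃ C : ℝ≥0∞, C ≠ ∞ ∧
    ∀ (P : Measure ℝ) [IsProbabilityMeasure P], ∀ f ∈ martingales P,
      amalgamNorm P p q (maximal f) ≤
        C * (amalgamNorm P p q (condSquare P f) + amalgamNorm P p q (maxJump f)) := by
  have hp1 : 1 ≤ p := by linarith
  have hp0 : 0 < p := by linarith
  obtain ⟨C, hC, h⟩ := exists_local_rosenthal hp
  refine ⟨C ^ (1 / p), ENNReal.rpow_ne_top_of_nonneg (by positivity) hC, fun P _ f hf ↦ ?_⟩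
  refine le_trans ?_ (mul_le_mul_right (amalgamNorm_add_le hp1 hq (measurable_condSquare P f)
    (measurable_maxJump hf)) _)
  refine amalgamNorm_le_of_local hp0 (by linarith) fun j ↦ (h P f hf j).trans ?_
  gcongr
  rw [← lintegral_add_left ((measurable_condSquare P f).pow_const p)]
  exact lintegral_mono fun x ↦ ENNReal.add_rpow_le_rpow_add _ _ hp1

theorem exists_condSquare_le {p q : ℝ} (hp : 2 ≤ p) (hq : 1 ≤ q) : ∃ C : ℝ≥0∞, C ≠ ∞ ∧
    ∀ (P : Measure ℝ) [IsProbabilityMeasure P], ∀ f ∈ martingales P,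
      amalgamNorm P p q (condSquare P f) + amalgamNorm P p q (maxJump f) ≤
        C * amalgamNorm P p q (maximal f) := by
  have hp0 : 0 < p := by linarith
  obtain ⟨C, hC, h⟩ := exists_local_condSquare hp
  refine ⟨C ^ (1 / p) + 2, ENNReal.add_ne_top.2
    ⟨ENNReal.rpow_ne_top_of_nonneg (by positivity) hC, by simp⟩, fun P _ f hf ↦ ?_⟩
  rw [add_mul]
  refine add_le_add (amalgamNorm_le_of_local hp0 (by linarith) fun j ↦ h P f hf j) ?_
  rw [← amalgamNorm_const_mul (by linarith) hq (by simp)]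
  exact amalgamNorm_mono (by linarith) hq (ae_of_all _ (maxJump_le f))

end

section

variable {P : Measure ℝ} [IsProbabilityMeasure P]

/-! ### Test functions and the martingales they generate -/

/-- Bounded measurable functions of bounded support. -/
def testFunctions : Submodule ℝ (ℝ → ℝ) where
  carrier := {g | Measurable g ∧ (∃ C : ℝ, ∀ x, |g x| ≤ C) ∧
    ∃ K : ℕ, ∀ x, g x ≠ 0 → -(K : ℝ) ≤ x ∧ x < K}
  zero_mem' := ⟨measurable_const, ⟨0, by simp⟩, 0, by simp⟩
  add_mem' := by
    rintro g h ⟨hg, ⟨C, hC⟩, K, hK⟩ ⟨hh, ⟨D, hD⟩, M, hM⟩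
    refine ⟨hg.add hh, ⟨C + D, fun x ↦ (abs_add_le _ _).trans (add_le_add (hC x) (hD x))⟩,
      max K M, fun x hx ↦ ?_⟩
    have h1 : (K : ℝ) ≤ ((max K M : ℕ) : ℝ) := by exact_mod_cast le_max_left K M
    have h2 : (M : ℝ) ≤ ((max K M : ℕ) : ℝ) := by exact_mod_cast le_max_right K M
    by_cases hgx : g x = 0
    · have hhx : h x ≠ 0 := fun hhx ↦ hx (by simp [hgx, hhx])
      have := hM x hhx
      constructor <;> linarith
    · have := hK x hgx
      constructor <;> linarith
  smul_mem' := by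
    rintro c g ⟨hg, ⟨C, hC⟩, K, hK⟩
    refine ⟨hg.const_smul c, ⟨|c| * C, fun x ↦ ?_⟩, K, fun x hx ↦ hK x fun h ↦ hx (by simp [h])⟩
    rw [Pi.smul_apply, smul_eq_mul, abs_mul]
    exact mul_le_mul_of_nonneg_left (hC x) (abs_nonneg c)

theorem integrable_of_mem_testFunctions {g : ℝ → ℝ} (hg : g ∈ testFunctions) : Integrable g P := by
  obtain ⟨hm, ⟨C, hC⟩, _⟩ := hg
  exact Integrable.of_bound hm.aestronglyMeasurable C (ae_of_all _ hC)

theorem bddMeasurable_of_mem_testFunctions {g : ℝ → ℝ} (hg : g ∈ testFunctions) {n : ℕ}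
    (h : Measurable[dyadicFiltration n] g) : BddMeasurable (dyadicFiltration n) g :=
  ⟨h, hg.2.1⟩

theorem mem_testFunctions {n : ℕ} {g : ℝ → ℝ} (hg : Measurable[dyadicFiltration n] g) (K : ℕ)
    (hK : ∀ x, g x ≠ 0 → -(K : ℝ) ≤ x ∧ x < K) : g ∈ testFunctions :=
  ⟨hg.mono (dyadicFiltration.le n) le_rfl, (bddMeasurable_of_support hg (-K) K fun x hx ↦ by
    push_cast; exact hK x hx).2, K, hK⟩

theorem mem_Ico_floor {K : ℕ} {x : ℝ} : -(K : ℝ) ≤ x ∧ x < K ↔ ⌊x⌋ ∈ Finset.Ico (-(K : ℤ)) K := by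
  rw [Finset.mem_Ico, Int.le_floor, Int.floor_lt]
  push_cast
  rfl

theorem avg_add (n : ℕ) {g h : ℝ → ℝ} (hg : Integrable g P) (hh : Integrable h P) (x : ℝ) :
    avg P n (g + h) x = avg P n g x + avg P n h x := by
  simp only [avg, Pi.add_apply]
  rw [integral_add hg.integrableOn hh.integrableOn, add_div]

theorem avg_smul (n : ℕ) (c : ℝ) (g : ℝ → ℝ) (x : ℝ) :
    avg P n (c • g) x = c * avg P n g x := by
  simp only [avg, Pi.smul_apply, smul_eq_mul]
  rw [integral_const_mul, mul_div_assoc]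

theorem avg_eq_of_floor {n : ℕ} {g h : ℝ → ℝ} {x : ℝ} (hgh : ∀ y, ⌊y⌋ = ⌊x⌋ → g y = h y) :
    avg P n g x = avg P n h x :=
  avg_congr P fun y hy ↦ hgh y (floor_congr' hy)

theorem indicator_avg (j : ℤ) (n : ℕ) (g : ℝ → ℝ) :
    (unitInterval j).indicator (avg P n g) = avg P n ((unitInterval j).indicator g) := by
  ext x
  by_cases hx : x ∈ unitInterval j
  · rw [Set.indicator_of_mem hx]
    refine avg_eq_of_floor fun y hy ↦ ?_
    rw [Set.indicator_of_mem]
    rwa [mem_unitInterval, hy, ← mem_unitInterval]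
  · rw [Set.indicator_of_notMem hx, ← avg_zero P n x]
    refine avg_eq_of_floor fun y hy ↦ ?_
    rw [Set.indicator_of_notMem]
    rwa [mem_unitInterval, hy, ← mem_unitInterval]

theorem martingale_avg {g : ℝ → ℝ} (hg : Integrable g P) :
    Martingale (fun n ↦ avg P n g) dyadicFiltration P := by
  refine ⟨fun n ↦ (measurable_avg P n g).stronglyMeasurable, fun i j hij ↦ ?_⟩
  exact (condExp_congr_ae (condExp_ae_eq_avg j hg).symm).trans
    ((condExp_condExp_of_le (dyadicFiltration.mono hij) (dyadicFiltration.le j)).trans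
      (condExp_ae_eq_avg i hg))

theorem isLocalMartingale_avg {g : ℝ → ℝ} (hg : Integrable g P) :
    IsLocalMartingale P fun n ↦ avg P n g := fun j ↦ by
  simp only [indicator_avg]
  exact martingale_avg (hg.indicator (measurableSet_unitInterval' j))

/-- Equality can fail on dyadic intervals of mass zero, where the average is 0 by convention. -/
theorem avg_ae_eq_self {N n : ℕ} (hn : N ≤ n) {g : ℝ → ℝ} (hg : Integrable g P)
    (hm : Measurable[dyadicFiltration N] g) : avg P n g =ᵐ[P] g := by
  have h := condExp_of_stronglyMeasurable (μ := P) (dyadicFiltration.le n)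
    (hm.mono (dyadicFiltration.mono hn) le_rfl).stronglyMeasurable hg
  have h' := condExp_ae_eq_avg (P := P) n hg
  rw [h] at h'
  exact h'.symm

/-- The dyadic martingale generated by `g`, normalized to start with `0`. -/
def testMart (P : Measure ℝ) (g : ℝ → ℝ) (n : ℕ) (x : ℝ) : ℝ := avg P n g x - avg P 0 g x

theorem testMart_add {g h : ℝ → ℝ} (hg : Integrable g P) (hh : Integrable h P) :
    testMart P (g + h) = testMart P g + testMart P h := by
  ext n x
  simp only [testMart, Pi.add_apply]
  rw [avg_add n hg hh, avg_add 0 hg hh]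
  ring

theorem testMart_smul (c : ℝ) (g : ℝ → ℝ) : testMart P (c • g) = c • testMart P g := by
  ext n x
  simp only [testMart, Pi.smul_apply, smul_eq_mul]
  rw [avg_smul, avg_smul]
  ring

theorem testMart_mem {g : ℝ → ℝ} (hg : Integrable g P) : testMart P g ∈ martingales P := by
  refine ⟨by ext x; simp [testMart], fun j ↦ ?_⟩
  have hi := hg.indicator (measurableSet_unitInterval' j)
  have h0 : Martingale (fun _ : ℕ ↦ avg P 0 ((unitInterval j).indicator g)) dyadicFiltration P :=
    martingale_const_fun _ _ (measurable_avg P 0 _).stronglyMeasurable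
      ((martingale_avg hi).integrable 0)
  convert (martingale_avg hi).sub h0 using 1
  ext n x
  rw [Pi.sub_apply, Pi.sub_apply, ← indicator_avg, ← indicator_avg]
  by_cases hx : x ∈ unitInterval j <;> simp [hx, testMart]

/-- Since [-K, K) is a union of unit intervals, averaging does not spread mass out of it. -/
theorem avg_eq_zero_of_support {g : ℝ → ℝ} {K : ℕ} (hK : ∀ x, g x ≠ 0 → -(K : ℝ) ≤ x ∧ x < K)
    (n : ℕ) (x : ℝ) (hx : avg P n g x ≠ 0) : -(K : ℝ) ≤ x ∧ x < K := by
  by_contra h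
  apply hx
  rw [← avg_zero P n x]
  refine avg_eq_of_floor fun y hy ↦ ?_
  by_contra hgy
  have := hK y hgy
  rw [mem_Ico_floor, hy, ← mem_Ico_floor] at this
  exact h this

theorem avg_mem_testFunctions {g : ℝ → ℝ} (hg : g ∈ testFunctions) (n : ℕ) :
    avg P n g ∈ testFunctions := by
  obtain ⟨_, _, K, hK⟩ := hg
  exact mem_testFunctions (measurable_avg P n g) K (avg_eq_zero_of_support hK n)

theorem maximal_testMart_le (g : ℝ → ℝ) (x : ℝ) :
    maximal (testMart P g) x ≤ 2 * maximal (fun n ↦ avg P n g) x := by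
  refine iSup_le fun n ↦ ?_
  rw [two_mul]
  exact (enorm_sub_le).trans (add_le_add (le_iSup (fun n ↦ ‖avg P n g x‖ₑ) n)
    (le_iSup (fun n ↦ ‖avg P n g x‖ₑ) 0))

theorem amalgamNorm_testMart_lt_top {p q : ℝ} (hp : 1 ≤ p) (hq : 1 ≤ q) {g : ℝ → ℝ}
    (hg : g ∈ testFunctions) : amalgamNorm P p q (maximal (testMart P g)) < ∞ := by
  obtain ⟨_, ⟨C, hC⟩, K, hK⟩ := hg
  refine amalgamNorm_lt_top_of_bdd (C := 2 * ENNReal.ofReal C) (by linarith) (by linarith)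
    (ENNReal.mul_ne_top (by simp) ENNReal.ofReal_ne_top) (fun x ↦ ?_) K fun x hx ↦ ?_
  · refine (maximal_testMart_le g x).trans ?_
    gcongr
    refine iSup_le fun n ↦ ?_
    rw [Real.enorm_eq_ofReal_abs]
    exact ENNReal.ofReal_le_ofReal (abs_avg_le n hC x)
  · have : ∃ n, testMart P g n x ≠ 0 := by
      by_contra! h
      exact hx (by simp [maximal, h])
    obtain ⟨n, hn⟩ := this
    by_cases h : avg P n g x = 0
    · refine avg_eq_zero_of_support (P := P) hK 0 x fun h' ↦ hn ?_
      rw [testMart, h, h', sub_zero]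
    · exact avg_eq_zero_of_support hK n x h

/-- By Doob, a bounded functional on H^* is also bounded for the plain L_{p,q} norm of step
functions, where Hölder duality is available. -/
theorem exists_amalgamNorm_testMart_le {p q : ℝ} (hp : 1 < p) (hq : 1 ≤ q) : ∃ C : ℝ≥0∞, C ≠ ∞ ∧
    ∀ (P : Measure ℝ) [IsProbabilityMeasure P], ∀ g ∈ testFunctions, ∀ N,
      Measurable[dyadicFiltration N] g →
        amalgamNorm P p q (maximal (testMart P g)) ≤ C * amalgamNorm P p q fun x ↦ ‖g x‖ₑ := by
  obtain ⟨C, hC, h⟩ := exists_maximal_le_of_forall hp hq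
  refine ⟨2 * C, ENNReal.mul_ne_top (by simp) hC, fun P _ g hg N hm ↦ ?_⟩
  have hi : Integrable g P := integrable_of_mem_testFunctions hg
  refine (amalgamNorm_mono hp.le hq (ae_of_all _ (maximal_testMart_le g))).trans ?_
  rw [amalgamNorm_const_mul hp.le hq (by simp), mul_assoc]
  gcongr
  refine h P _ (isLocalMartingale_avg hi) N _ fun n hn ↦ (amalgamNorm_congr ?_).le
  filter_upwards [avg_ae_eq_self hn hi hm] with x hx
  rw [hx]

variable {p q : ℝ} {hp : 1 ≤ p} {hq : 1 ≤ q}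

theorem HStar.norm_eq (f : HStar P p q hp hq) :
    ‖f‖ = (amalgamNorm P p q (maximal f.mart)).toReal := rfl

theorem HStar.mart_mem (f : HStar P p q hp hq) : f.mart ∈ martingales P := f.2.1

theorem HStar.lt_top (f : HStar P p q hp hq) : amalgamNorm P p q (maximal f.mart) < ∞ := f.2.2

/-- The linear map sending a test function to the martingale it generates. -/
def testMap (P : Measure ℝ) [IsProbabilityMeasure P] (p q : ℝ) (hp : 1 ≤ p) (hq : 1 ≤ q) :
    testFunctions →ₗ[ℝ] HStar P p q hp hq where
  toFun g := (⟨testMart P g.1, testMart_mem (integrable_of_mem_testFunctions g.2),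
    amalgamNorm_testMart_lt_top hp hq g.2⟩ : (starNorm P p q hp hq).space)
  map_add' g h := Subtype.ext (testMart_add (integrable_of_mem_testFunctions g.2)
    (integrable_of_mem_testFunctions h.2))
  map_smul' c g := Subtype.ext (testMart_smul c g.1)

theorem testMap_mart (g : testFunctions) : (testMap P p q hp hq g).mart = testMart P g.1 := rfl

theorem norm_testMap_eq_zero {g : testFunctions} (h : ∀ n, testMart P g.1 n =ᵐ[P] 0) :
    ‖testMap P p q hp hq g‖ = 0 := by
  rw [HStar.norm_eq, testMap_mart]
  have h1 : maximal (testMart P g.1) =ᵐ[P] fun _ ↦ 0 := by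
    filter_upwards [ae_all_iff.2 h] with x hx
    simp [maximal, hx]
  rw [amalgamNorm_congr h1]
  have hp0 : 0 < p := by linarith
  have hq0 : 0 < q := by linarith
  simp only [amalgamNorm, ENNReal.zero_rpow_of_pos hp0, lintegral_zero,
    ENNReal.zero_rpow_of_pos (div_pos hq0 hp0), tsum_zero,
    ENNReal.zero_rpow_of_pos (one_div_pos.2 hq0), ENNReal.toReal_zero]

/-- Together with `norm_testMap_of_measurable` this lists what a bounded functional cannot see: null
functions, which makes division by P(I) harmless, and ℱ_0-measurable functions, which makes the
representing martingale start at 0. -/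
theorem norm_testMap_of_ae_zero {g : testFunctions} (h : g.1 =ᵐ[P] 0) :
    ‖testMap P p q hp hq g‖ = 0 := by
  refine norm_testMap_eq_zero fun n ↦ ae_of_all _ fun x ↦ ?_
  have : ∀ n, avg P n g.1 x = 0 := fun n ↦ by
    rw [avg, integral_congr_ae (ae_restrict_of_ae h)]
    simp
  simp [testMart, this]

theorem norm_testMap_of_measurable {g : testFunctions} (h : Measurable[dyadicFiltration 0] g.1) :
    ‖testMap P p q hp hq g‖ = 0 := by
  have hi : Integrable g.1 P := integrable_of_mem_testFunctions g.2
  refine norm_testMap_eq_zero fun n ↦ ?_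
  filter_upwards [avg_ae_eq_self (Nat.zero_le n) hi h, avg_ae_eq_self le_rfl hi h] with x h1 h2
  rw [testMart, h1, h2, sub_self]
  rfl

/-! ### Almost everywhere limits -/

/-- P is finite and t ≤ 1 + t^p. -/
theorem lintegral_ne_top_of_amalgamNorm' {g : ℝ → ℝ≥0∞} (hp : 1 ≤ p) (hq : 1 ≤ q)
    (hg : amalgamNorm P p q g ≠ ∞) (j : ℤ) : ∫⁻ x in unitInterval j, g x ∂P ≠ ∞ := by
  have h1 := lintegral_ne_top_of_amalgamNorm (by linarith) (by linarith) hg j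
  have h2 : ∫⁻ x in unitInterval j, g x ∂P ≤ ∫⁻ x in unitInterval j, (1 + g x ^ p) ∂P := by
    refine lintegral_mono fun x ↦ ?_
    rcases le_total (g x) 1 with h | h
    · exact h.trans le_self_add
    · calc g x = g x ^ (1 : ℝ) := (ENNReal.rpow_one _).symm
        _ ≤ g x ^ p := ENNReal.rpow_le_rpow_of_exponent_le h hp
        _ ≤ _ := le_add_self
  refine ne_top_of_le_ne_top ?_ h2
  rw [lintegral_add_left measurable_const]
  refine ENNReal.add_ne_top.2 ⟨?_, h1⟩
  rw [setLIntegral_const]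
  exact ENNReal.mul_ne_top (by simp) (measure_ne_top _ _)

theorem stronglyMeasurable_limUnder_iSup {Ω : Type*} {m : ℕ → MeasurableSpace Ω} {f : ℕ → Ω → ℝ}
    (hf : ∀ n, Measurable[m n] (f n)) :
    StronglyMeasurable[⨆ n, m n] fun x ↦ limUnder atTop fun n ↦ f n x := by
  let _ : MeasurableSpace Ω := ⨆ n, m n
  exact StronglyMeasurable.limUnder fun n ↦ ((hf n).mono (le_iSup m n) le_rfl).stronglyMeasurable

/-- On each A_j the martingale is bounded in L_1 by the integral of f^*, so the convergence theorem
applies there; countably many null sets are united. -/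
theorem ae_tendsto_limit {f : ℕ → ℝ → ℝ} (hf : IsLocalMartingale P f) (hp : 1 ≤ p) (hq : 1 ≤ q)
    (hfin : amalgamNorm P p q (maximal f) ≠ ∞) :
    ∀ᵐ x ∂P, Tendsto (fun n ↦ f n x) atTop (𝓝 (limit P f x)) := by
  have h1 : ∀ᵐ x ∂P, ∀ j : ℤ, ∃ c, Tendsto (fun n ↦ (unitInterval j).indicator (f n) x) atTop
      (𝓝 c) := by
    rw [ae_all_iff]
    intro j
    have hR := lintegral_ne_top_of_amalgamNorm' hp hq hfin j
    refine (hf j).submartingale.exists_ae_tendsto_of_bdd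
      (R := (∫⁻ x in unitInterval j, maximal f x ∂P).toNNReal) fun n ↦ ?_
    rw [ENNReal.coe_toNNReal hR, eLpNorm_one_eq_lintegral_enorm,
      ← lintegral_indicator (measurableSet_unitInterval' j)]
    refine lintegral_mono fun x ↦ ?_
    by_cases hx : x ∈ unitInterval j
    · rw [Set.indicator_of_mem hx, Set.indicator_of_mem hx]
      exact le_iSup (fun n ↦ ‖f n x‖ₑ) n
    · simp [hx]
  -- `limitProcess` is chosen among the measurable almost everywhere limits and is a default value
  -- if there are none, so one candidate has to be exhibited.
  have h2 : ∃ g : ℝ → ℝ, StronglyMeasurable[⨆ n, dyadicFiltration n] g ∧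
      ∀ᵐ x ∂P, Tendsto (fun n ↦ f n x) atTop (𝓝 (g x)) := by
    refine ⟨fun x ↦ limUnder atTop fun n ↦ f n x, ?_, ?_⟩
    · exact stronglyMeasurable_limUnder_iSup fun n ↦ hf.adapted n
    · filter_upwards [h1] with x hx
      obtain ⟨c, hc⟩ := hx ⌊x⌋
      simp only [Set.indicator_of_mem (mem_unitInterval.2 (rfl : ⌊x⌋ = ⌊x⌋))] at hc
      rwa [hc.limUnder_eq]
  rw [limit, Filtration.limitProcess, dif_pos h2]
  exact (Classical.choose_spec h2).2

theorem measurable_limit (f : ℕ → ℝ → ℝ) : Measurable (limit P f) :=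
  Filtration.stronglyMeasurable_limit_process'.measurable

theorem enorm_limit_le {f : ℕ → ℝ → ℝ} {x : ℝ}
    (h : Tendsto (fun n ↦ f n x) atTop (𝓝 (limit P f x))) : ‖limit P f x‖ₑ ≤ maximal f x :=
  le_of_tendsto h.enorm (Eventually.of_forall fun n ↦ le_iSup (fun n ↦ ‖f n x‖ₑ) n)

end

section

variable {P : Measure ℝ} [IsProbabilityMeasure P] {p q p' q' : ℝ}

/-! ### The duality pairing -/

theorem limit_add_ae {f g : ℕ → ℝ → ℝ} (hf : f ∈ martingales P) (hg : g ∈ martingales P)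
    (hp : 1 ≤ p) (hq : 1 ≤ q) (hf' : amalgamNorm P p q (maximal f) ≠ ∞)
    (hg' : amalgamNorm P p q (maximal g) ≠ ∞) :
    ∀ᵐ x ∂P, limit P (f + g) x = limit P f x + limit P g x := by
  have hfg := (starNorm P p q hp hq).space.add_mem ⟨hf, hf'.lt_top⟩ ⟨hg, hg'.lt_top⟩
  filter_upwards [ae_tendsto_limit hf.2 hp hq hf', ae_tendsto_limit hg.2 hp hq hg',
    ae_tendsto_limit hfg.1.2 hp hq (ne_of_lt hfg.2)] with x h1 h2 h3
  exact tendsto_nhds_unique h3 (h1.add h2)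

theorem limit_smul_ae {f : ℕ → ℝ → ℝ} (hf : f ∈ martingales P) (c : ℝ) (hp : 1 ≤ p) (hq : 1 ≤ q)
    (hf' : amalgamNorm P p q (maximal f) ≠ ∞) :
    ∀ᵐ x ∂P, limit P (c • f) x = c * limit P f x := by
  have hcf := (starNorm P p q hp hq).space.smul_mem c ⟨hf, hf'.lt_top⟩
  filter_upwards [ae_tendsto_limit hf.2 hp hq hf',
    ae_tendsto_limit hcf.1.2 hp hq (ne_of_lt hcf.2)] with x h1 h3
  exact tendsto_nhds_unique h3 (h1.const_mul c)

theorem lintegral_limit_mul_le (hpp : p.HolderConjugate p') (hqq : q.HolderConjugate q')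
    {f φ : ℕ → ℝ → ℝ} (hf : IsLocalMartingale P f) (hφ : IsLocalMartingale P φ)
    (hf' : amalgamNorm P p q (maximal f) ≠ ∞) (hφ' : amalgamNorm P p' q' (maximal φ) ≠ ∞) :
    ∫⁻ x, ‖limit P f x * limit P φ x‖ₑ ∂P ≤
      amalgamNorm P p q (maximal f) * amalgamNorm P p' q' (maximal φ) := by
  refine le_trans (lintegral_mono_ae ?_) (lintegral_mul_le_amalgamNorm hpp hqq
    (measurable_maximal' hf.measurable) (measurable_maximal' hφ.measurable))
  filter_upwards [ae_tendsto_limit hf hpp.lt.le hqq.lt.le hf',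
    ae_tendsto_limit hφ hpp.symm.lt.le hqq.symm.lt.le hφ'] with x h1 h2
  rw [enorm_mul]
  exact mul_le_mul' (enorm_limit_le h1) (enorm_limit_le h2)

theorem integrable_limit_mul (hpp : p.HolderConjugate p') (hqq : q.HolderConjugate q')
    {f φ : ℕ → ℝ → ℝ} (hf : IsLocalMartingale P f) (hφ : IsLocalMartingale P φ)
    (hf' : amalgamNorm P p q (maximal f) ≠ ∞) (hφ' : amalgamNorm P p' q' (maximal φ) ≠ ∞) :
    Integrable (fun x ↦ limit P f x * limit P φ x) P :=
  ⟨((measurable_limit f).mul (measurable_limit φ)).aestronglyMeasurable,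
    (lintegral_limit_mul_le hpp hqq hf hφ hf' hφ').trans_lt
      (ENNReal.mul_lt_top hf'.lt_top hφ'.lt_top)⟩

theorem abs_integral_limit_mul_le (hpp : p.HolderConjugate p') (hqq : q.HolderConjugate q')
    {f φ : ℕ → ℝ → ℝ} (hf : IsLocalMartingale P f) (hφ : IsLocalMartingale P φ)
    (hf' : amalgamNorm P p q (maximal f) ≠ ∞) (hφ' : amalgamNorm P p' q' (maximal φ) ≠ ∞) :
    |∫ x, limit P f x * limit P φ x ∂P| ≤
      (amalgamNorm P p q (maximal f)).toReal * (amalgamNorm P p' q' (maximal φ)).toReal := by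
  rw [← ENNReal.toReal_mul, ← Real.norm_eq_abs]
  refine (norm_integral_le_lintegral_norm _).trans (ENNReal.toReal_mono
    (ENNReal.mul_ne_top hf' hφ') ?_)
  simp only [ofReal_norm]
  exact lintegral_limit_mul_le hpp hqq hf hφ hf' hφ'

theorem IsLocalMartingale.integral_mul_eq {φ : ℕ → ℝ → ℝ} (hφ : IsLocalMartingale P φ) (j : ℤ)
    {N n : ℕ} (hn : N ≤ n) {w : ℝ → ℝ} (hw : BddMeasurable (dyadicFiltration N) w) :
    ∫ x, w x * (unitInterval j).indicator (φ n) x ∂P =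
      ∫ x, w x * (unitInterval j).indicator (φ N) x ∂P := by
  induction n, hn using Nat.le_induction with
  | base => rfl
  | succ n hn ih =>
    rw [← ih]
    exact (hφ.isBddMartingale j).step n w (hw.mono (dyadicFiltration.mono hn))

theorem IsLocalMartingale.integrable_indicator_maximal {φ : ℕ → ℝ → ℝ} (hφ : IsLocalMartingale P φ)
    (hp : 1 ≤ p) (hq : 1 ≤ q) (hφ' : amalgamNorm P p q (maximal φ) ≠ ∞) (j : ℤ) :
    Integrable ((unitInterval j).indicator fun x ↦ (maximal φ x).toReal) P := by
  rw [integrable_indicator_iff (measurableSet_unitInterval' j)]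
  exact integrable_toReal_of_lintegral_ne_top
    (measurable_maximal' hφ.measurable).aemeasurable
    (lintegral_ne_top_of_amalgamNorm' hp hq hφ' j)

theorem IsLocalMartingale.ae_maximal_lt_top {φ : ℕ → ℝ → ℝ} (hφ : IsLocalMartingale P φ)
    (hp : 1 ≤ p) (hq : 1 ≤ q) (hφ' : amalgamNorm P p q (maximal φ) ≠ ∞) :
    ∀ᵐ x ∂P, maximal φ x < ∞ := by
  have : ∀ᵐ x ∂P, ∀ j : ℤ, x ∈ unitInterval j → maximal φ x < ∞ := by
    rw [ae_all_iff]
    intro j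
    rw [← ae_restrict_iff' (measurableSet_unitInterval' j)]
    exact ae_lt_top (measurable_maximal' hφ.measurable)
      (lintegral_ne_top_of_amalgamNorm' hp hq hφ' j)
  filter_upwards [this] with x hx using hx _ (mem_unitInterval.2 rfl)

/-- On A_j this says φ_N = E_N φ_∞. The integrals against w are constant for n ≥ N, and dominated
convergence with majorant a multiple of φ^* gives the limit. -/
theorem IsLocalMartingale.integral_mul_limit {φ : ℕ → ℝ → ℝ} (hφ : IsLocalMartingale P φ)
    (hp : 1 ≤ p) (hq : 1 ≤ q) (hφ' : amalgamNorm P p q (maximal φ) ≠ ∞) (j : ℤ) {N : ℕ} {w : ℝ → ℝ}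
    (hw : BddMeasurable (dyadicFiltration N) w) :
    Integrable (fun x ↦ w x * (unitInterval j).indicator (limit P φ) x) P ∧
      ∫ x, w x * (unitInterval j).indicator (limit P φ) x ∂P =
        ∫ x, w x * (unitInterval j).indicator (φ N) x ∂P := by
  obtain ⟨C, hC⟩ := hw.2
  have hC0 : 0 ≤ C := (abs_nonneg _).trans (hC 0)
  have hwm : Measurable w := hw.1.mono (dyadicFiltration.le N) le_rfl
  have hb := (hφ.integrable_indicator_maximal hp hq hφ' j).const_mul C
  have hlim := ae_tendsto_limit hφ hp hq hφ'
  have hfin := hφ.ae_maximal_lt_top hp hq hφ'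
  have bound : ∀ x, maximal φ x < ∞ → ∀ a : ℝ, ‖a‖ₑ ≤ maximal φ x → ∀ u : ℝ → ℝ, u x = a →
      ‖w x * (unitInterval j).indicator u x‖ ≤
        C * (unitInterval j).indicator (fun x ↦ (maximal φ x).toReal) x := by
    intro x hx a ha u hu
    rw [Real.norm_eq_abs, abs_mul]
    by_cases hxj : x ∈ unitInterval j
    · rw [Set.indicator_of_mem hxj, Set.indicator_of_mem hxj, hu]
      refine mul_le_mul (hC x) ?_ (abs_nonneg _) hC0
      rw [← Real.norm_eq_abs, ← toReal_enorm]
      exact ENNReal.toReal_mono hx.ne ha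
    · simp [hxj]
  have hmeas : ∀ u : ℝ → ℝ, Measurable u →
      AEStronglyMeasurable (fun x ↦ w x * (unitInterval j).indicator u x) P := fun u hu ↦
    (hwm.mul (hu.indicator (measurableSet_unitInterval' j))).aestronglyMeasurable
  refine ⟨hb.mono' (hmeas _ (measurable_limit φ)) ?_, ?_⟩
  · filter_upwards [hlim, hfin] with x h1 h2
    exact bound x h2 _ (enorm_limit_le h1) _ rfl
  · have ht := tendsto_integral_of_dominated_convergence (μ := P)
      (F := fun n x ↦ w x * (unitInterval j).indicator (φ n) x)
      (f := fun x ↦ w x * (unitInterval j).indicator (limit P φ) x) _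
      (fun n ↦ hmeas _ (hφ.measurable n)) hb (fun n ↦ ?_) ?_
    · refine tendsto_nhds_unique ht (tendsto_const_nhds.congr' ?_)
      filter_upwards [eventually_ge_atTop N] with n hn
      exact (hφ.integral_mul_eq j hn hw).symm
    · filter_upwards [hfin] with x h2
      exact bound x h2 _ (le_iSup (fun n ↦ ‖φ n x‖ₑ) n) _ rfl
    · filter_upwards [hlim] with x h1
      refine Tendsto.const_mul _ ?_
      by_cases hxj : x ∈ unitInterval j
      · simpa only [Set.indicator_of_mem hxj] using h1
      · simp [hxj]

theorem mul_eq_sum_indicator {g : ℝ → ℝ} {K : ℕ} (hK : ∀ x, g x ≠ 0 → -(K : ℝ) ≤ x ∧ x < K)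
    (u : ℝ → ℝ) (x : ℝ) :
    g x * u x = ∑ j ∈ Finset.Ico (-(K : ℤ)) K, g x * (unitInterval j).indicator u x := by
  by_cases hg : g x = 0
  · simp [hg]
  · have hx := mem_Ico_floor.1 (hK x hg)
    rw [Finset.sum_eq_single_of_mem _ hx, Set.indicator_of_mem (mem_unitInterval.2 rfl)]
    intro j _ hj
    rw [Set.indicator_of_notMem, mul_zero]
    rw [mem_unitInterval]
    exact hj.symm

theorem integral_mul_eq_sum {g : ℝ → ℝ} {K : ℕ} (hK : ∀ x, g x ≠ 0 → -(K : ℝ) ≤ x ∧ x < K)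
    {u : ℝ → ℝ} (hu : ∀ j : ℤ, Integrable (fun x ↦ g x * (unitInterval j).indicator u x) P) :
    Integrable (fun x ↦ g x * u x) P ∧ ∫ x, g x * u x ∂P =
      ∑ j ∈ Finset.Ico (-(K : ℤ)) K, ∫ x, g x * (unitInterval j).indicator u x ∂P := by
  simp only [mul_eq_sum_indicator hK u]
  exact ⟨integrable_finsetSum _ fun j _ ↦ hu j, integral_finsetSum _ fun j _ ↦ hu j⟩

theorem IsLocalMartingale.integrable_mul_indicator {φ : ℕ → ℝ → ℝ} (hφ : IsLocalMartingale P φ)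
    {N : ℕ} {g : ℝ → ℝ} (hg : BddMeasurable (dyadicFiltration N) g) (j : ℤ) :
    Integrable (fun x ↦ g x * (unitInterval j).indicator (φ N) x) P :=
  (hg.mul (bddMeasurable_indicator (hφ.adapted N) j)).int

theorem IsLocalMartingale.integral_test_mul_limit {φ : ℕ → ℝ → ℝ} (hφ : IsLocalMartingale P φ)
    (hp : 1 ≤ p) (hq : 1 ≤ q) (hφ' : amalgamNorm P p q (maximal φ) ≠ ∞) {N : ℕ} {g : ℝ → ℝ}
    (hg : g ∈ testFunctions) (hm : Measurable[dyadicFiltration N] g) :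
    Integrable (fun x ↦ g x * limit P φ x) P ∧
      ∫ x, g x * limit P φ x ∂P = ∫ x, g x * φ N x ∂P := by
  have hb := bddMeasurable_of_mem_testFunctions hg hm
  obtain ⟨_, _, K, hK⟩ := hg
  have h1 := fun j ↦ hφ.integral_mul_limit hp hq hφ' j hb
  have h2 := integral_mul_eq_sum hK fun j ↦ (h1 j).1
  refine ⟨h2.1, ?_⟩
  rw [h2.2, (integral_mul_eq_sum hK fun j ↦ hφ.integrable_mul_indicator hb j).2]
  exact Finset.sum_congr rfl fun j _ ↦ (h1 j).2

/-- Pairing with the martingale generated by a test function. -/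
theorem integral_limit_testMart_mul {φ : ℕ → ℝ → ℝ} (hφ : φ ∈ martingales P)
    (hp : 1 ≤ p) (hq : 1 ≤ q) (hφ' : amalgamNorm P p q (maximal φ) ≠ ∞) {N : ℕ} {g : ℝ → ℝ}
    (hg : g ∈ testFunctions) (hm : Measurable[dyadicFiltration N] g) :
    ∫ x, limit P (testMart P g) x * limit P φ x ∂P = ∫ x, g x * φ N x ∂P := by
  have hi : Integrable g P := integrable_of_mem_testFunctions hg
  have hφl : IsLocalMartingale P φ := hφ.2
  have h1 := hφl.integral_test_mul_limit hp hq hφ' hg hm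
  have h2 := hφl.integral_test_mul_limit hp hq hφ' (avg_mem_testFunctions (P := P) hg 0)
    (measurable_avg P 0 g)
  -- The generated martingale is eventually equal to g - E_0 g. The second term pairs with φ to the
  -- integral of E_0 g · φ_0, which is zero.
  have h3 : ∀ᵐ x ∂P, limit P (testMart P g) x * limit P φ x =
      g x * limit P φ x - avg P 0 g x * limit P φ x := by
    have h4 : ∀ᵐ x ∂P, ∀ n ≥ N, avg P n g x = g x := by
      rw [ae_all_iff]
      intro n
      by_cases hn : N ≤ n
      · filter_upwards [avg_ae_eq_self hn hi hm] with x hx _ using hx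
      · exact ae_of_all _ fun x h ↦ absurd h hn
    filter_upwards [h4, ae_tendsto_limit (testMart_mem hi).2 hp hq
      (amalgamNorm_testMart_lt_top hp hq hg).ne] with x hx hx'
    have : limit P (testMart P g) x = g x - avg P 0 g x := by
      refine tendsto_nhds_unique hx' (tendsto_const_nhds.congr' ?_)
      filter_upwards [eventually_ge_atTop N] with n hn
      rw [testMart, hx n hn]
    rw [this]
    ring
  rw [integral_congr_ae h3, integral_sub h1.1 h2.1, h1.2, h2.2, hφ.1]
  simp

end

section

variable {P : Measure ℝ} [IsProbabilityMeasure P] {p q p' q' : ℝ}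

/-! ### Norming functionals -/

theorem sign_mul_rpow_mul {r : ℝ} (hr : 1 ≤ r) (y : ℝ) :
    (if 0 ≤ y then (1 : ℝ) else -1) * |y| ^ (r - 1) * y = |y| ^ r := by
  have e : |y| ^ r = |y| ^ (r - 1) * |y| := by
    nth_rewrite 3 [← Real.rpow_one |y|]
    rw [← Real.rpow_add_of_nonneg (abs_nonneg _) (by linarith) zero_le_one, sub_add_cancel]
  rw [e]
  split_ifs with h
  · rw [abs_of_nonneg h]; ring
  · rw [abs_of_neg (not_le.1 h)]; ring

/-- The extremal for Hölder's inequality in both exponents: sgn(h)|h|^(p'-1) on A_j times a weight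
c_j for the outer sum. Keeping finitely many j makes g a test function, whether or not the norm of h
is finite. -/
theorem exists_norming_function (hpp : p.HolderConjugate p') (hqq : q.HolderConjugate q') {N : ℕ}
    {h : ℝ → ℝ} (hh : Measurable[dyadicFiltration N] h) (K : ℕ) :
    ∃ g ∈ testFunctions, Measurable[dyadicFiltration N] g ∧ ∃ S : ℝ, 0 ≤ S ∧
      ENNReal.ofReal S = ∑ j ∈ Finset.Ico (-(K : ℤ)) K,
        (∫⁻ x in unitInterval j, ‖h x‖ₑ ^ p' ∂P) ^ (q' / p') ∧
      ∫ x, g x * h x ∂P = S ∧ amalgamNorm P p q (fun x ↦ ‖g x‖ₑ) = ENNReal.ofReal S ^ (1 / q) := by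
  have hp0 := hpp.pos
  have hp0' := hpp.symm.pos
  have hq0 := hqq.pos
  have hq0' := hqq.symm.pos
  have hp1' := hpp.symm.lt.le
  have ep := hpp.symm.sub_one_mul_conj
  have eq := hqq.symm.sub_one_mul_conj
  set s := Finset.Ico (-(K : ℤ)) K with hs
  set a : ℤ → ℝ := fun j ↦ ∫ x, |(unitInterval j).indicator h x| ^ p' ∂P with ha
  have ha0 : ∀ j, 0 ≤ a j := fun j ↦ integral_nonneg fun x ↦ Real.rpow_nonneg (abs_nonneg _) _
  have haE : ∀ j, ENNReal.ofReal (a j) = ∫⁻ x in unitInterval j, ‖h x‖ₑ ^ p' ∂P := by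
    intro j
    rw [ha, ofReal_integral_rpow (j := j) (bddMeasurable_indicator hh j).abs
      (fun _ ↦ abs_nonneg _) (fun x hx ↦ by simp [hx]) hp0']
    refine setLIntegral_congr_fun (measurableSet_unitInterval' j) fun x hx ↦ ?_
    rw [Set.indicator_of_mem hx, Real.enorm_eq_ofReal_abs]
  -- With this exponent, c_j a_j (the pairing on A_j) and (c_j^p a_j)^(q/p) (the contribution to the
  -- norm of g) are both a_j^(q'/p').
  set c : ℤ → ℝ := fun j ↦ a j ^ ((q' - p') / p') with hc
  have hc0 : ∀ j, 0 ≤ c j := fun j ↦ Real.rpow_nonneg (ha0 j) _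
  have hca : ∀ j, c j * a j = a j ^ (q' / p') := by
    intro j
    rcases eq_or_lt_of_le (ha0 j) with h0 | h0
    · rw [← h0, mul_zero, Real.zero_rpow (by positivity)]
    · have e : c j * a j = a j ^ ((q' - p') / p') * a j ^ (1 : ℝ) := by rw [Real.rpow_one]
      rw [e, ← Real.rpow_add h0]
      congr 1
      field_simp
      ring
  have hcpa : ∀ j, (c j ^ p * a j) ^ (q / p) = a j ^ (q' / p') := by
    intro j
    rcases eq_or_lt_of_le (ha0 j) with h0 | h0
    · rw [← h0, mul_zero, Real.zero_rpow (by positivity), Real.zero_rpow (by positivity)]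
    · rw [hc, ← Real.rpow_mul h0.le]
      nth_rewrite 2 [← Real.rpow_one (a j)]
      rw [← Real.rpow_add h0, ← Real.rpow_mul h0.le]
      congr 1
      field_simp
      have : (q' - p') * p + p' = (q' - 1) * p := by nlinarith
      rw [this]
      nlinarith
  set g : ℝ → ℝ := fun x ↦ (if ⌊x⌋ ∈ s then c ⌊x⌋ else 0) *
    ((if 0 ≤ h x then 1 else -1) * |h x| ^ (p' - 1)) with hg
  have hgm : Measurable[dyadicFiltration N] g := by
    refine Measurable.mul ?_ (Measurable.mul (Measurable.ite (measurableSet_le measurable_const hh)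
      measurable_const measurable_const) ((continuous_abs.measurable.comp hh).pow_const _))
    have := measurable_comp_floor 0 fun k ↦ if k ∈ s then c k else 0
    simp only [pow_zero, mul_one] at this
    exact this.mono (dyadicFiltration.mono (Nat.zero_le N)) le_rfl
  have hgK : ∀ x, g x ≠ 0 → -(K : ℝ) ≤ x ∧ x < K := by
    intro x hx
    rw [mem_Ico_floor]
    by_contra hn
    exact hx (by rw [hg]; simp only [hs, hn, if_false, zero_mul])
  have hgt : g ∈ testFunctions := mem_testFunctions hgm K hgK
  have hgb := bddMeasurable_of_mem_testFunctions hgt hgm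
  refine ⟨g, hgt, hgm, ∑ j ∈ s, a j ^ (q' / p'),
    Finset.sum_nonneg fun j _ ↦ Real.rpow_nonneg (ha0 j) _, ?_, ?_, ?_⟩
  · rw [ENNReal.ofReal_sum_of_nonneg fun j _ ↦ Real.rpow_nonneg (ha0 j) _]
    refine Finset.sum_congr rfl fun j _ ↦ ?_
    rw [← haE, ENNReal.ofReal_rpow_of_nonneg (ha0 j) (by positivity)]
  · rw [(integral_mul_eq_sum hgK fun j ↦
      (hgb.mul (bddMeasurable_indicator hh j)).int).2]
    refine Finset.sum_congr rfl fun j hj ↦ ?_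
    rw [← hca, ha, ← integral_const_mul]
    congr 1
    ext x
    by_cases hx : x ∈ unitInterval j
    · rw [Set.indicator_of_mem hx, ← sign_mul_rpow_mul hp1', hg]
      simp only [mem_unitInterval.1 hx, hj, if_true]
      ring
    · rw [Set.indicator_of_notMem hx, abs_zero, Real.zero_rpow hp0'.ne']
      simp
  · have hin : ∀ j ∈ s, (∫⁻ x in unitInterval j, ‖g x‖ₑ ^ p ∂P) ^ (q / p) =
        ENNReal.ofReal (a j ^ (q' / p')) := by
      intro j hj
      have h1 : ∫⁻ x in unitInterval j, ‖g x‖ₑ ^ p ∂P =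
          ∫⁻ x in unitInterval j, ENNReal.ofReal (c j ^ p) * ‖h x‖ₑ ^ p' ∂P := by
        refine setLIntegral_congr_fun (measurableSet_unitInterval' j) fun x hx ↦ ?_
        have : |g x| ^ p = c j ^ p * |h x| ^ p' := by
          have e : |g x| = c j * |h x| ^ (p' - 1) := by
            rw [hg]
            simp only [mem_unitInterval.1 hx, hj, if_true]
            rw [abs_mul, abs_mul, abs_of_nonneg (hc0 j),
              abs_of_nonneg (Real.rpow_nonneg (abs_nonneg (h x)) _)]
            split_ifs <;> simp
          rw [e, Real.mul_rpow (hc0 j) (Real.rpow_nonneg (abs_nonneg _) _),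
            ← Real.rpow_mul (abs_nonneg _), ep]
        rw [Real.enorm_eq_ofReal_abs, Real.enorm_eq_ofReal_abs,
          ENNReal.ofReal_rpow_of_nonneg (abs_nonneg _) hp0.le,
          ENNReal.ofReal_rpow_of_nonneg (abs_nonneg _) hp0'.le,
          ← ENNReal.ofReal_mul (Real.rpow_nonneg (hc0 j) _), this]
      rw [h1, lintegral_const_mul' _ _ ENNReal.ofReal_ne_top, ← haE,
        ← ENNReal.ofReal_mul (Real.rpow_nonneg (hc0 j) _),
        ENNReal.ofReal_rpow_of_nonneg (mul_nonneg (Real.rpow_nonneg (hc0 j) _) (ha0 j))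
          (by positivity), hcpa]
    have hout : ∀ j ∉ s, (∫⁻ x in unitInterval j, ‖g x‖ₑ ^ p ∂P) ^ (q / p) = 0 := by
      intro j hj
      have h1 : ∫⁻ x in unitInterval j, ‖g x‖ₑ ^ p ∂P = ∫⁻ x in unitInterval j, 0 ∂P := by
        refine setLIntegral_congr_fun (measurableSet_unitInterval' j) fun x hx ↦ ?_
        rw [hg]
        simp only [mem_unitInterval.1 hx, hj, if_false, zero_mul, enorm_zero]
        exact ENNReal.zero_rpow_of_pos hp0
      rw [h1, lintegral_zero, ENNReal.zero_rpow_of_pos (by positivity)]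
    rw [amalgamNorm, tsum_eq_sum hout, Finset.sum_congr rfl hin,
      ENNReal.ofReal_sum_of_nonneg fun j _ ↦ Real.rpow_nonneg (ha0 j) _]

theorem exists_Ico_superset (t : Finset ℤ) : ∃ K : ℕ, t ⊆ Finset.Ico (-(K : ℤ)) K := by
  refine ⟨t.sup Int.natAbs + 1, fun j hj ↦ ?_⟩
  have : j.natAbs ≤ t.sup Int.natAbs := Finset.le_sup (f := Int.natAbs) hj
  rw [Finset.mem_Ico]
  omega

/-- The converse of Hölder's inequality for amalgam norms of dyadic step functions. -/
theorem amalgamNorm_le_of_test (hpp : p.HolderConjugate p') (hqq : q.HolderConjugate q') {N : ℕ}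
    {h : ℝ → ℝ} (hh : Measurable[dyadicFiltration N] h) {B : ℝ} (hB : 0 ≤ B)
    (H : ∀ g ∈ testFunctions, Measurable[dyadicFiltration N] g →
      ∫ x, g x * h x ∂P ≤ B * (amalgamNorm P p q fun x ↦ ‖g x‖ₑ).toReal) :
    amalgamNorm P p' q' (fun x ↦ ‖h x‖ₑ) ≤ ENNReal.ofReal B := by
  have hq0' := hqq.symm.pos
  rw [amalgamNorm, one_div, ENNReal.rpow_inv_le_iff hq0',
    ENNReal.tsum_eq_iSup_sum' _ exists_Ico_superset]
  refine iSup_le fun K ↦ ?_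
  obtain ⟨g, hgt, hgm, S, hS, hSeq, hint, hnorm⟩ := exists_norming_function (P := P) hpp hqq hh K
  have h1 := H g hgt hgm
  rw [hint, hnorm, ENNReal.ofReal_rpow_of_nonneg hS (one_div_pos.2 hqq.pos).le,
    ENNReal.toReal_ofReal (Real.rpow_nonneg hS _)] at h1
  rw [← hSeq, ENNReal.ofReal_rpow_of_nonneg hB hq0'.le]
  refine ENNReal.ofReal_le_ofReal ?_
  rcases eq_or_lt_of_le hS with h0 | h0
  · rw [← h0]
    exact Real.rpow_nonneg hB _
  -- Testing gives S ≤ B S^(1/q); the truncated sum S is finite and positive, so S^(1/q) may be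
  -- cancelled.
  · have e : S = S ^ (1 / q') * S ^ (1 / q) := by
      rw [← Real.rpow_add h0, one_div, one_div, add_comm, hqq.inv_add_inv_eq_one, Real.rpow_one]
    have h2 : S ^ (1 / q') ≤ B := by
      refine le_of_mul_le_mul_right ?_ (Real.rpow_pos_of_pos h0 (1 / q))
      rw [← e]
      exact h1
    have h3 := Real.rpow_le_rpow (Real.rpow_nonneg hS _) h2 hq0'.le
    rwa [← Real.rpow_mul hS, one_div_mul_cancel hq0'.ne', Real.rpow_one] at h3

/-! ### Representation of functionals on test functions -/

theorem indicator_dyadic_mem (N : ℕ) (k : ℤ) :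
    (dyadic N k).indicator (fun _ ↦ (1 : ℝ)) ∈ testFunctions := by
  refine mem_testFunctions (n := N) (measurable_const.indicator (measurableSet_dyadic N k))
    (k.natAbs + 1) fun x hx ↦ ?_
  have hx := Set.mem_of_indicator_ne_zero hx
  have h1 := mem_dyadic.1 hx
  rw [Int.floor_eq_iff] at h1
  obtain ⟨h1, h2⟩ := h1
  have h2N : (1 : ℝ) ≤ 2 ^ N := one_le_pow₀ one_le_two
  have h3 : |(k : ℝ)| = k.natAbs := by rw [Nat.cast_natAbs, Int.cast_abs]
  have h4 := neg_abs_le (k : ℝ)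
  have h5 := le_abs_self (k : ℝ)
  push_cast
  rw [h3] at h4 h5
  rw [Nat.cast_natAbs, Int.cast_abs, h3]
  constructor
  · by_contra! h
    nlinarith
  · by_contra! h
    nlinarith

/-- The indicator function of a dyadic interval, as a test function. -/
def dyadicTest (N : ℕ) (k : ℤ) : testFunctions := ⟨_, indicator_dyadic_mem N k⟩

theorem dyadicTest_apply (N : ℕ) (k : ℤ) (x : ℝ) :
    (dyadicTest N k).1 x = if ⌊x * 2 ^ N⌋ = k then 1 else 0 := by
  change (dyadic N k).indicator (fun _ ↦ (1 : ℝ)) x = _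
  by_cases hx : x ∈ dyadic N k
  · rw [Set.indicator_of_mem hx, if_pos (mem_dyadic.1 hx)]
  · rw [Set.indicator_of_notMem hx, if_neg fun h ↦ hx (mem_dyadic.2 h)]

/-- The process representing a functional on test functions. -/
def dualMart (P : Measure ℝ) (ℓ : testFunctions →ₗ[ℝ] ℝ) (N : ℕ) (x : ℝ) : ℝ :=
  ℓ (dyadicTest N ⌊x * 2 ^ N⌋) / P.real (dyadic N ⌊x * 2 ^ N⌋)

theorem measurable_dualMart (ℓ : testFunctions →ₗ[ℝ] ℝ) (N : ℕ) :
    Measurable[dyadicFiltration N] (dualMart P ℓ N) :=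
  measurable_comp_floor N fun k ↦ ℓ (dyadicTest N k) / P.real (dyadic N k)

theorem floor_mem_of_support {N K : ℕ} {x : ℝ} (h : -(K : ℝ) ≤ x ∧ x < K) :
    ⌊x * 2 ^ N⌋ ∈ Finset.Ico (-(K : ℤ) * 2 ^ N) (K * 2 ^ N) := by
  rw [Finset.mem_Ico, Int.le_floor, Int.floor_lt]
  push_cast
  obtain ⟨h1, h2⟩ := h
  exact ⟨by gcongr, by gcongr⟩

theorem eq_apply_floor {N : ℕ} {g : ℝ → ℝ} (hg : Measurable[dyadicFiltration N] g) (x : ℝ) :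
    g x = g ((⌊x * 2 ^ N⌋ : ℝ) / 2 ^ N) := by
  refine eq_of_floor_eq hg ?_
  rw [div_mul_cancel₀ _ (by positivity), Int.floor_intCast]

/-- A test function of level N is a finite combination of indicators of dyadic intervals I, and for
these the identity reads ℓ(1_I) = (ℓ(1_I)/P(I)) · P(I). -/
theorem apply_eq_integral_dualMart {ℓ : testFunctions →ₗ[ℝ] ℝ}
    (h0 : ∀ g : testFunctions, g.1 =ᵐ[P] 0 → ℓ g = 0) (N : ℕ) (g : testFunctions)
    (hg : Measurable[dyadicFiltration N] g.1) : ℓ g = ∫ x, g.1 x * dualMart P ℓ N x ∂P := by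
  obtain ⟨_, _, K, hK⟩ := g.2
  set s := Finset.Ico (-(K : ℤ) * 2 ^ N) (K * 2 ^ N) with hs
  have hmem : ∀ x, g.1 x ≠ 0 → ⌊x * 2 ^ N⌋ ∈ s := fun x hx ↦ floor_mem_of_support (hK x hx)
  have hsum : ∀ (u : ℤ → ℝ) (x : ℝ),
      ∑ k ∈ s, g.1 ((k : ℝ) / 2 ^ N) * u k * (if ⌊x * 2 ^ N⌋ = k then 1 else 0) =
        g.1 x * u ⌊x * 2 ^ N⌋ := by
    intro u x
    simp only [mul_ite, mul_one, mul_zero]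
    rw [Finset.sum_ite_eq, ← eq_apply_floor hg]
    split_ifs with hx
    · rfl
    · have : g.1 x = 0 := by
        by_contra h
        exact hx (hmem x h)
      rw [this, zero_mul]
  have hgsum : g = ∑ k ∈ s, g.1 ((k : ℝ) / 2 ^ N) • dyadicTest N k := by
    refine Subtype.ext (funext fun x ↦ ?_)
    have h := hsum (fun _ ↦ 1) x
    simp only [mul_one] at h
    rw [← h, Submodule.coe_sum, Finset.sum_apply]
    refine Finset.sum_congr rfl fun k _ ↦ ?_
    rw [Submodule.coe_smul, Pi.smul_apply, dyadicTest_apply, smul_eq_mul]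
  have hint : ∀ x, g.1 x * dualMart P ℓ N x = ∑ k ∈ s, g.1 ((k : ℝ) / 2 ^ N) *
      (ℓ (dyadicTest N k) / P.real (dyadic N k)) * (dyadicTest N k).1 x := by
    intro x
    simp only [dyadicTest_apply]
    rw [hsum fun k ↦ ℓ (dyadicTest N k) / P.real (dyadic N k)]
    rfl
  have hi : ∀ k, ∫ x, (dyadicTest N k).1 x ∂P = P.real (dyadic N k) := fun k ↦ by
    rw [dyadicTest]
    exact integral_indicator_one measurableSet_Ico
  nth_rewrite 1 [hgsum]
  simp only [hint]
  rw [integral_finsetSum _ fun k _ ↦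
    (integrable_of_mem_testFunctions (dyadicTest N k).2).const_mul _, map_sum]
  refine Finset.sum_congr rfl fun k _ ↦ ?_
  rw [integral_const_mul, hi, map_smul, smul_eq_mul, mul_assoc]
  congr 1
  -- On a null interval the quotient is 0 by convention, in agreement with ℓ(1_I) = 0.
  by_cases hk : P.real (dyadic N k) = 0
  · rw [hk, mul_zero]
    refine h0 _ ?_
    have hk' : P (dyadic N k) = 0 := by rwa [measureReal_eq_zero_iff] at hk
    filter_upwards [measure_eq_zero_iff_ae_notMem.1 hk'] with x hx
    change (dyadic N k).indicator (fun _ ↦ (1 : ℝ)) x = 0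
    rw [Set.indicator_of_notMem hx]
  · rw [div_mul_cancel₀ _ hk]

/-- For s in ℱ_m, the indicator of s ∩ A_j is a test function of every level n ≥ m. The integrals
over s of the process at times m and n, restricted to A_j, are therefore the same number ℓ(1_{s ∩
A_j}). -/
theorem dualMart_mem {ℓ : testFunctions →ₗ[ℝ] ℝ}
    (h0 : ∀ g : testFunctions, g.1 =ᵐ[P] 0 → ℓ g = 0)
    (h1 : ∀ g : testFunctions, Measurable[dyadicFiltration 0] g.1 → ℓ g = 0) :
    dualMart P ℓ ∈ martingales P := by
  have hm := measurable_dualMart (P := P) ℓ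
  refine ⟨?_, fun j ↦ ⟨fun n ↦ ?_, fun m n hmn ↦ ?_⟩⟩
  · ext x
    rw [dualMart, h1 _ (measurable_const.indicator (measurableSet_dyadic 0 _)), zero_div]
    rfl
  · exact ((hm n).indicator (measurableSet_unitInterval n j)).stronglyMeasurable
  · have hi : ∀ n, Integrable ((unitInterval j).indicator (dualMart P ℓ n)) P := fun n ↦
      (bddMeasurable_indicator (hm n) j).int
    refine (ae_eq_condExp_of_forall_setIntegral_eq (dyadicFiltration.le m) (hi n)
      (fun s _ _ ↦ (hi m).integrableOn) (fun s hs _ ↦ ?_)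
      ((hm m).indicator (measurableSet_unitInterval m j)).aestronglyMeasurable).symm
    have hsj := hs.inter (measurableSet_unitInterval m j)
    have hg : Measurable[dyadicFiltration m]
        ((s ∩ unitInterval j).indicator fun _ ↦ (1 : ℝ)) := measurable_const.indicator hsj
    have hgt : (s ∩ unitInterval j).indicator (fun _ ↦ (1 : ℝ)) ∈ testFunctions := by
      refine mem_testFunctions hg (j.natAbs + 1) fun x hx ↦ ?_
      have hx := (Set.mem_of_indicator_ne_zero hx).2
      rw [mem_Ico_floor, mem_unitInterval.1 hx, Finset.mem_Ico]
      omega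
    have key : ∀ n, m ≤ n → ∫ x in s, (unitInterval j).indicator (dualMart P ℓ n) x ∂P =
        ℓ ⟨_, hgt⟩ := by
      intro n hn
      rw [apply_eq_integral_dualMart h0 n ⟨_, hgt⟩ (hg.mono (dyadicFiltration.mono hn) le_rfl),
        ← integral_indicator (dyadicFiltration.le m s hs), Set.indicator_indicator]
      congr 1
      ext x
      by_cases hx : x ∈ s ∩ unitInterval j <;> simp [hx]
    rw [key m le_rfl, key n hmn]

end

section

variable {P : Measure ℝ} [IsProbabilityMeasure P] {p q p' q' : ℝ}

/-! ### Density of the martingales generated by test functions -/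

/-- The restriction of `f_N` to `[-N, N)`. -/
def trunc (f : ℕ → ℝ → ℝ) (N : ℕ) (x : ℝ) : ℝ :=
  if ⌊x⌋ ∈ Finset.Ico (-(N : ℤ)) N then f N x else 0

theorem measurable_trunc {f : ℕ → ℝ → ℝ} (hf : IsLocalMartingale P f) (N : ℕ) :
    Measurable[dyadicFiltration N] (trunc f N) := by
  refine Measurable.ite ?_ (hf.adapted N) measurable_const
  have : {x : ℝ | ⌊x⌋ ∈ Finset.Ico (-(N : ℤ)) N} =
      ⋃ j ∈ Finset.Ico (-(N : ℤ)) N, unitInterval j := by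
    ext x
    simp [mem_unitInterval]
  rw [this]
  exact Finset.measurableSet_biUnion _ fun j _ ↦ measurableSet_unitInterval N j

theorem trunc_mem {f : ℕ → ℝ → ℝ} (hf : IsLocalMartingale P f) (N : ℕ) :
    trunc f N ∈ testFunctions := by
  refine mem_testFunctions (measurable_trunc hf N) N fun x hx ↦ ?_
  rw [mem_Ico_floor]
  by_contra h
  exact hx (if_neg h)

/-- The truncation generates f stopped at time N, restricted to [-N, N). -/
theorem testMart_trunc_ae {f : ℕ → ℝ → ℝ} (hf : f ∈ martingales P) :
    ∀ᵐ x ∂P, ∀ N n, testMart P (trunc f N) n x =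
      if ⌊x⌋ ∈ Finset.Ico (-(N : ℤ)) N then f (min n N) x else 0 := by
  have hfl : IsLocalMartingale P f := hf.2
  have h1 : ∀ᵐ x ∂P, ∀ (j : ℤ) (N n : ℕ), avg P n ((unitInterval j).indicator (f N)) x =
      (unitInterval j).indicator (f (min n N)) x := by
    simp only [ae_all_iff]
    intro j N n
    have hb := bddMeasurable_indicator (hfl.adapted N) j
    rcases le_total n N with h | h
    · rw [min_eq_left h]
      exact (condExp_ae_eq_avg n hb.int).symm.trans ((hf.2 j).2 n N h)
    · rw [min_eq_right h]
      exact avg_ae_eq_self h hb.int hb.1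
  filter_upwards [h1] with x hx N n
  have h2 : ∀ m, avg P m (trunc f N) x =
      if ⌊x⌋ ∈ Finset.Ico (-(N : ℤ)) N then f (min m N) x else 0 := by
    intro m
    split_ifs with h
    · have h3 := hx ⌊x⌋ N m
      rw [Set.indicator_of_mem (mem_unitInterval.2 rfl)] at h3
      rw [← h3]
      refine avg_eq_of_floor fun y hy ↦ ?_
      rw [Set.indicator_of_mem (mem_unitInterval.2 hy), trunc, hy, if_pos h]
    · rw [← avg_zero P m x]
      refine avg_eq_of_floor fun y hy ↦ ?_
      rw [trunc, hy, if_neg h]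
  rw [testMart, h2, h2, Nat.zero_min, hf.1]
  simp

/-- For large N the difference at x vanishes up to time N and is f_n - f_N afterwards, uniformly
small because the sequence at x is almost surely Cauchy. The majorant is 2 f^*. -/
theorem tendsto_sub_testMart_trunc {f : ℕ → ℝ → ℝ} (hf : f ∈ martingales P) (hp : 1 ≤ p)
    (hq : 1 ≤ q) (hfin : amalgamNorm P p q (maximal f) ≠ ∞) :
    Tendsto (fun N ↦ amalgamNorm P p q (maximal (f - testMart P (trunc f N)))) atTop (𝓝 0) := by
  have hfl : IsLocalMartingale P f := hf.2
  have hae := testMart_trunc_ae hf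
  refine tendsto_amalgamNorm_zero (by linarith) (by linarith)
    (H := fun x ↦ 2 * maximal f x) (fun N ↦ ?_) ?_ (fun N ↦ ?_) ?_
  · exact measurable_maximal (sub_mem hf
      (testMart_mem (integrable_of_mem_testFunctions (trunc_mem hfl N))))
  · rw [amalgamNorm_const_mul hp hq (by simp)]
    exact ENNReal.mul_ne_top (by simp) hfin
  · filter_upwards [hae] with x hx
    refine iSup_le fun n ↦ ?_
    rw [Pi.sub_apply, Pi.sub_apply, hx, two_mul]
    refine enorm_sub_le.trans (add_le_add (le_iSup (fun n ↦ ‖f n x‖ₑ) n) ?_)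
    split_ifs
    · exact le_iSup (fun n ↦ ‖f n x‖ₑ) (min n N)
    · simp
  · filter_upwards [hae, ae_tendsto_limit hfl hp hq hfin] with x hx hlim
    rw [ENNReal.tendsto_atTop_zero]
    intro ε hε
    obtain ⟨M, hM⟩ := EMetric.cauchySeq_iff.1 hlim.cauchySeq ε hε
    refine ⟨max M (⌊x⌋.natAbs + 1), fun N hN ↦ iSup_le fun n ↦ ?_⟩
    have hN1 : M ≤ N := (le_max_left _ _).trans hN
    have hN2 : ⌊x⌋.natAbs + 1 ≤ N := (le_max_right _ _).trans hN
    have hmem : ⌊x⌋ ∈ Finset.Ico (-(N : ℤ)) N := by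
      rw [Finset.mem_Ico]
      omega
    rw [Pi.sub_apply, Pi.sub_apply, hx, if_pos hmem]
    rcases le_total n N with h | h
    · simp [min_eq_left h]
    · rw [min_eq_right h, ← edist_eq_enorm_sub]
      exact (hM n (hN1.trans h) N hN1).le

/-! ### The dual space -/

/-- Doob for the test martingales bounds the integral of g φ_N by C₁ B times the norm of g, the
converse of Hölder bounds φ_N, and Doob at the dual exponents bounds φ^*. It serves both the lower
bound, with L the pairing with φ, and surjectivity, with φ built from L. -/
theorem exists_dual_norm_le (hpp : p.HolderConjugate p') (hqq : q.HolderConjugate q') :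
    ∃ C : ℝ≥0∞, C ≠ ∞ ∧ ∀ (P : Measure ℝ) [IsProbabilityMeasure P], ∀ φ ∈ martingales P,
      ∀ (L : HStar P p q hpp.lt.le hqq.lt.le → ℝ) (B : ℝ), 0 ≤ B → (∀ f, |L f| ≤ B * ‖f‖) →
      (∀ (N : ℕ) (g : testFunctions), Measurable[dyadicFiltration N] g.1 →
        L (testMap P p q hpp.lt.le hqq.lt.le g) = ∫ x, g.1 x * φ N x ∂P) →
      amalgamNorm P p' q' (maximal φ) ≤ C * ENNReal.ofReal B := by
  obtain ⟨C₁, hC₁, h₁⟩ := exists_amalgamNorm_testMart_le hpp.lt hqq.lt.le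
  obtain ⟨C₂, hC₂, h₂⟩ := exists_maximal_le_of_forall hpp.symm.lt hqq.symm.lt.le
  refine ⟨C₂ * C₁, ENNReal.mul_ne_top hC₂ hC₁, fun P _ φ hφ L B hB hL hLφ ↦ ?_⟩
  rw [mul_assoc]
  refine h₂ P φ hφ.2 0 _ fun N _ ↦ ?_
  have h3 : amalgamNorm P p' q' (fun x ↦ ‖φ N x‖ₑ) ≤ ENNReal.ofReal (B * C₁.toReal) := by
    refine amalgamNorm_le_of_test hpp hqq (IsLocalMartingale.adapted hφ.2 N) (by positivity)
      fun g hg hm ↦ ?_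
    rw [← hLφ N ⟨g, hg⟩ hm]
    refine (le_abs_self _).trans ((hL _).trans ?_)
    rw [mul_assoc, ← ENNReal.toReal_mul]
    refine mul_le_mul_of_nonneg_left (ENNReal.toReal_mono (ENNReal.mul_ne_top hC₁ ?_)
      (h₁ P g hg N hm)) hB
    obtain ⟨_, ⟨C, hC⟩, K, hK⟩ := hg
    refine (amalgamNorm_lt_top_of_bdd (C := ENNReal.ofReal C) hpp.pos hqq.pos
      ENNReal.ofReal_ne_top (fun x ↦ ?_) K fun x hx ↦ hK x fun h ↦ hx (by simp [h])).ne
    rw [Real.enorm_eq_ofReal_abs]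
    exact ENNReal.ofReal_le_ofReal (hC x)
  rwa [ENNReal.ofReal_mul hB, ENNReal.ofReal_toReal hC₁, mul_comm] at h3

/-- A nondegenerate pairing of seminormed spaces that represents all functionals identifies one
of the separation quotients with the dual space of the other. -/
theorem exists_equiv_of_pairing {E F : Type*} [SeminormedAddCommGroup E] [NormedSpace ℝ E]
    [SeminormedAddCommGroup F] [NormedSpace ℝ F] (B : E →ₗ[ℝ] F →ₗ[ℝ] ℝ) {c C : ℝ} (hc : 0 < c)
    (hC : 0 ≤ C) (hB : ∀ x y, ‖B x y‖ ≤ C * ‖x‖ * ‖y‖)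
    (hlow : ∀ x (M : ℝ), 0 ≤ M → (∀ y, ‖B x y‖ ≤ M * ‖y‖) → c * ‖x‖ ≤ M)
    (hsurj : ∀ L : F →L[ℝ] ℝ, ∃ x, ∀ y, B x y = L y) :
    ∃ κ : SeparationQuotient E ≃L[ℝ] StrongDual ℝ (SeparationQuotient F),
      (∀ x y, κ (SeparationQuotient.mk x) (SeparationQuotient.mk y) = B x y) ∧
        ∀ x, c * ‖x‖ ≤ ‖κ x‖ ∧ ‖κ x‖ ≤ C * ‖x‖ := by
  let κ₀ : E →L[ℝ] F →L[ℝ] ℝ := B.mkContinuous₂ C hB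
  let κ₁ : E →ₗ[ℝ] StrongDual ℝ (SeparationQuotient F) :=
    { toFun := fun x ↦ SeparationQuotient.liftCLM (κ₀ x)
        fun _ _ h ↦ (h.map (κ₀ x).continuous).eq
      map_add' := fun x x' ↦ by
        ext z
        obtain ⟨y, rfl⟩ := SeparationQuotient.surjective_mk z
        simp
      map_smul' := fun a x ↦ by
        ext z
        obtain ⟨y, rfl⟩ := SeparationQuotient.surjective_mk z
        simp }
  have e₁ : ∀ x y, κ₁ x (SeparationQuotient.mk y) = B x y := fun x y ↦ rfl
  have b₁ : ∀ x, ‖κ₁ x‖ ≤ C * ‖x‖ := fun x ↦ by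
    refine ContinuousLinearMap.opNorm_le_bound _ (by positivity) fun z ↦ ?_
    obtain ⟨y, rfl⟩ := SeparationQuotient.surjective_mk z
    rw [e₁, SeparationQuotient.norm_mk]
    exact hB x y
  let κ₁' : E →L[ℝ] StrongDual ℝ (SeparationQuotient F) := κ₁.mkContinuous C b₁
  let κ₂ : SeparationQuotient E →L[ℝ] StrongDual ℝ (SeparationQuotient F) :=
    SeparationQuotient.liftCLM κ₁' fun _ _ h ↦ (h.map κ₁'.continuous).eq
  have e₂ : ∀ x, κ₂ (SeparationQuotient.mk x) = κ₁ x := fun x ↦ rfl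
  have up : ∀ z, ‖κ₂ z‖ ≤ C * ‖z‖ := fun z ↦ by
    obtain ⟨x, rfl⟩ := SeparationQuotient.surjective_mk z
    rw [e₂, SeparationQuotient.norm_mk]
    exact b₁ x
  have low : ∀ z, c * ‖z‖ ≤ ‖κ₂ z‖ := fun z ↦ by
    obtain ⟨x, rfl⟩ := SeparationQuotient.surjective_mk z
    rw [e₂, SeparationQuotient.norm_mk]
    refine hlow x _ (norm_nonneg _) fun y ↦ ?_
    rw [← e₁, ← SeparationQuotient.norm_mk y]
    exact ContinuousLinearMap.le_opNorm _ _
  have inj : Function.Injective κ₂ := by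
    refine (injective_iff_map_eq_zero κ₂).2 fun z hz ↦ ?_
    have h := low z
    rw [hz, norm_zero] at h
    have : ‖z‖ ≤ 0 := by
      by_contra! h'
      nlinarith
    exact norm_le_zero_iff.1 this
  have surj : Function.Surjective κ₂ := fun L ↦ by
    obtain ⟨x, hx⟩ := hsurj (L.comp (SeparationQuotient.mkCLM ℝ F))
    refine ⟨SeparationQuotient.mk x, ?_⟩
    ext z
    obtain ⟨y, rfl⟩ := SeparationQuotient.surjective_mk z
    rw [e₂, e₁, hx]
    rfl
  -- The lower bound makes the inverse continuous, so completeness is not needed.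
  let e := LinearEquiv.ofBijective κ₂.toLinearMap ⟨inj, surj⟩
  have he : ∀ z, e z = κ₂ z := fun z ↦ rfl
  refine ⟨e.toContinuousLinearEquivOfBounds C (1 / c) (fun z ↦ up z) fun L ↦ ?_, fun x y ↦ rfl,
    fun z ↦ ⟨low z, up z⟩⟩
  have h := low (e.symm L)
  rw [← he, e.apply_symm_apply] at h
  rw [one_div, inv_mul_eq_div, le_div_iff₀ hc, mul_comm]
  exact h

/-! ### The pairing of the two martingale spaces and its bounds. -/

theorem HsBD.mart_mem {hp : 1 ≤ p} {hq : 1 ≤ q} (φ : HsBD P p q hp hq) :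
    φ.mart ∈ martingales P := φ.2.1.1

theorem HsBD.add_lt_top {hp : 1 ≤ p} {hq : 1 ≤ q} (φ : HsBD P p q hp hq) :
    amalgamNorm P p q (condSquare P φ.mart) + amalgamNorm P p q (maxJump φ.mart) < ∞ :=
  ENNReal.add_lt_top.2 ⟨φ.2.1.2, φ.2.2.2⟩

theorem HsBD.norm_eq' {hp : 1 ≤ p} {hq : 1 ≤ q} (φ : HsBD P p q hp hq) :
    ‖φ‖ = (amalgamNorm P p q (condSquare P φ.mart) +
      amalgamNorm P p q (maxJump φ.mart)).toReal :=
  (ENNReal.toReal_add φ.2.1.2.ne φ.2.2.2.ne).symm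

theorem HsBD.maximal_ne_top (hp2 : 2 ≤ p) {hp : 1 ≤ p} {hq : 1 ≤ q} (φ : HsBD P p q hp hq) :
    amalgamNorm P p q (maximal φ.mart) ≠ ∞ := by
  obtain ⟨C, hC, h⟩ := exists_maximal_le hp2 hq
  exact ne_top_of_le_ne_top (ENNReal.mul_ne_top hC φ.add_lt_top.ne) (h P _ φ.mart_mem)

/-- The pairing `(φ, f) ↦ E(f_∞ φ_∞)`. -/
def pairing (P : Measure ℝ) [IsProbabilityMeasure P] (hpp : p.HolderConjugate p')
    (hqq : q.HolderConjugate q') (hp2 : 2 ≤ p') :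
    HsBD P p' q' hpp.symm.lt.le hqq.symm.lt.le →ₗ[ℝ] HStar P p q hpp.lt.le hqq.lt.le →ₗ[ℝ] ℝ :=
  have hi : ∀ (φ : HsBD P p' q' hpp.symm.lt.le hqq.symm.lt.le)
      (f : HStar P p q hpp.lt.le hqq.lt.le),
      Integrable (fun x ↦ limit P f.mart x * limit P φ.mart x) P := fun φ f ↦
    integrable_limit_mul hpp hqq f.mart_mem.2 φ.mart_mem.2 f.lt_top.ne (φ.maximal_ne_top hp2)
  LinearMap.mk₂ ℝ (fun φ f ↦ ∫ x, limit P f.mart x * limit P φ.mart x ∂P)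
    (fun φ ψ f ↦ by
      rw [← integral_add (hi φ f) (hi ψ f)]
      refine integral_congr_ae ?_
      filter_upwards [limit_add_ae φ.mart_mem ψ.mart_mem hpp.symm.lt.le hqq.symm.lt.le
        (φ.maximal_ne_top hp2) (ψ.maximal_ne_top hp2)] with x hx
      rw [← mul_add, ← hx]
      rfl)
    (fun a φ f ↦ by
      rw [smul_eq_mul, ← integral_const_mul]
      refine integral_congr_ae ?_
      filter_upwards [limit_smul_ae φ.mart_mem a hpp.symm.lt.le hqq.symm.lt.le
        (φ.maximal_ne_top hp2)] with x hx
      rw [mul_left_comm, ← hx]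
      rfl)
    (fun φ f g ↦ by
      rw [← integral_add (hi φ f) (hi φ g)]
      refine integral_congr_ae ?_
      filter_upwards [limit_add_ae f.mart_mem g.mart_mem hpp.lt.le hqq.lt.le
        f.lt_top.ne g.lt_top.ne] with x hx
      rw [← add_mul, ← hx]
      rfl)
    (fun a φ f ↦ by
      rw [smul_eq_mul, ← integral_const_mul]
      refine integral_congr_ae ?_
      filter_upwards [limit_smul_ae f.mart_mem a hpp.lt.le hqq.lt.le f.lt_top.ne] with x hx
      rw [← mul_assoc, ← hx]
      rfl)

theorem pairing_apply (hpp : p.HolderConjugate p') (hqq : q.HolderConjugate q') (hp2 : 2 ≤ p')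
    (φ : HsBD P p' q' hpp.symm.lt.le hqq.symm.lt.le) (f : HStar P p q hpp.lt.le hqq.lt.le) :
    pairing P hpp hqq hp2 φ f = ∫ x, limit P f.mart x * limit P φ.mart x ∂P := rfl

theorem pairing_testMap (hpp : p.HolderConjugate p') (hqq : q.HolderConjugate q') (hp2 : 2 ≤ p')
    (φ : HsBD P p' q' hpp.symm.lt.le hqq.symm.lt.le) (N : ℕ) (g : testFunctions)
    (hg : Measurable[dyadicFiltration N] g.1) :
    pairing P hpp hqq hp2 φ (testMap P p q hpp.lt.le hqq.lt.le g) = ∫ x, g.1 x * φ.mart N x ∂P := by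
  rw [pairing_apply, testMap_mart]
  exact integral_limit_testMart_mul φ.mart_mem hpp.symm.lt.le hqq.symm.lt.le
    (φ.maximal_ne_top hp2) g.2 hg

theorem tendsto_testMap_trunc {hp : 1 ≤ p} {hq : 1 ≤ q} (f : HStar P p q hp hq) :
    Tendsto (fun N ↦ testMap P p q hp hq ⟨trunc f.mart N, trunc_mem f.mart_mem.2 N⟩) atTop
      (𝓝 f) := by
  rw [tendsto_iff_norm_sub_tendsto_zero]
  have h := (ENNReal.tendsto_toReal ENNReal.zero_ne_top).comp
    (tendsto_sub_testMart_trunc f.mart_mem hp hq f.lt_top.ne)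
  refine h.congr fun N ↦ ?_
  rw [norm_sub_rev]
  rfl

theorem exists_pairing_bounds (hpp : p.HolderConjugate p') (hqq : q.HolderConjugate q')
    (hp2 : 2 ≤ p') : ∃ c C : ℝ, 0 < c ∧ 0 < C ∧ ∀ (P : Measure ℝ) [IsProbabilityMeasure P],
      (∀ φ f, ‖pairing P hpp hqq hp2 φ f‖ ≤ C * ‖φ‖ * ‖f‖) ∧
      (∀ φ (M : ℝ), 0 ≤ M → (∀ f, ‖pairing P hpp hqq hp2 φ f‖ ≤ M * ‖f‖) → c * ‖φ‖ ≤ M) ∧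
      ∀ L : HStar P p q hpp.lt.le hqq.lt.le →L[ℝ] ℝ, ∃ φ, ∀ f, pairing P hpp hqq hp2 φ f = L f := by
  obtain ⟨C₁, hC₁, h₁⟩ := exists_maximal_le hp2 hqq.symm.lt.le
  obtain ⟨C₂, hC₂, h₂⟩ := exists_condSquare_le hp2 hqq.symm.lt.le
  obtain ⟨C₃, hC₃, h₃⟩ := exists_dual_norm_le hpp hqq
  -- Adding 1 keeps the final constants positive even if the constants of the inequalities vanish.
  have hD : 0 < (C₂ * C₃).toReal + 1 := by positivity
  refine ⟨1 / ((C₂ * C₃).toReal + 1), C₁.toReal + 1, by positivity, by positivity,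
    fun P _ ↦ ?_⟩
  have bound : ∀ φ f, ‖pairing P hpp hqq hp2 φ f‖ ≤ (C₁.toReal + 1) * ‖φ‖ * ‖f‖ := by
    intro φ f
    have h := abs_integral_limit_mul_le hpp hqq f.mart_mem.2 φ.mart_mem.2 f.lt_top.ne
      (φ.maximal_ne_top hp2)
    have h' := ENNReal.toReal_mono (ENNReal.mul_ne_top hC₁ φ.add_lt_top.ne)
      (h₁ P _ φ.mart_mem)
    rw [ENNReal.toReal_mul, ← HsBD.norm_eq'] at h'
    rw [pairing_apply, Real.norm_eq_abs]
    refine h.trans ?_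
    rw [← HStar.norm_eq, mul_comm]
    refine mul_le_mul_of_nonneg_right (h'.trans ?_) (norm_nonneg f)
    exact mul_le_mul_of_nonneg_right (by linarith) (norm_nonneg φ)
  refine ⟨bound, fun φ M hM hφ ↦ ?_, fun L ↦ ?_⟩
  · have h4 := h₃ P φ.mart φ.mart_mem (fun f ↦ pairing P hpp hqq hp2 φ f) M hM hφ
      fun N g hg ↦ pairing_testMap hpp hqq hp2 φ N g hg
    have h5 : ‖φ‖ ≤ (C₂ * C₃).toReal * M := by
      rw [HsBD.norm_eq', ← ENNReal.toReal_ofReal hM, ← ENNReal.toReal_mul]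
      refine ENNReal.toReal_mono
        (ENNReal.mul_ne_top (ENNReal.mul_ne_top hC₂ hC₃) ENNReal.ofReal_ne_top) ?_
      rw [mul_assoc]
      exact (h₂ P _ φ.mart_mem).trans (mul_le_mul_right h4 _)
    rw [one_div, inv_mul_eq_div, div_le_iff₀ hD]
    linarith
  -- The representing φ is built from the values of L on the martingales generated by dyadic
  -- indicators.
  · set ℓ : testFunctions →ₗ[ℝ] ℝ := L.toLinearMap ∘ₗ testMap P p q hpp.lt.le hqq.lt.le with hℓ
    have hzero : ∀ g, ‖testMap P p q hpp.lt.le hqq.lt.le g‖ = 0 → ℓ g = 0 := by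
      intro g hg
      have h := L.le_opNorm (testMap P p q hpp.lt.le hqq.lt.le g)
      rw [hg, mul_zero] at h
      exact norm_le_zero_iff.1 h
    have h0 : ∀ g : testFunctions, g.1 =ᵐ[P] 0 → ℓ g = 0 := fun g hg ↦
      hzero g (norm_testMap_of_ae_zero hg)
    have hmem : dualMart P ℓ ∈ martingales P :=
      dualMart_mem h0 fun g hg ↦ hzero g (norm_testMap_of_measurable hg)
    have h4 := h₃ P _ hmem L ‖L‖ (norm_nonneg L) (fun f ↦ L.le_opNorm f)
      fun N g hg ↦ apply_eq_integral_dualMart h0 N g hg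
    have h5 := (h₂ P _ hmem).trans (mul_le_mul_right h4 C₂)
    have h6 : amalgamNorm P p' q' (condSquare P (dualMart P ℓ)) +
        amalgamNorm P p' q' (maxJump (dualMart P ℓ)) < ∞ :=
      h5.trans_lt (ENNReal.mul_lt_top hC₂.lt_top
        (ENNReal.mul_lt_top hC₃.lt_top ENNReal.ofReal_lt_top))
    obtain ⟨h7, h8⟩ := ENNReal.add_lt_top.1 h6
    let φ : HsBD P p' q' hpp.symm.lt.le hqq.symm.lt.le :=
      (⟨dualMart P ℓ, ⟨hmem, h7⟩, ⟨hmem, h8⟩⟩ : ((condNorm P p' q' _ _).space ⊓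
        (jumpNorm P p' q' _ _).space : Submodule ℝ (ℕ → ℝ → ℝ)))
    refine ⟨φ, fun f ↦ ?_⟩
    -- Both functionals are continuous and agree on the approximating martingales, hence at f.
    have t := tendsto_testMap_trunc f
    have t1 := (L.continuous.tendsto f).comp t
    have hcont : Continuous (pairing P hpp hqq hp2 φ) :=
      ((pairing P hpp hqq hp2 φ).mkContinuous _ (bound φ)).continuous
    have t2 := (hcont.tendsto f).comp t
    refine tendsto_nhds_unique t2 (t1.congr fun N ↦ ?_)
    have hm := measurable_trunc (P := P) f.mart_mem.2 N
    have e1 := pairing_testMap hpp hqq hp2 φ N ⟨trunc f.mart N, trunc_mem f.mart_mem.2 N⟩ hm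
    have e2 := apply_eq_integral_dualMart h0 N ⟨trunc f.mart N, trunc_mem f.mart_mem.2 N⟩ hm
    exact e2.trans e1.symm

end

end DyadicAmalgam

end

/-! ### The duality theorem. -/

theorem mainTheorem6 (p q p' q' : ℝ) (hq : 1 < q) (hqp : q ≤ p) (hp : p ≤ 2)
    (hpp' : p.HolderConjugate p') (hqq' : q.HolderConjugate q') :
    ∃ c C : ℝ, 0 < c ∧ 0 < C ∧ ∀ (P : Measure ℝ) [IsProbabilityMeasure P],
      ∃ κ : SeparationQuotient (DyadicAmalgam.HsBD P p' q' hpp'.symm.lt.le hqq'.symm.lt.le) ≃L[ℝ]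
          StrongDual ℝ (SeparationQuotient
            (DyadicAmalgam.HStar P p q hpp'.lt.le hqq'.lt.le)),
        (∀ (φ : DyadicAmalgam.HsBD P p' q' hpp'.symm.lt.le hqq'.symm.lt.le)
          (f : DyadicAmalgam.HStar P p q hpp'.lt.le hqq'.lt.le),
          Integrable (fun x ↦ DyadicAmalgam.limit P f.mart x * DyadicAmalgam.limit P φ.mart x) P ∧
          κ (SeparationQuotient.mk φ) (SeparationQuotient.mk f) =
            ∫ x, DyadicAmalgam.limit P f.mart x * DyadicAmalgam.limit P φ.mart x ∂P) ∧
        ∀ φ, c * ‖φ‖ ≤ ‖κ φ‖ ∧ ‖κ φ‖ ≤ C * ‖φ‖ := by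
  -- From (p - 1) p' = p: if p' < 2 then p < 2(p - 1), that is p > 2.
  have hp2 : 2 ≤ p' := by
    have h := hpp'.sub_one_mul_conj
    have := hpp'.symm.lt
    nlinarith
  obtain ⟨c, C, hc, hC, h⟩ := DyadicAmalgam.exists_pairing_bounds hpp' hqq' hp2
  refine ⟨c, C, hc, hC, fun P _ ↦ ?_⟩
  obtain ⟨h1, h2, h3⟩ := h P
  obtain ⟨κ, hκ, hb⟩ := DyadicAmalgam.exists_equiv_of_pairing
    (DyadicAmalgam.pairing P hpp' hqq' hp2) hc hC.le h1 h2 h3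
  exact ⟨κ, fun φ f ↦ ⟨DyadicAmalgam.integrable_limit_mul hpp' hqq' f.mart_mem.2 φ.mart_mem.2
    f.lt_top.ne (φ.maximal_ne_top hp2), hκ φ f⟩, hb⟩
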